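/- An instance of $1|er|\sum w_jU_j$ consists of a finite set $J$ of $n$ jobs with processing times $p_j\in\mathbb{Z}_{\ge 0}$, weights $w_j\in\mathbb{Z}_{\ge 0}$ and due dates $d_j\in\mathbb{Z}$ for $j\in J$, a subset $J^r\subseteq J$ of jobs that require an external resource, and a budget $K^r\in\mathbb{Z}$. Put $P=\sum_{j\in J}p_j$ and assume $P\ge 1$. A sequence $\sigma$ of all jobs is processed on a single machine from time $0$ on, one job after the other without interruption; $C_j^\sigma$ is the completion time of job $j$, and $U_j^\sigma=1$ if $C_j^\sigma>d_j$ and $U_j^\sigma=0$ otherwise. The length of the renting period is $$er(\sigma)=\max_{j\in J^r}C_j^\sigma-\min_{j\in J^r}(C_j^\sigma-p_j)\qquad(er(\sigma)=0\text{ if }J^r=\emptyset).$$ The problem is to find a sequence $\sigma$ that minimizes $\sum_{j\in J}w_jU_j^\sigma$ among all sequences with $er(\sigma)\le K^r$, or to report that there is no such sequence. **Theorem.** The problem $1|er|\sum w_jU_j$ can be solved in $O(nP^4)$ time. That is, there are a single deterministic word-RAM program and a constant $c$ such that on every instance the program halts with a correct answer (an optimal sequence, or the report that no sequence is feasible) after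 at most $c\,nP^4$ steps. Here additions, subtractions, multiplications, comparisons and memory accesses on machine words take one step each, and all numbers that occur have absolute value at most $(2+M)^k$, where $k$ is a constant and $M=n+P+\sum_jw_j+\sum_j|d_j|+|K^r|$; so words of $O(\log (2+M))$ bits suffice. -/

import Mathlib

/-! ### The scheduling problem -/

namespace Renting

/-- An instance of single-machine scheduling with an external resource: jobs `0, …, n - 1` with
processing times, weights and due dates, the set of jobs that need the external resource
(the r-jobs), and the budget for the length of the renting period. -/
structure Inst where
  n : ℕ
  p : Fin n → ℕ
  w : Fin n → ℕ
  d : Fin n → ℤ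
  rJobs : Finset (Fin n)
  budget : ℤ

namespace Inst

variable (I : Inst)

/-- The total processing time `P`. -/
def totalP : ℕ := ∑ j, I.p j

/-- The total weight `W`. -/
def totalW : ℕ := ∑ j, I.w j

/-- A sequence lists every job once: `σ i` is the job in position `i`. -/
abbrev Sequence : Type := Equiv.Perm (Fin I.n)

/-- Completion time of job `j`: the jobs are processed one after the other, starting at time `0`. -/
def completion (σ : I.Sequence) (j : Fin I.n) : ℤ :=
  ∑ i ∈ Finset.univ.filter (fun i => i ≤ σ.symm j), (I.p (σ i) : ℤ)

/-- Length of the renting period: from the start of the first r-job to the completion of the last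
one. Without r-jobs nothing is rented and the length is `0`. -/
def rentLength (σ : I.Sequence) : ℤ :=
  if h : I.rJobs.Nonempty then
    I.rJobs.sup' h (fun j => I.completion σ j)
      - I.rJobs.inf' h (fun j => I.completion σ j - (I.p j : ℤ))
  else 0

/-- Weighted number of tardy jobs. -/
def tardyWeight (σ : I.Sequence) : ℕ :=
  ∑ j, I.w j * (if I.d j < I.completion σ j then 1 else 0)

/-- The sequence respects the renting budget. -/
def Feasible (σ : I.Sequence) : Prop := I.rentLength σ ≤ I.budget

/-- The sequence minimizes the weighted number of tardy jobs among all feasible sequences. -/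
def Optimal (σ : I.Sequence) : Prop :=
  I.Feasible σ ∧ ∀ τ : I.Sequence, I.Feasible τ → I.tardyWeight σ ≤ I.tardyWeight τ

/-- A measure of the magnitude of the numbers in the instance; machine words have a number of bits
that is logarithmic in it. -/
def magnitude : ℕ :=
  I.n + I.totalP + I.totalW + (∑ j, (I.d j).natAbs) + I.budget.natAbs

end Inst

/-! ### The machine model: structured programs for a word RAM

A program uses finitely many scalar variables and finitely many arrays (each addressed by a fixed
number), all holding integers. Each arithmetic operation, each comparison and each memory access
costs one time unit, and every number that occurs has to fit into a machine word. -/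

structure State where
  var : ℕ → ℤ
  arr : ℕ → ℤ → ℤ

namespace State

def setVar (s : State) (x : ℕ) (v : ℤ) : State :=
  { s with var := Function.update s.var x v }

def setArr (s : State) (a : ℕ) (i v : ℤ) : State :=
  { s with arr := Function.update s.arr a (Function.update (s.arr a) i v) }

end State

inductive Expr where
  | const (c : ℤ)
  | var (x : ℕ)
  | read (a : ℕ) (i : Expr)
  | add (e f : Expr)
  | sub (e f : Expr)
  | mul (e f : Expr)

namespace Expr

def eval (s : State) : Expr → ℤ
  | const c => c
  | var x => s.var x
  | read a i => s.arr a (i.eval s)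
  | add e f => e.eval s + f.eval s
  | sub e f => e.eval s - f.eval s
  | mul e f => e.eval s * f.eval s

/-- Time for evaluating an expression: one unit for each of its nodes. -/
def cost : Expr → ℕ
  | const _ => 1
  | var _ => 1
  | read _ i => i.cost + 1
  | add e f => e.cost + f.cost + 1
  | sub e f => e.cost + f.cost + 1
  | mul e f => e.cost + f.cost + 1

/-- All numbers that occur in the evaluation have absolute value at most `B`. -/
def Fits (B : ℕ) (s : State) : Expr → Prop
  | const c => |c| ≤ (B : ℤ)
  | var x => |s.var x| ≤ (B : ℤ)
  | read a i => i.Fits B s ∧ |s.arr a (i.eval s)| ≤ (B : ℤ)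
  | add e f => e.Fits B s ∧ f.Fits B s ∧ |e.eval s + f.eval s| ≤ (B : ℤ)
  | sub e f => e.Fits B s ∧ f.Fits B s ∧ |e.eval s - f.eval s| ≤ (B : ℤ)
  | mul e f => e.Fits B s ∧ f.Fits B s ∧ |e.eval s * f.eval s| ≤ (B : ℤ)

end Expr

/-- Tests. -/
inductive Cond where
  | le (e f : Expr)
  | not (b : Cond)
  | and (b c : Cond)

namespace Cond

def Holds (s : State) : Cond → Prop
  | le e f => e.eval s ≤ f.eval s
  | not b => ¬ b.Holds s
  | and b c => b.Holds s ∧ c.Holds s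

def cost : Cond → ℕ
  | le e f => e.cost + f.cost + 1
  | not b => b.cost + 1
  | and b c => b.cost + c.cost + 1

def Fits (B : ℕ) (s : State) : Cond → Prop
  | le e f => e.Fits B s ∧ f.Fits B s
  | not b => b.Fits B s
  | and b c => b.Fits B s ∧ c.Fits B s

end Cond

/-- Programs. -/
inductive Prog where
  | skip
  | assign (x : ℕ) (e : Expr)
  | write (a : ℕ) (i e : Expr)
  | seq (c₁ c₂ : Prog)
  | ite (b : Cond) (c₁ c₂ : Prog)
  | loop (b : Cond) (c : Prog)

/-- `Exec B c s s' t`: started in state `s`, the program `c` halts in state `s'` after `t` time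
units, and every number that it handles has absolute value at most `B`. The constructor
`loop b c` stands for "while `b` do `c`". -/
inductive Exec (B : ℕ) : Prog → State → State → ℕ → Prop where
  | skip (s : State) : Exec B Prog.skip s s 1
  | assign (s : State) (x : ℕ) (e : Expr) (he : e.Fits B s) :
      Exec B (Prog.assign x e) s (s.setVar x (e.eval s)) (e.cost + 1)
  | write (s : State) (a : ℕ) (i e : Expr) (hi : i.Fits B s) (he : e.Fits B s) :
      Exec B (Prog.write a i e) s (s.setArr a (i.eval s) (e.eval s)) (i.cost + e.cost + 1)
  | seq (c₁ c₂ : Prog) (s s₁ s₂ : State) (t₁ t₂ : ℕ)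
      (h₁ : Exec B c₁ s s₁ t₁) (h₂ : Exec B c₂ s₁ s₂ t₂) :
      Exec B (Prog.seq c₁ c₂) s s₂ (t₁ + t₂ + 1)
  | iteTrue (b : Cond) (c₁ c₂ : Prog) (s s' : State) (t : ℕ)
      (hf : b.Fits B s) (hb : b.Holds s) (h : Exec B c₁ s s' t) :
      Exec B (Prog.ite b c₁ c₂) s s' (b.cost + t + 1)
  | iteFalse (b : Cond) (c₁ c₂ : Prog) (s s' : State) (t : ℕ)
      (hf : b.Fits B s) (hb : ¬ b.Holds s) (h : Exec B c₂ s s' t) :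
      Exec B (Prog.ite b c₁ c₂) s s' (b.cost + t + 1)
  | loopTrue (b : Cond) (c : Prog) (s s₁ s₂ : State) (t₁ t₂ : ℕ)
      (hf : b.Fits B s) (hb : b.Holds s)
      (h₁ : Exec B c s s₁ t₁) (h₂ : Exec B (Prog.loop b c) s₁ s₂ t₂) :
      Exec B (Prog.loop b c) s s₂ (b.cost + t₁ + t₂ + 1)
  | loopFalse (b : Cond) (c : Prog) (s : State)
      (hf : b.Fits B s) (hb : ¬ b.Holds s) :
      Exec B (Prog.loop b c) s s (b.cost + 1)

/-! ### Input and output -/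

/-- The array with the entries of `f` in cells `0, …, n - 1` and `0` in all other cells. -/
def toArray {n : ℕ} (f : Fin n → ℤ) (i : ℤ) : ℤ :=
  if h : 0 ≤ i ∧ i.toNat < n then f ⟨i.toNat, h.2⟩ else 0

namespace Inst

variable (I : Inst)

/-- Initial state: variable `0` holds `n`, variable `1` the budget, and arrays `0, 1, 2, 3` hold the
processing times, the due dates, the weights, and the indicator of the r-jobs, for the jobs in
their given (arbitrary) order. Everything else is `0`. -/
def input : State where
  var x := match x with
    | 0 => (I.n : ℤ)
    | 1 => I.budget
    | _ => 0
  arr a := match a with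
    | 0 => toArray (fun j => (I.p j : ℤ))
    | 1 => toArray I.d
    | 2 => toArray (fun j => (I.w j : ℤ))
    | 3 => toArray (fun j => if j ∈ I.rJobs then 1 else 0)
    | _ => fun _ => 0

/-- The final state is a correct answer: either variable `2` holds `1` and the first `n` cells of
array `4` list an optimal sequence, or variable `2` holds `0` and there is no feasible sequence. -/
def Answered (s : State) : Prop :=
  (s.var 2 = 1 ∧ ∃ σ : I.Sequence, I.Optimal σ ∧
      ∀ i : Fin I.n, s.arr 4 (i : ℤ) = ((σ i : ℕ) : ℤ)) ∨
    (s.var 2 = 0 ∧ ∀ σ : I.Sequence, ¬ I.Feasible σ)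

end Inst

end Renting

/-!
The problem is solved by a dynamic program with `O(n * P ^ 4)` table entries, each of which is
computed in constant time, and this program is implemented and verified on the machine model.

**The structure of optimal sequences.** Let `R` be the total length of the r-jobs. A feasible
sequence exists exactly if `R` is within the budget: the r-jobs can be processed consecutively. The
jobs are divided into five classes that are processed one after the other: early jobs before the
renting period (`0`), early jobs in it (`1`), tardy r-jobs at its end (`2`), early jobs after it
(`3`), and the other tardy jobs (`4`). Within the classes of early jobs the order of due dates can
be used. The dynamic program goes through the jobs in this order and decides on the class of each of
them.

It has to know the start `s` of the renting period, which is fixed in advance, the total lengths `v`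
and `m` of the r-jobs and the other jobs in class `1`, and the total lengths of the classes `0` and
`3`. All of them range over `0, …, P`, which would give five dimensions. One dimension is saved by
the following exchange. Let `i` be the first job of class `3` in the order of due dates. All early
jobs without resource requirement that come after `i` in this order can be moved to class `3` as
well: for such a job `j`, let `k` be the last job of the given sequence among those that were in
class `3` from the start and come no later than `j` in the order of due dates. All jobs that now
precede `j` were processed no later than `k`, and so was `j`; hence `j` is now completed by the time
when `k` was completed, which is at most the due date of `k` and so at most that of `j`. Thus the
classes `0` and `1` can be closed for jobs without resource requirement when class `3` is opened.
From then on `m` does not change and the length of class `0` is irrelevant, so that one entry `x` of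
the state serves for the classes `0` and `3`, with a flag `b` that tells which of them is meant.
`DP.run_iff_fit` translates paths through these states into conditions on the classes;
`Inst.exists_sequence_of_run` and `Inst.Feasible.exists_run` turn a path into a sequence and a
sequence into a path, without increasing the cost. Due dates are moved into `[-1, P]` first, which
does not affect which jobs are tardy. `DP.value_le_cost` and `DP.plan_spec` say that the recursion
computes the cheapest path.

**The implementation.** `Runs` is a Hoare logic with time bounds, whose main rules are for loop-free
code (`Runs.of_loopFree`), sequences (`Runs.seq`) and counting loops (`Runs.forLoop'`). Word sizes
are dealt with once and for all: if the memory cells are bounded by `Y` whenever a loop is entered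
or repeated, then all intermediate results are bounded by a power of `Y` whose exponent is
determined by the program (`Prog.growth`); so only the contents of the memory have to be bounded
explicitly. The jobs are sorted by buckets (`collectProg_runs`), because `n * log n` is not bounded
by `n * P ^ 4` when there are many jobs of length `0`; the same procedure finally arranges the jobs
by classes. `chooseProg_run` is the recursion of the dynamic program, `tableProg_runs` fills the
table layer by layer from the last job to the first, and `planProg_runs` follows an optimal path.
`exists_mainTime_le` bounds the running time.
-/

namespace Renting

/-! ### Program logic -/

namespace Expr

instance : Add Expr := ⟨Expr.add⟩
instance : Sub Expr := ⟨Expr.sub⟩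
instance : Mul Expr := ⟨Expr.mul⟩

@[simp] theorem eval_const (s : State) (c : ℤ) : (const c).eval s = c := rfl
@[simp] theorem eval_var (s : State) (x : ℕ) : (var x).eval s = s.var x := rfl
@[simp] theorem eval_read (s : State) (a : ℕ) (i : Expr) :
    (read a i).eval s = s.arr a (i.eval s) := rfl
@[simp] theorem eval_add (s : State) (e f : Expr) : (e + f).eval s = e.eval s + f.eval s := rfl
@[simp] theorem eval_sub (s : State) (e f : Expr) : (e - f).eval s = e.eval s - f.eval s := rfl
@[simp] theorem eval_mul (s : State) (e f : Expr) : (e * f).eval s = e.eval s * f.eval s := rfl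

/-- An exponent `g` such that the evaluation stays below `Y ^ g` if all memory cells hold numbers of
absolute value at most `Y`, for every `Y ≥ 2`. -/
def growth : Expr → ℕ
  | const c => c.natAbs + 1
  | var _ => 1
  | read _ i => i.growth + 1
  | add e f => e.growth + f.growth + 1
  | sub e f => e.growth + f.growth + 1
  | mul e f => e.growth + f.growth

theorem Fits.mono {B B' : ℕ} (h : B ≤ B') {s : State} : ∀ {e : Expr}, e.Fits B s → e.Fits B' s := by
  have hB : (B : ℤ) ≤ B' := by exact_mod_cast h
  intro e
  induction e with
  | const c => exact fun he => le_trans he hB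
  | var x => exact fun he => le_trans he hB
  | read a i ih => exact fun he => ⟨ih he.1, he.2.trans hB⟩
  | add e f ihe ihf => exact fun he => ⟨ihe he.1, ihf he.2.1, he.2.2.trans hB⟩
  | sub e f ihe ihf => exact fun he => ⟨ihe he.1, ihf he.2.1, he.2.2.trans hB⟩
  | mul e f ihe ihf => exact fun he => ⟨ihe he.1, ihf he.2.1, he.2.2.trans hB⟩

end Expr

namespace Cond

@[simp] theorem holds_le (s : State) (e f : Expr) :
    (le e f).Holds s ↔ e.eval s ≤ f.eval s := Iff.rfl
@[simp] theorem holds_not (s : State) (b : Cond) : (not b).Holds s ↔ ¬ b.Holds s := Iff.rfl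
@[simp] theorem holds_and (s : State) (b c : Cond) :
    (and b c).Holds s ↔ b.Holds s ∧ c.Holds s := Iff.rfl

/-- The analogue of `Expr.growth` for tests. -/
def growth : Cond → ℕ
  | le e f => e.growth + f.growth
  | not b => b.growth
  | and b c => b.growth + c.growth

theorem Fits.mono {B B' : ℕ} (h : B ≤ B') {s : State} : ∀ {b : Cond}, b.Fits B s → b.Fits B' s := by
  intro b
  induction b with
  | le e f => exact fun he => ⟨he.1.mono h, he.2.mono h⟩
  | not b ih => exact fun hb => ih hb
  | and b c ihb ihc => exact fun hb => ⟨ihb hb.1, ihc hb.2⟩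

end Cond

/-- All memory cells hold numbers of absolute value at most `Y`. -/
structure State.Small (Y : ℕ) (s : State) : Prop where
  var : ∀ x, |s.var x| ≤ (Y : ℤ)
  arr : ∀ a i, |s.arr a i| ≤ (Y : ℤ)

namespace State

@[simp] theorem setVar_var (s : State) (x : ℕ) (v : ℤ) (y : ℕ) :
    (s.setVar x v).var y = if y = x then v else s.var y := by
  simp [setVar, Function.update_apply]

@[simp] theorem setVar_arr (s : State) (x : ℕ) (v : ℤ) : (s.setVar x v).arr = s.arr := rfl

@[simp] theorem setArr_var (s : State) (a : ℕ) (i v : ℤ) : (s.setArr a i v).var = s.var := rfl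

@[simp] theorem setArr_arr (s : State) (a : ℕ) (i v : ℤ) (b : ℕ) (l : ℤ) :
    (s.setArr a i v).arr b l = if b = a ∧ l = i then v else s.arr b l := by
  by_cases h : b = a
  · subst h; simp [setArr, Function.update_apply]
  · simp [setArr, h]

theorem Small.mono {Y Y' : ℕ} (h : Y ≤ Y') {s : State} (hs : s.Small Y) : s.Small Y' :=
  ⟨fun x => (hs.var x).trans (by exact_mod_cast h),
    fun a i => (hs.arr a i).trans (by exact_mod_cast h)⟩

theorem Small.setVar {Y : ℕ} {s : State} (hs : s.Small Y) {x : ℕ} {v : ℤ} (hv : |v| ≤ (Y : ℤ)) :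
    (s.setVar x v).Small Y := by
  refine ⟨fun y => ?_, hs.arr⟩
  rw [setVar_var]
  split_ifs
  exacts [hv, hs.var y]

theorem Small.setArr {Y : ℕ} {s : State} (hs : s.Small Y) {a : ℕ} {i v : ℤ} (hv : |v| ≤ (Y : ℤ)) :
    (s.setArr a i v).Small Y := by
  refine ⟨hs.var, fun b l => ?_⟩
  rw [setArr_arr]
  split_ifs
  exacts [hv, hs.arr b l]

end State

theorem Expr.growth_pos (e : Expr) : 1 ≤ e.growth := by
  induction e <;> simp only [Expr.growth] <;> omega

/-- Since `Y ≥ 2`, a sum of two numbers below powers of `Y` is below `Y` to one more than the sum of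
the exponents; this also covers constants, which are below `Y ^ (|c| + 1)`. -/
theorem Expr.fits_of_small {Y : ℕ} (hY : 2 ≤ Y) {s : State} (hs : s.Small Y) (e : Expr) :
    e.Fits (Y ^ e.growth) s ∧ |e.eval s| ≤ ((Y ^ e.growth : ℕ) : ℤ) := by
  have hY1 : 1 ≤ Y := by omega
  have sum_le (a b : ℕ) : Y ^ a + Y ^ b ≤ Y ^ (a + b + 1) := by
    have h1 : Y ^ a ≤ Y ^ (a + b) := Nat.pow_le_pow_right hY1 (by omega)
    have h2 : Y ^ b ≤ Y ^ (a + b) := Nat.pow_le_pow_right hY1 (by omega)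
    calc Y ^ a + Y ^ b ≤ Y ^ (a + b) * 2 := by omega
      _ ≤ Y ^ (a + b) * Y := Nat.mul_le_mul_left _ hY
      _ = Y ^ (a + b + 1) := (pow_succ _ _).symm
  induction e with
  | const c =>
    have : |c| ≤ ((Y ^ (c.natAbs + 1) : ℕ) : ℤ) := by
      have h1 : c.natAbs + 1 < Y ^ (c.natAbs + 1) := Nat.lt_pow_self (by omega)
      rw [Int.abs_eq_natAbs]
      exact_mod_cast (by omega : c.natAbs ≤ Y ^ (c.natAbs + 1))
    exact ⟨this, this⟩
  | var x =>
    have : |s.var x| ≤ ((Y ^ 1 : ℕ) : ℤ) := by simpa using hs.var x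
    exact ⟨this, this⟩
  | read a i ih =>
    have h1 : |s.arr a (i.eval s)| ≤ ((Y ^ (i.growth + 1) : ℕ) : ℤ) := by
      refine (hs.arr a _).trans ?_
      exact_mod_cast Nat.le_self_pow (by omega) Y
    exact ⟨⟨ih.1.mono (Nat.pow_le_pow_right hY1 (by simp [growth])), h1⟩, h1⟩
  | add e f ihe ihf =>
    have h1 : |e.eval s + f.eval s| ≤ ((Y ^ (e.growth + f.growth + 1) : ℕ) : ℤ) := by
      refine (abs_add_le _ _).trans ((add_le_add ihe.2 ihf.2).trans ?_)
      exact_mod_cast sum_le _ _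
    exact ⟨⟨ihe.1.mono (Nat.pow_le_pow_right hY1 (by simp only [growth]; omega)),
      ihf.1.mono (Nat.pow_le_pow_right hY1 (by simp only [growth]; omega)), h1⟩, h1⟩
  | sub e f ihe ihf =>
    have h1 : |e.eval s - f.eval s| ≤ ((Y ^ (e.growth + f.growth + 1) : ℕ) : ℤ) := by
      refine (abs_sub _ _).trans ((add_le_add ihe.2 ihf.2).trans ?_)
      exact_mod_cast sum_le _ _
    exact ⟨⟨ihe.1.mono (Nat.pow_le_pow_right hY1 (by simp only [growth]; omega)),
      ihf.1.mono (Nat.pow_le_pow_right hY1 (by simp only [growth]; omega)), h1⟩, h1⟩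
  | mul e f ihe ihf =>
    have h1 : |e.eval s * f.eval s| ≤ ((Y ^ (e.growth + f.growth) : ℕ) : ℤ) := by
      rw [abs_mul, pow_add, Nat.cast_mul]
      exact mul_le_mul ihe.2 ihf.2 (abs_nonneg _) (by positivity)
    exact ⟨⟨ihe.1.mono (Nat.pow_le_pow_right hY1 (by simp only [growth]; omega)),
      ihf.1.mono (Nat.pow_le_pow_right hY1 (by simp only [growth]; omega)), h1⟩, h1⟩

theorem Cond.fits_of_small {Y : ℕ} (hY : 2 ≤ Y) {s : State} (hs : s.Small Y) (b : Cond) :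
    b.Fits (Y ^ b.growth) s := by
  have hY1 : 1 ≤ Y := by omega
  induction b with
  | le e f =>
    exact ⟨(e.fits_of_small hY hs).1.mono (Nat.pow_le_pow_right hY1 (by simp [growth])),
      (f.fits_of_small hY hs).1.mono (Nat.pow_le_pow_right hY1 (by simp [growth]))⟩
  | not b ih => exact ih
  | and b c ihb ihc =>
    exact ⟨ihb.mono (Nat.pow_le_pow_right hY1 (by simp [growth])),
      ihc.mono (Nat.pow_le_pow_right hY1 (by simp [growth]))⟩

theorem Exec.mono {B B' : ℕ} (h : B ≤ B') {c : Prog} {s s' : State} {t : ℕ}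
    (hc : Exec B c s s' t) : Exec B' c s s' t := by
  induction hc with
  | skip s => exact .skip s
  | assign s x e he => exact .assign s x e (he.mono h)
  | write s a i e hi he => exact .write s a i e (hi.mono h) (he.mono h)
  | seq c₁ c₂ s s₁ s₂ t₁ t₂ _ _ ih₁ ih₂ => exact .seq c₁ c₂ s s₁ s₂ t₁ t₂ ih₁ ih₂
  | iteTrue b c₁ c₂ s s' t hf hb _ ih => exact .iteTrue b c₁ c₂ s s' t (hf.mono h) hb ih
  | iteFalse b c₁ c₂ s s' t hf hb _ ih => exact .iteFalse b c₁ c₂ s s' t (hf.mono h) hb ih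
  | loopTrue b c s s₁ s₂ t₁ t₂ hf hb _ _ ih₁ ih₂ =>
    exact .loopTrue b c s s₁ s₂ t₁ t₂ (hf.mono h) hb ih₁ ih₂
  | loopFalse b c s hf hb => exact .loopFalse b c s (hf.mono h) hb

namespace Prog

/-- An exponent `g` such that all numbers that occur have absolute value at most `Y ^ g`, provided
that all memory cells are at most `Y ≥ 2` in absolute value when the program starts and before each
pass through the body of a loop. The exponent of a sequence is a product because the first part
may raise `Y` to a power before the second part starts. The exponent depends on the program alone,
and its value is never needed. -/
def growth : Prog → ℕ
  | skip => 1
  | assign _ e => e.growth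
  | write _ i e => i.growth + e.growth
  | seq c₁ c₂ => c₁.growth * c₂.growth
  | ite b c₁ c₂ => b.growth + c₁.growth + c₂.growth
  | loop b c => b.growth + c.growth

theorem growth_pos (c : Prog) : 1 ≤ c.growth := by
  induction c with
  | skip => exact le_rfl
  | assign x e => exact e.growth_pos
  | write a i e => have := i.growth_pos; simp only [growth]; omega
  | seq c₁ c₂ h₁ h₂ => exact Nat.mul_pos h₁ h₂
  | ite b c₁ c₂ h₁ h₂ => simp only [growth]; omega
  | loop b c h => simp only [growth]; omega

/-- The program contains no loop. -/
def LoopFree : Prog → Prop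
  | skip => True
  | assign _ _ => True
  | write _ _ _ => True
  | seq c₁ c₂ => c₁.LoopFree ∧ c₂.LoopFree
  | ite _ c₁ c₂ => c₁.LoopFree ∧ c₂.LoopFree
  | loop _ _ => False

open Classical in
/-- The state in which a loop-free program halts; loops are ignored. -/
noncomputable def run : Prog → State → State
  | skip, s => s
  | assign x e, s => s.setVar x (e.eval s)
  | write a i e, s => s.setArr a (i.eval s) (e.eval s)
  | seq c₁ c₂, s => c₂.run (c₁.run s)
  | ite b c₁ c₂, s => if b.Holds s then c₁.run s else c₂.run s
  | loop _ _, s => s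

/-- A bound on the running time of a loop-free program. -/
def time : Prog → ℕ
  | skip => 1
  | assign _ e => e.cost + 1
  | write _ i e => i.cost + e.cost + 1
  | seq c₁ c₂ => c₁.time + c₂.time + 1
  | ite b c₁ c₂ => b.cost + (c₁.time + c₂.time) + 1
  | loop _ _ => 0

/-- The program has an assignment to variable `x`. -/
def WritesVar (x : ℕ) : Prog → Prop
  | skip => False
  | assign y _ => x = y
  | write _ _ _ => False
  | seq c₁ c₂ => c₁.WritesVar x ∨ c₂.WritesVar x
  | ite _ c₁ c₂ => c₁.WritesVar x ∨ c₂.WritesVar x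
  | loop _ c => c.WritesVar x

/-- The program has an assignment to cells of array `a`. -/
def WritesArr (a : ℕ) : Prog → Prop
  | skip => False
  | assign _ _ => False
  | write b _ _ => a = b
  | seq c₁ c₂ => c₁.WritesArr a ∨ c₂.WritesArr a
  | ite _ c₁ c₂ => c₁.WritesArr a ∨ c₂.WritesArr a
  | loop _ c => c.WritesArr a

/-- The programs of the list, one after the other. -/
def block : List Prog → Prog
  | [] => skip
  | c :: cs => seq c (block cs)

end Prog

/-- A loop-free program halts in the state `c.run s` whatever the sizes of the numbers; how large
they can get is controlled by `Prog.growth`. -/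
theorem Prog.exec_run {c : Prog} (hc : c.LoopFree) {Y : ℕ} (hY : 2 ≤ Y) {s : State}
    (hs : s.Small Y) :
    (c.run s).Small (Y ^ c.growth) ∧ ∃ t ≤ c.time, Exec (Y ^ c.growth) c s (c.run s) t := by
  classical
  induction c generalizing Y s with
  | skip => exact ⟨hs.mono (by simp [growth]), _, le_rfl, .skip s⟩
  | assign x e =>
    have he := e.fits_of_small hY hs
    have hY1 : Y ≤ Y ^ e.growth := Nat.le_self_pow (by have := e.growth_pos; omega) Y
    exact ⟨(hs.mono hY1).setVar he.2, _, le_rfl, .assign s x e he.1⟩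
  | write a i e =>
    have hi := i.fits_of_small hY hs
    have he := e.fits_of_small hY hs
    have h1 : Y ^ i.growth ≤ Y ^ (write a i e).growth :=
      Nat.pow_le_pow_right (by omega) (by simp [growth])
    have h2 : Y ^ e.growth ≤ Y ^ (write a i e).growth :=
      Nat.pow_le_pow_right (by omega) (by simp [growth])
    refine ⟨(hs.mono ?_).setArr (he.2.trans (by exact_mod_cast h2)),
      _, le_rfl, .write s a i e (hi.1.mono h1) (he.1.mono h2)⟩
    exact Nat.le_self_pow (by have := e.growth_pos; simp only [growth]; omega) Y
  | seq c₁ c₂ ih₁ ih₂ =>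
    obtain ⟨h₁, t₁, ht₁, e₁⟩ := ih₁ hc.1 hY hs
    have hY' : 2 ≤ Y ^ c₁.growth :=
      hY.trans (Nat.le_self_pow (by have := c₁.growth_pos; omega) Y)
    obtain ⟨h₂, t₂, ht₂, e₂⟩ := ih₂ hc.2 hY' h₁
    rw [← pow_mul] at h₂ e₂
    refine ⟨h₂, _, ?_, .seq _ _ _ _ _ _ _ (e₁.mono ?_) e₂⟩
    · simp only [time]; omega
    · exact Nat.pow_le_pow_right (by omega) (Nat.le_mul_of_pos_right _ c₂.growth_pos)
  | ite b c₁ c₂ ih₁ ih₂ =>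
    have hb := (b.fits_of_small hY hs).mono
      (Nat.pow_le_pow_right (by omega) (by simp only [growth]; omega) :
        Y ^ b.growth ≤ Y ^ (ite b c₁ c₂).growth)
    have g₁ : Y ^ c₁.growth ≤ Y ^ (ite b c₁ c₂).growth :=
      Nat.pow_le_pow_right (by omega) (by simp only [growth]; omega)
    have g₂ : Y ^ c₂.growth ≤ Y ^ (ite b c₁ c₂).growth :=
      Nat.pow_le_pow_right (by omega) (by simp only [growth]; omega)
    by_cases h : b.Holds s
    · obtain ⟨h₁, t₁, ht₁, e₁⟩ := ih₁ hc.1 hY hs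
      rw [run, if_pos h]
      exact ⟨h₁.mono g₁, _, by simp only [time]; omega, .iteTrue _ _ _ _ _ _ hb h (e₁.mono g₁)⟩
    · obtain ⟨h₂, t₂, ht₂, e₂⟩ := ih₂ hc.2 hY hs
      rw [run, if_neg h]
      exact ⟨h₂.mono g₂, _, by simp only [time]; omega, .iteFalse _ _ _ _ _ _ hb h (e₂.mono g₂)⟩
  | loop b c => exact hc.elim

theorem Exec.var_eq {B : ℕ} {c : Prog} {s s' : State} {t : ℕ} (h : Exec B c s s' t) {x : ℕ}
    (hx : ¬ c.WritesVar x) : s'.var x = s.var x := by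
  induction h with
  | skip | loopFalse | write => rfl
  | assign s y e he => exact (State.setVar_var ..).trans (if_neg hx)
  | seq c₁ c₂ s s₁ s₂ t₁ t₂ _ _ ih₁ ih₂ =>
    exact (ih₂ fun h => hx (.inr h)).trans (ih₁ fun h => hx (.inl h))
  | iteTrue b c₁ c₂ s s' t _ _ _ ih => exact ih fun h => hx (.inl h)
  | iteFalse b c₁ c₂ s s' t _ _ _ ih => exact ih fun h => hx (.inr h)
  | loopTrue b c s s₁ s₂ t₁ t₂ _ _ _ _ ih₁ ih₂ => exact (ih₂ hx).trans (ih₁ hx)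

theorem Exec.arr_eq {B : ℕ} {c : Prog} {s s' : State} {t : ℕ} (h : Exec B c s s' t) {a : ℕ}
    (ha : ¬ c.WritesArr a) : s'.arr a = s.arr a := by
  induction h with
  | skip | loopFalse | assign => rfl
  | write s b i e =>
    funext l
    exact (State.setArr_arr ..).trans (if_neg fun h => ha h.1)
  | seq c₁ c₂ s s₁ s₂ t₁ t₂ _ _ ih₁ ih₂ =>
    exact (ih₂ fun h => ha (.inr h)).trans (ih₁ fun h => ha (.inl h))
  | iteTrue b c₁ c₂ s s' t _ _ _ ih => exact ih fun h => ha (.inl h)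
  | iteFalse b c₁ c₂ s s' t _ _ _ ih => exact ih fun h => ha (.inr h)
  | loopTrue b c s s₁ s₂ t₁ t₂ _ _ _ _ ih₁ ih₂ => exact (ih₂ ha).trans (ih₁ ha)

/-- Started in state `s`, the program `c` halts within time `T` in a state that satisfies `Q`, and
all numbers that occur have absolute value at most `Y ^ c.growth`. -/
def Runs (Y : ℕ) (c : Prog) (s : State) (T : ℕ) (Q : State → Prop) : Prop :=
  ∃ s' t, Exec (Y ^ c.growth) c s s' t ∧ t ≤ T ∧ Q s'

namespace Runs

variable {Y : ℕ} {c c₁ c₂ : Prog} {s : State} {T T₁ T₂ : ℕ} {Q Q' : State → Prop}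

theorem mono (h : Runs Y c s T₁ Q) (hT : T₁ ≤ T₂) (hQ : ∀ s', Q s' → Q' s') : Runs Y c s T₂ Q' := by
  obtain ⟨s', t, he, ht, hq⟩ := h
  exact ⟨s', t, he, ht.trans hT, hQ s' hq⟩

theorem of_loopFree (hc : c.LoopFree) (hY : 2 ≤ Y) (hs : s.Small Y) (hQ : Q (c.run s)) :
    Runs Y c s c.time Q := by
  obtain ⟨-, t, ht, he⟩ := c.exec_run hc hY hs
  exact ⟨_, t, he, ht, hQ⟩

theorem seq (hY : 2 ≤ Y) (h : Runs Y c₁ s T₁ fun s₁ => Runs Y c₂ s₁ T₂ Q) :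
    Runs Y (Prog.seq c₁ c₂) s (T₁ + T₂ + 1) Q := by
  obtain ⟨s₁, t₁, e₁, ht₁, s₂, t₂, e₂, ht₂, hq⟩ := h
  refine ⟨s₂, _, .seq _ _ _ _ _ _ _ (e₁.mono ?_) (e₂.mono ?_), by omega, hq⟩
  · exact Nat.pow_le_pow_right (by omega) (Nat.le_mul_of_pos_right _ c₂.growth_pos)
  · exact Nat.pow_le_pow_right (by omega) (Nat.le_mul_of_pos_left _ c₁.growth_pos)

theorem seq_run (hc : c₁.LoopFree) (hY : 2 ≤ Y) (hs : s.Small Y) (h : Runs Y c₂ (c₁.run s) T Q) :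
    Runs Y (Prog.seq c₁ c₂) s (c₁.time + T + 1) Q :=
  seq hY (of_loopFree hc hY hs h)

theorem frame (h : Runs Y c s T Q) :
    Runs Y c s T fun s' => Q s' ∧ (∀ x, ¬ c.WritesVar x → s'.var x = s.var x) ∧
      ∀ a, ¬ c.WritesArr a → s'.arr a = s.arr a := by
  obtain ⟨s', t, he, ht, hq⟩ := h
  exact ⟨s', t, he, ht, hq, fun x hx => he.var_eq hx, fun a ha => he.arr_eq ha⟩

theorem ite {b : Cond} (hY : 2 ≤ Y) (hs : s.Small Y) (h₁ : b.Holds s → Runs Y c₁ s T Q)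
    (h₂ : ¬ b.Holds s → Runs Y c₂ s T Q) : Runs Y (Prog.ite b c₁ c₂) s (b.cost + T + 1) Q := by
  have hb := (b.fits_of_small hY hs).mono
    (Nat.pow_le_pow_right (by omega) (by simp only [Prog.growth]; omega) :
      Y ^ b.growth ≤ Y ^ (Prog.ite b c₁ c₂).growth)
  by_cases h : b.Holds s
  · obtain ⟨s', t, he, ht, hq⟩ := h₁ h
    refine ⟨s', _, .iteTrue _ _ _ _ _ _ hb h (he.mono ?_), by omega, hq⟩
    exact Nat.pow_le_pow_right (by omega) (by simp only [Prog.growth]; omega)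
  · obtain ⟨s', t, he, ht, hq⟩ := h₂ h
    refine ⟨s', _, .iteFalse _ _ _ _ _ _ hb h (he.mono ?_), by omega, hq⟩
    exact Nat.pow_le_pow_right (by omega) (by simp only [Prog.growth]; omega)

end Runs

namespace Prog

/-- `body` for `i = 0, …, lim - 1`, where `i` and `lim` are (numbers of) variables. -/
def forLoop (i lim : ℕ) (body : Prog) : Prog :=
  seq (assign i (.const 0))
    (loop (.not (.le (.var lim) (.var i))) (seq body (assign i (.add (.var i) (.const 1)))))

end Prog

/-- The rule for counting loops: the invariant `Inv k` holds before the body is executed with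
`i = k`. The invariant has to bound the memory cells by the same `Y` in every round, so that the
numbers do not grow with the number of rounds. -/
theorem Runs.forLoop {Y : ℕ} (hY : 2 ≤ Y) {i lim : ℕ} {body : Prog} {T N : ℕ} {s : State}
    (Inv : ℕ → State → Prop) (hne : i ≠ lim) (hlim : s.var lim = N)
    (hi : ¬ body.WritesVar i) (hl : ¬ body.WritesVar lim)
    (hsmall : ∀ k s, Inv k s → s.Small Y)
    (hs : s.Small Y) (h0 : Inv 0 (s.setVar i 0))
    (hstep : ∀ k < N, ∀ s, s.var i = (k : ℤ) → s.var lim = (N : ℤ) → Inv k s →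
      Runs Y body s T fun s' => s'.Small Y ∧ Inv (k + 1) (s'.setVar i (k + 1))) :
    Runs Y (Prog.forLoop i lim body) s (N * (T + 10) + 10) (Inv N) := by
  set inc : Prog := .assign i (.add (.var i) (.const 1)) with hinc
  set b : Cond := .not (.le (.var lim) (.var i)) with hb
  set G : ℕ := (Prog.loop b (.seq body inc)).growth with hG
  have hbG : b.growth ≤ G := by simp only [hG, Prog.growth]; omega
  have hbodyG : body.growth ≤ G := by
    have : body.growth ≤ body.growth * inc.growth := Nat.le_mul_of_pos_right _ inc.growth_pos
    simp only [hG, Prog.growth] at this ⊢; omega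
  have hincG : inc.growth ≤ G := by
    have : inc.growth ≤ body.growth * inc.growth := Nat.le_mul_of_pos_left _ body.growth_pos
    simp only [hG, Prog.growth] at this ⊢; omega
  have key : ∀ m k, k + m = N → ∀ s, s.var i = (k : ℤ) → s.var lim = (N : ℤ) → Inv k s →
      ∃ s' t, Exec (Y ^ G) (.loop b (.seq body inc)) s s' t ∧ t ≤ m * (T + 10) + 5 ∧ Inv N s' := by
    intro m
    induction m with
    | zero =>
      intro k hk s h1 h2 h3
      have hk' : k = N := by omega
      subst hk'
      exact ⟨s, _, .loopFalse _ _ _ ((b.fits_of_small hY (hsmall _ _ h3)).mono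
          (Nat.pow_le_pow_right (by omega) hbG)) (by simp [hb, h1, h2]),
        by simp [hb, Cond.cost, Expr.cost], h3⟩
    | succ m ih =>
      intro k hk s h1 h2 h3
      obtain ⟨s₁, t₁, ⟨e₁, ht₁, ⟨hs₁, hI⟩, fv, -⟩⟩ := (hstep k (by omega) s h1 h2 h3).frame
      have hi1 : s₁.var i = (k : ℤ) := (fv i hi).trans h1
      have hl1 : s₁.var lim = (N : ℤ) := (fv lim hl).trans h2
      have e₂ := Exec.assign s₁ i (.add (.var i) (.const 1))
        (((Expr.add (.var i) (.const 1)).fits_of_small hY hs₁).1.mono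
          (Nat.pow_le_pow_right (by omega) hincG))
      have hev : (Expr.add (.var i) (.const 1)).eval s₁ = (k : ℤ) + 1 := by simp [Expr.eval, hi1]
      rw [hev] at e₂
      obtain ⟨s₂, t₂, e₃, ht₂, hN⟩ := ih (k + 1) (by omega) (s₁.setVar i (k + 1)) (by simp)
        (by simp [hne.symm, hl1]) hI
      refine ⟨s₂, _, .loopTrue _ _ _ _ _ _ _ ((b.fits_of_small hY (hsmall _ _ h3)).mono
          (Nat.pow_le_pow_right (by omega) hbG)) (by simp [hb, h1, h2]; omega)
          (.seq _ _ _ _ _ _ _ (e₁.mono (Nat.pow_le_pow_right (by omega) hbodyG)) e₂) e₃, ?_, hN⟩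
      simp only [hb, Cond.cost, Expr.cost, Nat.succ_mul]
      omega
  refine (Runs.seq (T₁ := 4) hY ⟨_, _, .assign s i (.const 0) ?_, by simp [Expr.cost],
    (?_ : Runs Y _ _ (N * (T + 10) + 5) (Inv N))⟩).mono (by omega) fun _ h => h
  · exact ((Expr.const 0).fits_of_small hY hs).1
  · exact key N 0 (by omega) _ (by simp) (by simp [hne.symm, hlim]) h0

/-! ### The dynamic program -/

namespace DP

/-- A job as the dynamic program sees it: `r` is `1` for r-jobs and `0` for all others. -/
structure Job where
  p : ℤ
  d : ℤ
  w : ℤ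
  r : ℤ

/-- A state of the dynamic program, which inserts the jobs in the order of their due dates.
The renting period is scheduled to start at time `s`. The early r-jobs have total length `v`, and
the other early jobs in the renting period have total length `m`. The flag `b` tells whether an
early job was scheduled after the renting period; if so, `x` is the total length of these jobs, and
otherwise `x` is the total length of the jobs before the renting period. -/
structure St where
  b : ℤ
  s : ℤ
  x : ℤ
  v : ℤ
  m : ℤ

variable {ι : Type*} (R K : ℤ)

/-- The job `q` can be put into class `c` in state `t`. The classes are: `0`, early before the
renting period; `1`, early in the renting period; `2`, tardy r-jobs; `3`, early after the renting
period; `4`, tardy jobs without resource requirement. Here `R` is the total length of the r-jobs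
and `K` the budget. Once a job was put into class `3`, the classes `0` and `1` are closed for the
jobs that do not need the resource. -/
def Allowed (q : Job) (c : ℤ) (t : St) : Prop :=
  (c = 1 ∧ q.r = 1 ∧ t.s + t.v + t.m + q.p ≤ q.d) ∨
  (c = 0 ∧ q.r = 0 ∧ t.b = 0 ∧ t.x + q.p ≤ t.s ∧ t.x + q.p ≤ q.d) ∨
  (c = 1 ∧ q.r = 0 ∧ t.b = 0 ∧ t.s + t.v + t.m + q.p ≤ q.d ∧ t.m + q.p + R ≤ K) ∨
  (c = 3 ∧ q.r = 0 ∧ t.s + R + t.m + t.b * t.x + q.p ≤ q.d) ∨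
  c = 4 - 2 * q.r

/-- The state after the job `q` was put into class `c`. -/
def next (q : Job) (c : ℤ) (t : St) : St :=
  if c = 0 then { t with x := t.x + q.p }
  else if c = 1 then
    if q.r = 1 then { t with v := t.v + q.p } else { t with m := t.m + q.p }
  else if c = 3 then { t with b := 1, x := t.b * t.x + q.p }
  else t

/-- What has to be paid for putting the job `q` into class `c`. -/
def price (q : Job) (c : ℤ) : ℤ := if c = 4 - 2 * q.r then q.w else 0

/-- A decision for one job: the class, the state that results, and the total price for this job and
the later ones. -/
structure Choice where
  value : ℤ
  cls : ℤ
  next : St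

open Classical in
/-- Replaces the decision `a` by class `c` with resulting state `t` if this is possible (`A`) and
cheaper, where `g` is the price of the later jobs. -/
noncomputable def better (g : St → ℤ) (A : Prop) (c : ℤ) (t : St) (a : Choice) : Choice :=
  if A ∧ g t < a.value then ⟨g t, c, t⟩ else a

/-- The best decision for the job `q` in state `t` if the later jobs have price `g`. -/
noncomputable def choose (g : St → ℤ) (q : Job) (t : St) : Choice :=
  better g (q.r = 0 ∧ t.s + R + t.m + t.b * t.x + q.p ≤ q.d) 3
      { t with b := 1, x := t.b * t.x + q.p } <|
  better g (q.r = 0 ∧ t.b = 0 ∧ t.s + t.v + t.m + q.p ≤ q.d ∧ t.m + q.p + R ≤ K) 1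
      { t with m := t.m + q.p } <|
  better g (q.r = 0 ∧ t.b = 0 ∧ t.x + q.p ≤ t.s ∧ t.x + q.p ≤ q.d) 0
      { t with x := t.x + q.p } <|
  better g (q.r = 1 ∧ t.s + t.v + t.m + q.p ≤ q.d) 1
      { t with v := t.v + q.p } <|
  ⟨q.w + g t, 4 - 2 * q.r, t⟩

variable {R K}

theorem better_value_le (g : St → ℤ) (A : Prop) (c : ℤ) (t : St) (a : Choice) :
    (better g A c t a).value ≤ a.value := by
  unfold better
  split_ifs with h
  exacts [h.2.le, le_rfl]

theorem better_value_le_of (g : St → ℤ) {A : Prop} (hA : A) (c : ℤ) (t : St) (a : Choice) :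
    (better g A c t a).value ≤ g t := by
  unfold better
  split_ifs with h
  exacts [le_rfl, not_lt.1 fun h' => h ⟨hA, h'⟩]

/-- A choice that obeys the rules and states the correct price. -/
def Choice.Valid (R K : ℤ) (g : St → ℤ) (q : Job) (t : St) (a : Choice) : Prop :=
  Allowed R K q a.cls t ∧ a.next = DP.next q a.cls t ∧ a.value = price q a.cls + g a.next

theorem better_valid {g : St → ℤ} {q : Job} {t : St} {A : Prop} {c : ℤ} {t' : St} {a : Choice}
    (ha : a.Valid R K g q t)
    (h : A → Allowed R K q c t ∧ t' = DP.next q c t ∧ price q c = 0) :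
    (better g A c t' a).Valid R K g q t := by
  unfold better
  split_ifs with hA
  · obtain ⟨h1, h2, h3⟩ := h hA.1
    exact ⟨h1, h2, by simp [h3]⟩
  · exact ha

theorem choose_valid (g : St → ℤ) {q : Job} (hq : q.r = 0 ∨ q.r = 1) (t : St) :
    (choose R K g q t).Valid R K g q t := by
  unfold choose
  refine better_valid (better_valid (better_valid (better_valid ?_ ?_) ?_) ?_) ?_
  · refine ⟨.inr (.inr (.inr (.inr rfl))), ?_, by simp [price]⟩
    rcases hq with h | h <;> simp [next, h]
  · rintro ⟨h1, h2⟩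
    exact ⟨.inl ⟨rfl, h1, h2⟩, by simp [next, h1], by simp [price, h1]⟩
  · rintro ⟨h1, h2⟩
    exact ⟨.inr (.inl ⟨rfl, h1, h2⟩), by simp [next], by simp [price, h1]⟩
  · rintro ⟨h1, h2⟩
    exact ⟨.inr (.inr (.inl ⟨rfl, h1, h2⟩)), by simp [next, h1], by simp [price, h1]⟩
  · rintro ⟨h1, h2⟩
    exact ⟨.inr (.inr (.inr (.inl ⟨rfl, h1, h2⟩))), by simp [next], by simp [price, h1]⟩

/-- No class that is allowed is cheaper than the decision `choose`. -/
theorem choose_value_le (g : St → ℤ) {q : Job} (hq : q.r = 0 ∨ q.r = 1) {t : St} {c : ℤ}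
    (hc : Allowed R K q c t) : (choose R K g q t).value ≤ price q c + g (next q c t) := by
  unfold choose
  rcases hc with ⟨rfl, h⟩ | ⟨rfl, h⟩ | ⟨rfl, h⟩ | ⟨rfl, h⟩ | rfl
  · refine (better_value_le ..).trans ((better_value_le ..).trans ((better_value_le ..).trans
      ((better_value_le_of g h ..).trans ?_)))
    simp [price, next, h.1]
  · refine (better_value_le ..).trans ((better_value_le ..).trans
      ((better_value_le_of g h ..).trans ?_))
    simp [price, next, h.1]
  · refine (better_value_le ..).trans ((better_value_le_of g h ..).trans ?_)
    simp [price, next, h.1]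
  · refine (better_value_le_of g h ..).trans ?_
    simp [price, next, h.1]
  · refine (better_value_le ..).trans ((better_value_le ..).trans ((better_value_le ..).trans
      ((better_value_le ..).trans ?_)))
    rcases hq with h | h <;> simp [price, next, h]

variable (R K)

/-- The least price for the jobs of a list, to be inserted in this order, from a given state on. -/
noncomputable def value : List Job → St → ℤ
  | [], _ => 0
  | q :: L, t => (choose R K (value L) q t).value

variable (job : ι → Job)

/-- The classes that an optimal path of the dynamic program assigns to the jobs of a list; all
other jobs keep their class in `c`. -/
noncomputable def plan [DecidableEq ι] : List ι → St → (ι → ℤ) → (ι → ℤ)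
  | [], _, c => c
  | j :: L, t, c =>
    let a := choose R K (value R K (L.map job)) (job j) t
    plan L a.next (Function.update c j a.cls)

/-- The state after the jobs of a list were put into the classes given by `c`. -/
def after (c : ι → ℤ) : List ι → St → St
  | [], t => t
  | j :: L, t => after c L (next (job j) (c j) t)

/-- The jobs of the list can be put into the classes given by `c`, in the order of the list. -/
def Run (c : ι → ℤ) : List ι → St → Prop
  | [], _ => True
  | j :: L, t => Allowed R K (job j) (c j) t ∧ Run c L (next (job j) (c j) t)

/-- The total price of the classes given by `c`. -/
def cost (c : ι → ℤ) (L : List ι) : ℤ := (L.map fun j => price (job j) (c j)).sum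

variable {R K job}

/-- The value of a state is a lower bound for the price of every path that starts there. -/
theorem value_le_cost (hr : ∀ j, (job j).r = 0 ∨ (job j).r = 1) {c : ι → ℤ} {L : List ι} {t : St}
    (h : Run R K job c L t) : value R K (L.map job) t ≤ cost job c L := by
  induction L generalizing t with
  | nil => simp [value, cost]
  | cons j L ih =>
    have h1 := choose_value_le (value R K (L.map job)) (hr j) h.1
    have h2 := ih h.2
    simp only [cost, List.map_cons, List.sum_cons, value] at h1 h2 ⊢
    linarith

theorem plan_of_notMem [DecidableEq ι] {L : List ι} {t : St} {c : ι → ℤ} {j : ι} (hj : j ∉ L) :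
    plan R K job L t c j = c j := by
  induction L generalizing t c with
  | nil => rfl
  | cons i L ih =>
    rw [List.mem_cons, not_or] at hj
    rw [plan, ih hj.2, Function.update_of_ne hj.1]

/-- The path `plan` obeys the rules and attains the value of the state. -/
theorem plan_spec [DecidableEq ι] (hr : ∀ j, (job j).r = 0 ∨ (job j).r = 1) {L : List ι}
    (hL : L.Nodup) (t : St) (c : ι → ℤ) :
    Run R K job (plan R K job L t c) L t ∧
      cost job (plan R K job L t c) L = value R K (L.map job) t := by
  induction L generalizing t c with
  | nil => exact ⟨trivial, rfl⟩
  | cons j L ih =>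
    rw [List.nodup_cons] at hL
    obtain ⟨h1, h2, h3⟩ := choose_valid (R := R) (K := K) (value R K (L.map job)) (hr j) t
    set a := choose R K (value R K (L.map job)) (job j) t with ha
    have hj : plan R K job (j :: L) t c j = a.cls := by
      rw [plan, plan_of_notMem hL.1]
      simp [ha]
    obtain ⟨ih1, ih2⟩ := ih hL.2 a.next (Function.update c j a.cls)
    have he : plan R K job (j :: L) t c = plan R K job L a.next (Function.update c j a.cls) := rfl
    rw [← he] at ih1 ih2
    refine ⟨⟨by rwa [hj], by rwa [hj, ← h2]⟩, ?_⟩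
    simp only [cost, List.map_cons, List.sum_cons, value] at ih2 ⊢
    rw [ih2, ← ha, h3, hj]

theorem run_append {c : ι → ℤ} {L₁ L₂ : List ι} {t : St} :
    Run R K job c (L₁ ++ L₂) t ↔ Run R K job c L₁ t ∧ Run R K job c L₂ (after job c L₁ t) := by
  induction L₁ generalizing t with
  | nil => simp [Run, after]
  | cons j L ih => simp [Run, after, ih, and_assoc]

theorem after_append {c : ι → ℤ} {L₁ L₂ : List ι} {t : St} :
    after job c (L₁ ++ L₂) t = after job c L₂ (after job c L₁ t) := by
  induction L₁ generalizing t with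
  | nil => rfl
  | cons j L ih => simp [after, ih]

/-- The states whose entries stay in the range of the table. -/
structure St.InBox (P : ℤ) (t : St) : Prop where
  b : 0 ≤ t.b ∧ t.b ≤ 1
  s : 0 ≤ t.s ∧ t.s ≤ P
  x : 0 ≤ t.x ∧ t.x ≤ P
  v : 0 ≤ t.v ∧ t.v ≤ P
  m : 0 ≤ t.m ∧ t.m ≤ P

/-- The properties of the job data that keep the states in the range of the table. -/
structure Job.Good (P : ℤ) (q : Job) : Prop where
  p : 0 ≤ q.p
  d : q.d ≤ P
  w : 0 ≤ q.w
  r : q.r = 0 ∨ q.r = 1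

/-- Early jobs are completed by their due dates, which are at most `P`, so all entries of the states
stay between `0` and `P`. -/
theorem Allowed.inBox {P : ℤ} {q : Job} {c : ℤ} {t : St} (h : Allowed R K q c t) (hR : 0 ≤ R)
    (hq : q.Good P) (ht : t.InBox P) : (next q c t).InBox P := by
  obtain ⟨hb, hs, hx, hv, hm⟩ := ht
  obtain ⟨hp, hd, hw, hr⟩ := hq
  have hbx : 0 ≤ t.b * t.x := mul_nonneg hb.1 hx.1
  rcases h with ⟨rfl, h⟩ | ⟨rfl, h⟩ | ⟨rfl, h⟩ | ⟨rfl, h⟩ | rfl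
  · simp only [next, h.1]
    norm_num
    exact ⟨hb, hs, hx, ⟨by linarith [hv.1], by linarith [hm.1, hs.1]⟩, hm⟩
  · simp only [next]
    norm_num
    exact ⟨hb, hs, ⟨by linarith [hx.1], by linarith⟩, hv, hm⟩
  · simp only [next, h.1]
    norm_num
    exact ⟨hb, hs, hx, hv, ⟨by linarith [hm.1], by linarith [hv.1, hs.1]⟩⟩
  · simp only [next]
    norm_num
    exact ⟨⟨by norm_num, by norm_num⟩, hs, ⟨by linarith, by linarith [hs.1, hm.1]⟩, hv, hm⟩
  · rcases hr with h | h <;> simp only [next, h] <;> norm_num <;> exact ⟨hb, hs, hx, hv, hm⟩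

theorem value_nonneg {P : ℤ} {L : List Job} (hL : ∀ q ∈ L, q.Good P) (t : St) :
    0 ≤ value R K L t := by
  induction L generalizing t with
  | nil => exact le_rfl
  | cons q L ih =>
    have hq := hL q List.mem_cons_self
    obtain ⟨-, -, h⟩ := choose_valid (R := R) (K := K) (value R K L) hq.r t
    rw [value, h]
    refine add_nonneg ?_ (ih (fun q hq => hL q (List.mem_cons_of_mem _ hq)) _)
    unfold price
    split_ifs
    exacts [hq.w, le_rfl]

theorem value_le {P : ℤ} {L : List Job} (hL : ∀ q ∈ L, q.Good P) (t : St) :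
    value R K L t ≤ (L.map Job.w).sum := by
  induction L generalizing t with
  | nil => exact le_rfl
  | cons q L ih =>
    have hq := hL q List.mem_cons_self
    have h1 := choose_value_le (R := R) (K := K) (value R K L) (t := t) hq.r
      (.inr (.inr (.inr (.inr rfl))))
    have h2 := ih (fun q hq => hL q (List.mem_cons_of_mem _ hq)) (next q (4 - 2 * q.r) t)
    simp only [price, if_true] at h1
    simp only [value, List.map_cons, List.sum_cons]
    linarith

/-- The sum of `f` over the entries of the list that satisfy `A`. -/
def load (f : ι → ℤ) (A : ι → Prop) [DecidablePred A] (L : List ι) : ℤ :=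
  (L.map fun j => if A j then f j else 0).sum

section load

variable {f : ι → ℤ} {A : ι → Prop} [DecidablePred A]

@[simp] theorem load_nil : load f A [] = 0 := rfl

@[simp] theorem load_cons (j : ι) (L : List ι) :
    load f A (j :: L) = (if A j then f j else 0) + load f A L := by simp [load]

@[simp] theorem load_append (L₁ L₂ : List ι) :
    load f A (L₁ ++ L₂) = load f A L₁ + load f A L₂ := by simp [load]

theorem load_eq_zero {L : List ι} (h : ∀ j ∈ L, ¬ A j) : load f A L = 0 := by
  induction L with
  | nil => rfl
  | cons j L ih =>
    rw [load_cons, if_neg (h j List.mem_cons_self),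
      ih fun i hi => h i (List.mem_cons_of_mem _ hi), add_zero]

theorem load_eq_sum_filter (L : List ι) : load f A L = ((L.filter A).map f).sum := by
  induction L with
  | nil => rfl
  | cons j L ih =>
    by_cases h : A j <;> simp [h, ih]

theorem load_nonneg (hf : ∀ j, 0 ≤ f j) (L : List ι) : 0 ≤ load f A L := by
  refine List.sum_nonneg fun y hy => ?_
  obtain ⟨j, -, rfl⟩ := List.mem_map.1 hy
  split_ifs
  exacts [hf j, le_rfl]

end load

/-- The initial state if the renting period is to start at time `s`. -/
def St.init (s : ℤ) : St := ⟨0, s, 0, 0, 0⟩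

/-- The rules for the class of the job `j` that comes after the jobs of the list `L`, in terms of
the classes of these jobs. -/
def Fit (R K : ℤ) (job : ι → Job) (c : ι → ℤ) (s : ℤ) (L : List ι) (j : ι) : Prop :=
  let V := load (fun i => (job i).p) (fun i => c i = 1 ∧ (job i).r = 1) L
  let M := load (fun i => (job i).p) (fun i => c i = 1 ∧ (job i).r = 0) L
  let X := load (fun i => (job i).p) (fun i => c i = 0) L
  let Z := load (fun i => (job i).p) (fun i => c i = 3) L
  let q := job j
  (c j = 1 ∧ q.r = 1 ∧ s + V + M + q.p ≤ q.d) ∨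
  (c j = 0 ∧ q.r = 0 ∧ (∀ i ∈ L, c i ≠ 3) ∧ X + q.p ≤ s ∧ X + q.p ≤ q.d) ∨
  (c j = 1 ∧ q.r = 0 ∧ (∀ i ∈ L, c i ≠ 3) ∧ s + V + M + q.p ≤ q.d ∧ M + q.p + R ≤ K) ∨
  (c j = 3 ∧ q.r = 0 ∧ s + R + M + Z + q.p ≤ q.d) ∨
  c j = 4 - 2 * q.r

/-- The meaning of the states on a path that starts with `St.init s`. -/
structure Reaches (R K : ℤ) (job : ι → Job) (c : ι → ℤ) (s : ℤ) (L : List ι) (t : St) : Prop where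
  s_eq : t.s = s
  v_eq : t.v = load (fun i => (job i).p) (fun i => c i = 1 ∧ (job i).r = 1) L
  m_eq : t.m = load (fun i => (job i).p) (fun i => c i = 1 ∧ (job i).r = 0) L
  phase : (t.b = 0 ∧ (∀ i ∈ L, c i ≠ 3) ∧ t.x = load (fun i => (job i).p) (fun i => c i = 0) L) ∨
    (t.b = 1 ∧ (∃ i ∈ L, c i = 3) ∧ t.x = load (fun i => (job i).p) (fun i => c i = 3) L)
  before_le : load (fun i => (job i).p) (fun i => c i = 0) L ≤ s
  budget : load (fun i => (job i).p) (fun i => c i = 1 ∧ (job i).r = 0) L + R ≤ K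

/-- A state determines the rules for the next job. The total length of class `0` is forgotten
when class `3` is opened, but from then on class `0` is closed. -/
theorem Reaches.allowed_iff {c : ι → ℤ} {s : ℤ} {L : List ι} {t : St}
    (h : Reaches R K job c s L t) (j : ι) :
    Allowed R K (job j) (c j) t ↔ Fit R K job c s L j := by
  unfold Allowed Fit
  simp only [h.s_eq, h.v_eq, h.m_eq]
  rcases h.phase with ⟨h1, h2, h3⟩ | ⟨h1, h2, h3⟩
  · have hZ : load (fun i => (job i).p) (fun i => c i = 3) L = 0 := load_eq_zero h2
    have h2' : (∀ i ∈ L, c i ≠ 3) ↔ True := iff_true_intro h2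
    simp [h1, h2', h3, hZ]
  · have h2' : (∀ i ∈ L, c i ≠ 3) ↔ False := by
      obtain ⟨i, hi, hci⟩ := h2
      exact iff_false_intro fun h => h i hi hci
    rw [h2']
    simp [h1, h3]

theorem Reaches.append {c : ι → ℤ} {s : ℤ} {L : List ι} {t : St} (h : Reaches R K job c s L t)
    (hr : ∀ j, (job j).r = 0 ∨ (job j).r = 1) {j : ι} (hj : Allowed R K (job j) (c j) t) :
    Reaches R K job c s (L ++ [j]) (next (job j) (c j) t) := by
  obtain ⟨h1, h2, h3, h4, h5, h6⟩ := h
  rcases hj with ⟨hc, hj, hj'⟩ | ⟨hc, hj, hj'⟩ | ⟨hc, hj, hj'⟩ | ⟨hc, hj, hj'⟩ | hc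
  · constructor <;> simp [next, hc, hj, h1, h2, h3, h5, h6]
    simpa [or_imp, forall_and, hc] using h4
  · have h4' := h4.resolve_right fun h => by simp [h.1] at hj'
    rw [h4'.2.2, h1] at hj'
    constructor <;> simp [next, hc, h1, h2, h3, hj'.2.1, h6]
    refine .inl ⟨hj'.1, ?_, h4'.2.2⟩
    rintro i (hi | rfl)
    exacts [h4'.2.1 i hi, by simp [hc]]
  · have h4' := h4.resolve_right fun h => by simp [h.1] at hj'
    rw [h3] at hj'
    constructor <;> simp [next, hc, hj, h1, h2, h3, h5, hj'.2.2]
    refine .inl ⟨hj'.1, ?_, h4'.2.2⟩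
    rintro i (hi | rfl)
    exacts [h4'.2.1 i hi, by simp [hc]]
  · constructor <;> simp [next, hc, h1, h2, h3, h5, h6]
    rcases h4 with ⟨h7, h8, h9⟩ | ⟨h7, h8, h9⟩
    · simp [h7, load_eq_zero h8]
    · simp [h7, h9]
  · have hc' : c j ≠ 0 ∧ c j ≠ 1 ∧ c j ≠ 3 := by
      rcases hr j with h | h <;> simp [hc, h]
    constructor <;> simp [next, hc', h1, h2, h3, h5, h6]
    simpa [or_imp, forall_and, hc', or_and_right, exists_or] using h4

theorem Run.reaches (hr : ∀ j, (job j).r = 0 ∨ (job j).r = 1) (hRK : R ≤ K) {c : ι → ℤ} {s : ℤ}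
    (hs : 0 ≤ s) {L : List ι} (h : Run R K job c L (St.init s)) :
    Reaches R K job c s L (after job c L (St.init s)) := by
  induction L using List.reverseRecOn with
  | nil => constructor <;> simp [after, St.init, hs, hRK]
  | append_singleton L j ih =>
    rw [run_append] at h
    rw [after_append]
    exact (ih h.1).append hr h.2.1

/-- A description of the paths of the dynamic program that does not refer to its states. -/
theorem run_iff_fit (hr : ∀ j, (job j).r = 0 ∨ (job j).r = 1) (hRK : R ≤ K) {c : ι → ℤ} {s : ℤ}
    (hs : 0 ≤ s) {L : List ι} :
    Run R K job c L (St.init s) ↔ ∀ L₁ j L₂, L = L₁ ++ j :: L₂ → Fit R K job c s L₁ j := by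
  constructor
  · rintro h L₁ j L₂ rfl
    rw [run_append] at h
    exact ((h.1.reaches hr hRK hs).allowed_iff j).1 h.2.1
  · intro h
    induction L using List.reverseRecOn with
    | nil => trivial
    | append_singleton L j ih =>
      have h1 : Run R K job c L (St.init s) :=
        ih fun L₁ i L₂ e => h L₁ i (L₂ ++ [j]) (by simp [e])
      exact run_append.2 ⟨h1, ((h1.reaches hr hRK hs).allowed_iff j).2 (h L j [] rfl), trivial⟩

end DP

/-! ### Sequences and classes of jobs -/

namespace Inst

variable (I : Inst)

/-- The due date of a job, moved into the range `[-1, P]`. Completion times lie in `[0, P]`, and the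
due date `-1` stands for those that cannot be met. -/
def due (j : Fin I.n) : ℤ := max (-1) (min (I.d j) I.totalP)

/-- The data of a job in the dynamic program. -/
def job (j : Fin I.n) : DP.Job := ⟨I.p j, I.due j, I.w j, if j ∈ I.rJobs then 1 else 0⟩

/-- The total processing time of the r-jobs. -/
def rTotal : ℤ := ∑ j, if j ∈ I.rJobs then (I.p j : ℤ) else 0

/-- The list contains the jobs in the order of their due dates. -/
structure EDD (L : List (Fin I.n)) : Prop where
  nodup : L.Nodup
  mem : ∀ j, j ∈ L
  sorted : L.Pairwise fun i j => I.due i ≤ I.due j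

variable {I}

@[simp] theorem job_p (j : Fin I.n) : (I.job j).p = I.p j := rfl
@[simp] theorem job_d (j : Fin I.n) : (I.job j).d = I.due j := rfl
@[simp] theorem job_w (j : Fin I.n) : (I.job j).w = I.w j := rfl

@[simp] theorem job_r_eq_one {j : Fin I.n} : (I.job j).r = 1 ↔ j ∈ I.rJobs := by
  simp [job]

@[simp] theorem job_r_eq_zero {j : Fin I.n} : (I.job j).r = 0 ↔ j ∉ I.rJobs := by
  simp [job]

theorem job_r_cases (j : Fin I.n) : (I.job j).r = 0 ∨ (I.job j).r = 1 := by
  rw [job_r_eq_zero, job_r_eq_one]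
  exact (em _).symm

theorem job_good (j : Fin I.n) : (I.job j).Good I.totalP where
  p := by simp
  d := by simp only [job_d, due]; omega
  w := by simp
  r := job_r_cases j

theorem rTotal_nonneg : 0 ≤ I.rTotal :=
  Finset.sum_nonneg fun j _ => by split_ifs <;> simp

theorem completion_eq (σ : I.Sequence) (j : Fin I.n) :
    I.completion σ j = ∑ i, if σ.symm i ≤ σ.symm j then (I.p i : ℤ) else 0 := by
  rw [completion, Finset.sum_filter,
    ← Equiv.sum_comp σ fun i => if σ.symm i ≤ σ.symm j then (I.p i : ℤ) else 0]
  simp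

/-- A sum over jobs is at most the completion time of `j` if only the jobs up to `j` contribute,
each at most its processing time. -/
theorem sum_le_completion {σ : I.Sequence} {j : Fin I.n} {f : Fin I.n → ℤ}
    (h : ∀ i, f i ≤ if σ.symm i ≤ σ.symm j then (I.p i : ℤ) else 0) :
    ∑ i, f i ≤ I.completion σ j := by
  rw [completion_eq]
  exact Finset.sum_le_sum fun i _ => h i

theorem completion_nonneg (σ : I.Sequence) (j : Fin I.n) : 0 ≤ I.completion σ j :=
  Finset.sum_nonneg fun _ _ => by simp

theorem completion_le_totalP (σ : I.Sequence) (j : Fin I.n) : I.completion σ j ≤ I.totalP := by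
  rw [completion_eq, totalP, Nat.cast_sum]
  exact Finset.sum_le_sum fun i _ => by split_ifs <;> simp

/-- Moving the due dates into the range of the completion times does not change which jobs are
tardy. -/
theorem lt_completion_iff (σ : I.Sequence) (j : Fin I.n) :
    I.d j < I.completion σ j ↔ ¬ I.completion σ j ≤ I.due j := by
  have h1 := completion_nonneg σ j
  have h2 := completion_le_totalP σ j
  simp only [due]
  omega

theorem tardyWeight_eq (σ : I.Sequence) :
    (I.tardyWeight σ : ℤ) = ∑ j, if I.completion σ j ≤ I.due j then 0 else (I.w j : ℤ) := by
  rw [tardyWeight, Nat.cast_sum]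
  refine Finset.sum_congr rfl fun j _ => ?_
  by_cases h : I.completion σ j ≤ I.due j
  · have := (lt_completion_iff σ j).not_left.2 h
    simp [h, this]
  · simp [h, (lt_completion_iff σ j).2 h]

/-- In a feasible sequence, the r-jobs are contained in an interval of positions whose jobs have a
total length within the budget. -/
theorem Feasible.exists_block {σ : I.Sequence} (h : I.Feasible σ) :
    ∃ lo hi : ℕ, lo ≤ hi ∧ (∀ j ∈ I.rJobs, lo ≤ (σ.symm j : ℕ) ∧ (σ.symm j : ℕ) < hi) ∧
      ∑ i, (if lo ≤ (σ.symm i : ℕ) ∧ (σ.symm i : ℕ) < hi then (I.p i : ℤ) else 0) ≤ I.budget := by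
  unfold Feasible rentLength at h
  split_ifs at h with hne
  · obtain ⟨q₀, h₀, hmin⟩ := Finset.exists_min_image I.rJobs (fun j => σ.symm j) hne
    obtain ⟨q₁, h₁, hmax⟩ := Finset.exists_max_image I.rJobs (fun j => σ.symm j) hne
    refine ⟨σ.symm q₀, σ.symm q₁ + 1, (Fin.le_def.1 (hmin q₁ h₁)).trans (Nat.le_succ _),
      fun j hj => ⟨hmin j hj, Nat.lt_succ_of_le (hmax j hj)⟩, le_trans ?_ h⟩
    have hs := Finset.le_sup' (fun j => I.completion σ j) h₁
    have hi := Finset.inf'_le (fun j => I.completion σ j - (I.p j : ℤ)) h₀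
    refine le_trans ?_ (sub_le_sub hs hi)
    have hq : (I.p q₀ : ℤ) = ∑ i, if i = q₀ then (I.p i : ℤ) else 0 := by simp
    rw [sub_sub_eq_add_sub, le_sub_iff_add_le, completion_eq, completion_eq, hq,
      ← Finset.sum_add_distrib, ← Finset.sum_add_distrib]
    refine Finset.sum_le_sum fun i _ => ?_
    have h01 := hmin q₁ h₁
    have heq : i = q₀ ↔ (σ.symm i : ℕ) = σ.symm q₀ := by
      rw [← Fin.ext_iff, σ.symm.injective.eq_iff]
    simp only [Fin.le_def, heq] at h01 ⊢
    have : (0 : ℤ) ≤ I.p i := by positivity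
    split_ifs <;> omega
  · exact ⟨0, 0, le_rfl, fun j hj => (hne ⟨j, hj⟩).elim, by simpa using h⟩

theorem feasible_of_bounds {σ : I.Sequence} {a b : ℤ} (h0 : 0 ≤ I.budget) (hab : b - a ≤ I.budget)
    (h : ∀ j ∈ I.rJobs, a ≤ I.completion σ j - I.p j ∧ I.completion σ j ≤ b) : I.Feasible σ := by
  unfold Feasible rentLength
  split_ifs with hne
  · exact (sub_le_sub (Finset.sup'_le hne _ fun j hj => (h j hj).2)
      (Finset.le_inf' hne _ fun j hj => (h j hj).1)).trans hab
  · exact h0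

theorem exists_sequence {S : List (Fin I.n)} (hS : S.Nodup) (hmem : ∀ j, j ∈ S) :
    ∃ σ : I.Sequence, S = List.ofFn σ := by
  have hlen : S.length = I.n := by
    have := (List.toFinset_card_of_nodup hS).symm
    rwa [Finset.eq_univ_of_forall fun j => List.mem_toFinset.2 (hmem j), Finset.card_fin] at this
  have hinj : Function.Injective fun i : Fin I.n => S.get (i.cast hlen.symm) := fun i j h => by
    simpa using hS.injective_get h
  refine ⟨Equiv.ofBijective _ (Finite.injective_iff_bijective.1 hinj), ?_⟩
  refine List.ext_get (by simp [hlen]) fun k h1 h2 => by simp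

theorem completion_of_append {σ : I.Sequence} {S₁ S₂ : List (Fin I.n)} {j : Fin I.n}
    (h : List.ofFn σ = S₁ ++ j :: S₂) :
    I.completion σ j = (S₁.map fun i => (I.p i : ℤ)).sum + I.p j := by
  have hlen : S₁.length < I.n := by
    have := congrArg List.length h
    simp at this
    omega
  have hj : σ.symm j = ⟨S₁.length, hlen⟩ := by
    rw [Equiv.symm_apply_eq]
    have h1 : (List.ofFn σ)[S₁.length]'(by simpa using hlen) = j := by simp [h]
    rw [List.getElem_ofFn] at h1
    exact h1.symm
  have h2 : ((List.ofFn fun i => (I.p (σ i) : ℤ)).take (S₁.length + 1)).sum =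
      (S₁.map fun i => (I.p i : ℤ)).sum + I.p j := by
    have h3 : (List.ofFn fun i => (I.p (σ i) : ℤ)) = (List.ofFn σ).map fun i => (I.p i : ℤ) := by
      simp [List.map_ofFn, Function.comp_def]
    rw [h3, h, ← List.map_take, List.append_cons, List.take_left' (by simp)]
    simp
  rw [← h2, List.sum_take_ofFn, completion, hj]
  refine Finset.sum_congr (Finset.filter_congr fun i _ => ?_) fun _ _ => rfl
  rw [Fin.le_def, Nat.lt_succ_iff]

theorem load_eq_sum {L : List (Fin I.n)} (hL : L.Nodup) (f : Fin I.n → ℤ) (A : Fin I.n → Prop)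
    [DecidablePred A] : DP.load f A L = ∑ i, if i ∈ L ∧ A i then f i else 0 := by
  rw [DP.load, ← List.sum_toFinset _ hL]
  simp only [ite_and, ← List.mem_toFinset]
  rw [Finset.sum_ite_mem, Finset.univ_inter]

theorem cost_eq_sum {L : List (Fin I.n)} (hL : I.EDD L) (c : Fin I.n → ℤ) :
    DP.cost I.job c L = ∑ j, DP.price (I.job j) (c j) := by
  rw [DP.cost, ← List.sum_toFinset _ hL.nodup,
    Finset.eq_univ_of_forall fun j => List.mem_toFinset.2 (hL.mem j)]

/-- The jobs of the classes `0, …, 4`, one class after the other, each in the order of `L`. On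
paths of the dynamic program, all r-jobs are in the classes `1` and `2`, which make up the renting
period. -/
def arrange (c : Fin I.n → ℤ) (L : List (Fin I.n)) : List (Fin I.n) :=
  L.filter (fun j => c j = 0) ++ L.filter (fun j => c j = 1) ++ L.filter (fun j => c j = 2) ++
    L.filter (fun j => c j = 3) ++ L.filter (fun j => c j = 4)

theorem mem_arrange {c : Fin I.n → ℤ} {L : List (Fin I.n)} {j : Fin I.n} :
    j ∈ arrange c L ↔ j ∈ L ∧ (c j = 0 ∨ c j = 1 ∨ c j = 2 ∨ c j = 3 ∨ c j = 4) := by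
  simp only [arrange, List.mem_append, List.mem_filter, decide_eq_true_eq]
  tauto

theorem nodup_arrange {c : Fin I.n → ℤ} {L : List (Fin I.n)} (hL : L.Nodup) :
    (arrange c L).Nodup := by
  have key (A B : Fin I.n → Prop) [DecidablePred A] [DecidablePred B] (h : ∀ j, A j → ¬ B j)
      (S : List (Fin I.n)) (hS : S.Nodup) (hA : ∀ j ∈ S, A j) :
      (S ++ L.filter B).Nodup := by
    refine List.Nodup.append hS (hL.filter _) fun j h1 h2 => ?_
    exact h j (hA j h1) (by simpa using (List.mem_filter.1 h2).2)
  unfold arrange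
  refine key (fun j => c j < 4) _ (fun j => by omega) _
    (key (fun j => c j < 3) _ (fun j => by omega) _
      (key (fun j => c j < 2) _ (fun j => by omega) _
        (key (fun j => c j < 1) _ (fun j => by omega) _ (hL.filter _) ?_) ?_) ?_) ?_ <;>
  · simp only [List.mem_append, List.mem_filter, decide_eq_true_eq]
    intro j hj
    omega

/-- A path of the dynamic program yields a feasible sequence, whose tardy jobs are paid for. The
renting period of this sequence may start before the time `s` for which the path was computed,
which only makes jobs earlier. -/
theorem exists_sequence_of_run {L : List (Fin I.n)} (hL : I.EDD L) (hRK : I.rTotal ≤ I.budget)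
    {c : Fin I.n → ℤ} {s : ℤ} (hs : 0 ≤ s)
    (hrun : DP.Run I.rTotal I.budget I.job c L (DP.St.init s)) :
    ∃ σ : I.Sequence, arrange c L = List.ofFn σ ∧ I.Feasible σ ∧
      (I.tardyWeight σ : ℤ) ≤ DP.cost I.job c L := by
  have hreach := hrun.reaches job_r_cases hRK hs
  have hfit := (DP.run_iff_fit job_r_cases hRK hs).1 hrun
  have hcls (j : Fin I.n) : (c j = 0 ∧ j ∉ I.rJobs) ∨ c j = 1 ∨ (c j = 2 ∧ j ∈ I.rJobs) ∨
      (c j = 3 ∧ j ∉ I.rJobs) ∨ (c j = 4 ∧ j ∉ I.rJobs) := by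
    obtain ⟨L₁, L₂, e⟩ := List.append_of_mem (hL.mem j)
    have := hfit L₁ j L₂ e
    unfold DP.Fit at this
    simp only [job_r_eq_one, job_r_eq_zero] at this
    have hr := job_r_cases j
    rw [job_r_eq_one, job_r_eq_zero] at hr
    rcases hr with hr | hr
    · have := job_r_eq_zero.2 hr
      simp only [this] at *
      grind
    · have := job_r_eq_one.2 hr
      simp only [this] at *
      grind
  obtain ⟨σ, hσ⟩ := exists_sequence (nodup_arrange (c := c) hL.nodup) fun j =>
    mem_arrange.2 ⟨hL.mem j, by have := hcls j; tauto⟩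
  refine ⟨σ, hσ, ?_⟩
  set p : Fin I.n → ℤ := fun i => I.p i with hp
  have hp0 : ∀ j, 0 ≤ p j := fun j => by simp [hp]
  set X := DP.load p (fun i => c i = 0) L with hX
  -- The completion times in the classes 0 to 3.
  have comp0 {L₁ j L₂} (e : L = L₁ ++ j :: L₂) (h : c j = 0) :
      I.completion σ j = DP.load p (fun i => c i = 0) L₁ + p j := by
    rw [DP.load_eq_sum_filter]
    apply completion_of_append
    rw [← hσ, arrange, e, List.filter_append, List.filter_cons_of_pos (by simpa using h)]
    simp only [List.append_assoc, List.cons_append]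
    rfl
  have comp1 {L₁ j L₂} (e : L = L₁ ++ j :: L₂) (h : c j = 1) :
      I.completion σ j = X + DP.load p (fun i => c i = 1) L₁ + p j := by
    rw [hX, DP.load_eq_sum_filter, DP.load_eq_sum_filter, ← List.sum_append, ← List.map_append]
    apply completion_of_append
    rw [← hσ, arrange, e, List.filter_append (p := fun j => decide (c j = 1)),
      List.filter_cons_of_pos (p := fun j => decide (c j = 1)) (by simpa using h)]
    simp only [List.append_assoc, List.cons_append]
    rfl
  have comp2 {L₁ j L₂} (e : L = L₁ ++ j :: L₂) (h : c j = 2) :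
      I.completion σ j = X + DP.load p (fun i => c i = 1) L + DP.load p (fun i => c i = 2) L₁
        + p j := by
    rw [hX, DP.load_eq_sum_filter, DP.load_eq_sum_filter, DP.load_eq_sum_filter, ← List.sum_append,
      ← List.map_append, ← List.sum_append, ← List.map_append]
    apply completion_of_append
    rw [← hσ, arrange, e, List.filter_append (p := fun j => decide (c j = 2)),
      List.filter_cons_of_pos (p := fun j => decide (c j = 2)) (by simpa using h)]
    simp only [List.append_assoc, List.cons_append]
    rfl
  have comp3 {L₁ j L₂} (e : L = L₁ ++ j :: L₂) (h : c j = 3) :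
      I.completion σ j = X + DP.load p (fun i => c i = 1) L + DP.load p (fun i => c i = 2) L
        + DP.load p (fun i => c i = 3) L₁ + p j := by
    rw [hX, DP.load_eq_sum_filter, DP.load_eq_sum_filter, DP.load_eq_sum_filter,
      DP.load_eq_sum_filter, ← List.sum_append,
      ← List.map_append, ← List.sum_append, ← List.map_append, ← List.sum_append, ← List.map_append]
    apply completion_of_append
    rw [← hσ, arrange, e, List.filter_append (p := fun j => decide (c j = 3)),
      List.filter_cons_of_pos (p := fun j => decide (c j = 3)) (by simpa using h)]
    simp only [List.append_assoc, List.cons_append]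
    rfl
  have split1 (L' : List (Fin I.n)) : DP.load p (fun i => c i = 1) L' =
      DP.load p (fun i => c i = 1 ∧ (I.job i).r = 1) L' +
        DP.load p (fun i => c i = 1 ∧ (I.job i).r = 0) L' := by
    induction L' with
    | nil => rfl
    | cons j L' ih =>
      simp only [DP.load_cons, ih, job_r_eq_one, job_r_eq_zero]
      by_cases h1 : c j = 1 <;> by_cases h2 : j ∈ I.rJobs <;> simp [h1, h2] <;> ring
  set M := DP.load p (fun i => c i = 1 ∧ (I.job i).r = 0) L with hM
  have hR : DP.load p (fun i => c i = 1 ∧ (I.job i).r = 1) L + DP.load p (fun i => c i = 2) L =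
      I.rTotal := by
    rw [load_eq_sum hL.nodup, load_eq_sum hL.nodup, ← Finset.sum_add_distrib, rTotal]
    refine Finset.sum_congr rfl fun j _ => ?_
    simp only [hL.mem, true_and, job_r_eq_one]
    rcases hcls j with h | h | h | h | h <;> simp [h, hp]
  have hMK : M + I.rTotal ≤ I.budget := hreach.budget
  have hXs : X ≤ s := hreach.before_le
  have hload (A : Fin I.n → Prop) [DecidablePred A] (L' : List (Fin I.n)) : 0 ≤ DP.load p A L' :=
    DP.load_nonneg hp0 L'
  have hpart {L₁ j L₂} (e : L = L₁ ++ j :: L₂) (A : Fin I.n → Prop) [DecidablePred A] (hA : A j) :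
      DP.load p A L₁ + p j ≤ DP.load p A L := by
    rw [e, DP.load_append, DP.load_cons, if_pos hA]
    linarith [hload A L₂]
  refine ⟨feasible_of_bounds (a := X) (b := X + M + I.rTotal) (rTotal_nonneg.trans hRK)
    (by linarith) fun j hj => ?_, ?_⟩
  · obtain ⟨L₁, L₂, e⟩ := List.append_of_mem (hL.mem j)
    have s1 := split1 L
    change X ≤ I.completion σ j - p j ∧ _
    rcases hcls j with h | h | h | h | h
    · exact (h.2 hj).elim
    · have h1 := hpart e (fun i => c i = 1) h
      have h2 := hload (fun i => c i = 1) L₁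
      have h3 := hload (fun i => c i = 2) L
      rw [comp1 e h]
      constructor <;> linarith
    · have h1 := hpart e (fun i => c i = 2) h.1
      have h2 := hload (fun i => c i = 2) L₁
      have h3 := hload (fun i => c i = 1) L
      rw [comp2 e h.1]
      constructor <;> linarith
    · exact (h.2 hj).elim
    · exact (h.2 hj).elim
  · rw [tardyWeight_eq, cost_eq_sum hL]
    refine Finset.sum_le_sum fun j _ => ?_
    unfold DP.price
    split_ifs with h1 h2 h2
    · simp
    · exact le_rfl
    · exact le_rfl
    · -- A job that is not paid for is early.
      exfalso
      apply h1
      obtain ⟨L₁, L₂, e⟩ := List.append_of_mem (hL.mem j)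
      have s1 := split1 L
      rcases hfit L₁ j L₂ e with ⟨h, -, h'⟩ | ⟨h, -, -, -, h'⟩ | ⟨h, -, -, h', -⟩ | ⟨h, h3, h'⟩ | h
      · rw [comp1 e h, split1]
        simp only [job_p, job_d] at h'
        linarith
      · rw [comp0 e h]
        exact h'
      · rw [comp1 e h, split1]
        simp only [job_p, job_d] at h'
        linarith
      · -- After a job of class 3 no other job without resource requirement joins class 1.
        have hM1 : M = DP.load p (fun i => c i = 1 ∧ (I.job i).r = 0) L₁ := by
          rw [hM, e, DP.load_append, DP.load_eq_zero (L := j :: L₂), add_zero]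
          rintro i hi ⟨hi1, hi2⟩
          obtain rfl | hi := List.mem_cons.1 hi
          · omega
          obtain ⟨L₃, L₄, e'⟩ := List.append_of_mem hi
          have hj : j ∈ L₁ ++ j :: L₃ := by simp
          rcases hfit (L₁ ++ j :: L₃) i L₄ (by simp [e, e']) with g | g | g | g | g
          · omega
          · exact g.2.2.1 j hj h
          · exact g.2.2.1 j hj h
          · omega
          · omega
        rw [comp3 e h]
        simp only [job_p, job_d] at h'
        change s + I.rTotal + DP.load p _ L₁ + DP.load p _ L₁ + p j ≤ _ at h'
        linarith
      · exact (h2 h).elim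

open Classical in
/-- Every feasible sequence is matched by a path of the dynamic program. The early jobs without
resource requirement are put into the classes `0`, `1`, `3` as in the sequence, except that all of
them that come after the first job of class `3` in the order of due dates are moved to class `3`.
They stay early: together with the renting period and the jobs before it, they are among the jobs
up to a job `k` that is early and is due no later than they are. -/
theorem Feasible.exists_run {σ : I.Sequence} (hσ : I.Feasible σ) {L : List (Fin I.n)}
    (hL : I.EDD L) :
    I.rTotal ≤ I.budget ∧ ∃ (c : Fin I.n → ℤ) (s : ℤ), 0 ≤ s ∧ s ≤ I.totalP ∧
      DP.Run I.rTotal I.budget I.job c L (DP.St.init s) ∧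
      DP.cost I.job c L ≤ I.tardyWeight σ := by
  obtain ⟨lo, hi, hlohi, hr, hblock⟩ := hσ.exists_block
  have hp0 (i : Fin I.n) : (0 : ℤ) ≤ I.p i := by positivity
  have hite (i : Fin I.n) (A : Prop) [Decidable A] : 0 ≤ if A then (I.p i : ℤ) else 0 := by
    split_ifs
    exacts [hp0 i, le_rfl]
  have hRK : I.rTotal ≤ I.budget := by
    refine le_trans (Finset.sum_le_sum fun i _ => ?_) hblock
    have := hp0 i
    split_ifs with h1 h2 <;> first | omega | exact (h2 (hr i h1)).elim
  refine ⟨hRK, ?_⟩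
  set E : Fin I.n → Prop := fun j => I.completion σ j ≤ I.due j with hE
  -- The early jobs after the renting period, and the jobs that are due after one of them.
  set T : Fin I.n → Prop := fun i => i ∉ I.rJobs ∧ E i ∧ hi ≤ (σ.symm i : ℕ) with hT
  set Late : Fin I.n → Prop := fun j => ∃ i, T i ∧ L.idxOf i ≤ L.idxOf j with hLate
  set c : Fin I.n → ℤ := fun j =>
    if j ∈ I.rJobs then (if E j then 1 else 2) else if E j then
    (if Late j then 3 else if (σ.symm j : ℕ) < lo then 0 else 1) else 4 with hc
  have c0 {i} (h : c i = 0) : i ∉ I.rJobs ∧ E i ∧ ¬ Late i ∧ (σ.symm i : ℕ) < lo := by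
    simp only [hc] at h
    split_ifs at h with h1 h2 h3 h4 h5 <;> first | (simp at h; done) | exact ⟨h1, h3, h4, h5⟩
  have c1 {i} (h : c i = 1) : E i ∧ lo ≤ (σ.symm i : ℕ) ∧
      (i ∉ I.rJobs → ¬ Late i ∧ (σ.symm i : ℕ) < hi) := by
    simp only [hc] at h
    split_ifs at h with h1 h2 h3 h4 h5 <;> try (simp at h; done)
    · exact ⟨h2, (hr i h1).1, fun h => (h h1).elim⟩
    · refine ⟨h3, not_lt.1 h5, fun _ => ⟨h4, ?_⟩⟩
      by_contra h6
      exact h4 ⟨i, ⟨h1, h3, not_lt.1 h6⟩, le_rfl⟩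
  have c3 {i} (h : c i = 3) : i ∉ I.rJobs ∧ E i ∧ Late i ∧ (T i ∨ (σ.symm i : ℕ) < hi) := by
    simp only [hc] at h
    split_ifs at h with h1 h2 h3 h4 h5 <;> try (simp at h; done)
    refine ⟨h1, h3, h4, ?_⟩
    by_cases h6 : (σ.symm i : ℕ) < hi
    exacts [.inr h6, .inl ⟨h1, h3, not_lt.1 h6⟩]
  -- The renting period starts when the jobs of class 0 are completed.
  set s : ℤ := ∑ i, if c i = 0 then (I.p i : ℤ) else 0 with hs
  have hs0 : 0 ≤ s := Finset.sum_nonneg fun i _ => by have := hp0 i; split_ifs <;> omega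
  have hsP : s ≤ I.totalP := by
    rw [totalP, Nat.cast_sum]
    exact Finset.sum_le_sum fun i _ => by have := hp0 i; split_ifs <;> omega
  refine ⟨c, s, hs0, hsP, (DP.run_iff_fit job_r_cases hRK hs0).2 ?_, ?_⟩
  · intro L₁ j L₂ e
    have hnd : (L₁ ++ j :: L₂).Nodup := e ▸ hL.nodup
    have hnd₁ : L₁.Nodup := hnd.of_append_left
    have hj₁ : j ∉ L₁ := fun h => (List.nodup_append.1 hnd).2.2 j h j (by simp) rfl
    have hidx {i} (hi : i ∈ L₁) : L.idxOf i < L.idxOf j := by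
      rw [e, List.idxOf_append_of_mem hi, List.idxOf_append_of_notMem hj₁]
      have := List.idxOf_lt_length_iff.2 hi
      omega
    have hidx' {i} (hi : L.idxOf i ≤ L.idxOf j) : i = j ∨ i ∈ L₁ := by
      by_contra! h
      rw [e, List.idxOf_append_of_notMem h.2, List.idxOf_append_of_notMem hj₁,
        List.idxOf_cons_ne _ h.1.symm] at hi
      simp at hi
    have hdue {i} (hi : i = j ∨ i ∈ L₁) : I.due i ≤ I.due j := by
      rcases hi with rfl | hi
      · exact le_rfl
      · have := hL.sorted
        rw [e, List.pairwise_append] at this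
        exact this.2.2 i hi j (by simp)
    have hpj : (I.p j : ℤ) = ∑ i, if i = j then (I.p i : ℤ) else 0 := by simp
    -- The member of a set of jobs `A` up to `j` (in `L`) that is last in the sequence.
    have hlast (A : Fin I.n → Prop) (hA : ∃ i, (i = j ∨ i ∈ L₁) ∧ A i) :
        ∃ k, (k = j ∨ k ∈ L₁) ∧ A k ∧ ∀ i, (i = j ∨ i ∈ L₁) → A i → σ.symm i ≤ σ.symm k := by
      obtain ⟨i₀, hi₀⟩ := hA
      obtain ⟨k, hk, hmax⟩ := Finset.exists_max_image
        (Finset.univ.filter fun i => (i = j ∨ i ∈ L₁) ∧ A i) (fun i => σ.symm i)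
        ⟨i₀, by simpa using hi₀⟩
      simp only [Finset.mem_filter, Finset.mem_univ, true_and] at hk hmax
      exact ⟨k, hk.1, hk.2, fun i h1 h2 => hmax i ⟨h1, h2⟩⟩
    have no3 (h : ¬ Late j) : ∀ i ∈ L₁, c i ≠ 3 := fun i hi h3 => by
      obtain ⟨-, -, ⟨k, hk, hki⟩, -⟩ := c3 h3
      exact h ⟨k, hk, hki.trans (hidx hi).le⟩
    have fit1 (h : c j = 1) :
        s + DP.load (fun i => (I.p i : ℤ)) (fun i => c i = 1 ∧ i ∈ I.rJobs) L₁
          + DP.load (fun i => (I.p i : ℤ)) (fun i => c i = 1 ∧ i ∉ I.rJobs) L₁ + I.p j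
          ≤ I.due j := by
      obtain ⟨k, hk, hAk, hmax⟩ := hlast (fun i => c i = 1) ⟨j, .inl rfl, h⟩
      refine le_trans ?_ ((c1 hAk).1.trans (hdue hk))
      rw [load_eq_sum hnd₁, load_eq_sum hnd₁, hpj, hs, ← Finset.sum_add_distrib,
        ← Finset.sum_add_distrib, ← Finset.sum_add_distrib]
      refine sum_le_completion fun i => ?_
      have hi0 : c i = 0 → σ.symm i ≤ σ.symm k := fun h0 =>
        Fin.le_def.2 ((c0 h0).2.2.2.le.trans (c1 hAk).2.1)
      have hi1 := hmax i
      have := hite i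
      clear_value c s
      clear * - hi0 hi1 this hj₁ h
      by_cases g0 : c i = 0 <;> by_cases g1 : c i = 1 <;> by_cases g2 : i ∈ L₁ <;>
        by_cases g3 : i = j <;> by_cases g4 : i ∈ I.rJobs <;> simp_all
    unfold DP.Fit
    simp only [job_p, job_d, job_r_eq_one, job_r_eq_zero]
    by_cases hjr : j ∈ I.rJobs
    · have hjr' := job_r_eq_one.2 hjr
      by_cases hjE : E j
      · have hcj : c j = 1 := by simp [hc, hjr, hjE]
        exact .inl ⟨hcj, hjr, fit1 hcj⟩
      · exact .inr (.inr (.inr (.inr (by simp [hc, hjr, hjE, hjr']))))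
    have hjr' := job_r_eq_zero.2 hjr
    by_cases hjE : E j
    swap
    · exact .inr (.inr (.inr (.inr (by simp [hc, hjr, hjE, hjr']))))
    by_cases hjL : Late j
    · have hcj : c j = 3 := by simp [hc, hjr, hjE, hjL]
      refine .inr (.inr (.inr (.inl ⟨hcj, hjr, ?_⟩)))
      obtain ⟨i₀, h1, h2⟩ := hjL
      obtain ⟨k, hk, hAk, hmax⟩ := hlast T ⟨i₀, hidx' h2, h1⟩
      refine le_trans ?_ (hAk.2.1.trans (hdue hk))
      rw [load_eq_sum hnd₁, load_eq_sum hnd₁, hpj, hs, rTotal, ← Finset.sum_add_distrib,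
        ← Finset.sum_add_distrib, ← Finset.sum_add_distrib, ← Finset.sum_add_distrib]
      refine sum_le_completion fun i => ?_
      have hlt : (σ.symm i : ℕ) < hi → σ.symm i ≤ σ.symm k := fun h =>
        Fin.le_def.2 (h.le.trans hAk.2.2)
      have hi0 : c i = 0 → σ.symm i ≤ σ.symm k ∧ i ∉ I.rJobs := fun h0 =>
        ⟨hlt ((c0 h0).2.2.2.trans_le hlohi), (c0 h0).1⟩
      have hir : i ∈ I.rJobs → σ.symm i ≤ σ.symm k := fun h => hlt (hr i h).2
      have hi1 : c i = 1 → i ∉ I.rJobs → σ.symm i ≤ σ.symm k := fun h h' => hlt ((c1 h).2.2 h').2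
      have hi3 : c i = 3 → (i = j ∨ i ∈ L₁) → σ.symm i ≤ σ.symm k ∧ i ∉ I.rJobs := fun h h' =>
        ⟨(c3 h).2.2.2.elim (hmax i h') hlt, (c3 h).1⟩
      have := hite i
      clear_value c s
      clear * - hi0 hir hi1 hi3 this hj₁ hcj
      by_cases g0 : c i = 0 <;> by_cases g1 : c i = 1 <;> by_cases g3 : c i = 3 <;>
        by_cases g4 : i ∈ L₁ <;> by_cases g5 : i = j <;> by_cases g6 : i ∈ I.rJobs <;> simp_all
    by_cases hjlo : (σ.symm j : ℕ) < lo
    · have hcj : c j = 0 := by simp [hc, hjr, hjE, hjL, hjlo]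
      refine .inr (.inl ⟨hcj, hjr, no3 hjL, ?_, ?_⟩)
      · rw [load_eq_sum hnd₁, hpj, hs, ← Finset.sum_add_distrib]
        refine Finset.sum_le_sum fun i _ => ?_
        have := hite i
        clear_value c s
        clear * - this hj₁ hcj
        by_cases g0 : c i = 0 <;> by_cases g2 : i ∈ L₁ <;> by_cases g3 : i = j <;> simp_all
      · obtain ⟨k, hk, hAk, hmax⟩ := hlast (fun i => c i = 0) ⟨j, .inl rfl, hcj⟩
        refine le_trans ?_ ((c0 hAk).2.1.trans (hdue hk))
        rw [load_eq_sum hnd₁, hpj, ← Finset.sum_add_distrib]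
        refine sum_le_completion fun i => ?_
        have hi1 := hmax i
        have := hite i
        clear_value c s
        clear * - this hj₁ hcj hi1
        by_cases g0 : c i = 0 <;> by_cases g2 : i ∈ L₁ <;> by_cases g3 : i = j <;> simp_all
    · have hcj : c j = 1 := by simp [hc, hjr, hjE, hjL, hjlo]
      refine .inr (.inr (.inl ⟨hcj, hjr, no3 hjL, fit1 hcj, ?_⟩))
      refine le_trans ?_ hblock
      rw [load_eq_sum hnd₁, hpj, rTotal, ← Finset.sum_add_distrib, ← Finset.sum_add_distrib]
      refine Finset.sum_le_sum fun i _ => ?_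
      have hi1 : c i = 1 → i ∉ I.rJobs → lo ≤ (σ.symm i : ℕ) ∧ (σ.symm i : ℕ) < hi :=
        fun h h' => ⟨(c1 h).2.1, ((c1 h).2.2 h').2⟩
      have hi2 := hr i
      have := hite i
      clear_value c s
      clear * - this hj₁ hcj hjr hi1 hi2
      by_cases g0 : c i = 1 <;> by_cases g2 : i ∈ L₁ <;> by_cases g3 : i = j <;>
        by_cases g4 : i ∈ I.rJobs <;> simp_all
  · rw [tardyWeight_eq, cost_eq_sum hL]
    refine Finset.sum_le_sum fun j _ => ?_
    by_cases hE' : I.completion σ j ≤ I.due j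
    · have hEj : E j := hE'
      rw [if_pos hE', DP.price, if_neg]
      by_cases hjr : j ∈ I.rJobs
      · simp [hc, hjr, hEj, job_r_eq_one.2 hjr]
      · simp only [hc, hjr, hEj, job_r_eq_zero.2 hjr, if_false]
        split_ifs <;> norm_num
    · rw [if_neg hE', DP.price]
      split_ifs <;> simp

end Inst

/-! ### Frame conditions -/

@[simp] theorem Prog.writesVar_block_nil (x : ℕ) : (Prog.block []).WritesVar x ↔ False := Iff.rfl
@[simp] theorem Prog.writesVar_block_cons (x : ℕ) (c : Prog) (cs : List Prog) :
    (Prog.block (c :: cs)).WritesVar x ↔ c.WritesVar x ∨ (Prog.block cs).WritesVar x := Iff.rfl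
@[simp] theorem Prog.writesArr_block_nil (a : ℕ) : (Prog.block []).WritesArr a ↔ False := Iff.rfl
@[simp] theorem Prog.writesArr_block_cons (a : ℕ) (c : Prog) (cs : List Prog) :
    (Prog.block (c :: cs)).WritesArr a ↔ c.WritesArr a ∨ (Prog.block cs).WritesArr a := Iff.rfl
@[simp] theorem Prog.loopFree_block_nil : (Prog.block []).LoopFree := trivial
@[simp] theorem Prog.loopFree_block_cons (c : Prog) (cs : List Prog) :
    (Prog.block (c :: cs)).LoopFree ↔ c.LoopFree ∧ (Prog.block cs).LoopFree := Iff.rfl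
@[simp] theorem Prog.run_block_nil (s : State) : (Prog.block []).run s = s := rfl
@[simp] theorem Prog.run_block_cons (c : Prog) (cs : List Prog) (s : State) :
    (Prog.block (c :: cs)).run s = (Prog.block cs).run (c.run s) := rfl
@[simp] theorem Prog.writesVar_forLoop (x i lim : ℕ) (c : Prog) :
    (Prog.forLoop i lim c).WritesVar x ↔ x = i ∨ c.WritesVar x := by
  simp only [Prog.forLoop, Prog.WritesVar]; tauto
@[simp] theorem Prog.writesArr_forLoop (a i lim : ℕ) (c : Prog) :
    (Prog.forLoop i lim c).WritesArr a ↔ c.WritesArr a := by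
  simp [Prog.forLoop, Prog.WritesArr]

/-- The states agree on everything that the program `c` does not write. -/
structure SameOff (c : Prog) (s s' : State) : Prop where
  var : ∀ x, ¬ c.WritesVar x → s'.var x = s.var x
  arr : ∀ a, ¬ c.WritesArr a → s'.arr a = s.arr a

theorem Runs.sameOff {Y : ℕ} {c : Prog} {s : State} {T : ℕ} {Q : State → Prop}
    (h : Runs Y c s T Q) : Runs Y c s T fun s' => Q s' ∧ SameOff c s s' :=
  h.frame.mono le_rfl fun _ h => ⟨h.1, h.2.1, h.2.2⟩

theorem Prog.sameOff_run {c : Prog} (s : State) : SameOff c s (c.run s) := by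
  classical
  induction c generalizing s with
  | skip | loop => exact ⟨fun _ _ => rfl, fun _ _ => rfl⟩
  | assign x e => exact ⟨fun y hy => (State.setVar_var ..).trans (if_neg hy), fun _ _ => rfl⟩
  | write a i e =>
    refine ⟨fun _ _ => rfl, fun b hb => funext fun l => ?_⟩
    exact (State.setArr_arr ..).trans (if_neg fun h => hb h.1)
  | seq c₁ c₂ ih₁ ih₂ =>
    exact ⟨fun x hx => ((ih₂ _).var x fun h => hx (.inr h)).trans
        ((ih₁ _).var x fun h => hx (.inl h)),
      fun a ha => ((ih₂ _).arr a fun h => ha (.inr h)).trans ((ih₁ _).arr a fun h => ha (.inl h))⟩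
  | ite b c₁ c₂ ih₁ ih₂ =>
    rw [run]
    split_ifs
    · exact ⟨fun x hx => (ih₁ s).var x fun h => hx (.inl h),
        fun a ha => (ih₁ s).arr a fun h => ha (.inl h)⟩
    · exact ⟨fun x hx => (ih₂ s).var x fun h => hx (.inr h),
        fun a ha => (ih₂ s).arr a fun h => ha (.inr h)⟩

theorem SameOff.small {Y : ℕ} {c : Prog} {s s' : State} (h : SameOff c s s') (hs : s.Small Y)
    (hv : ∀ x, c.WritesVar x → |s'.var x| ≤ (Y : ℤ))
    (ha : ∀ a, c.WritesArr a → ∀ i, |s'.arr a i| ≤ (Y : ℤ)) : s'.Small Y where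
  var x := by
    by_cases hx : c.WritesVar x
    exacts [hv x hx, h.var x hx ▸ hs.var x]
  arr a i := by
    by_cases hx : c.WritesArr a
    exacts [ha a hx i, h.arr a hx ▸ hs.arr a i]

/-- The rule for a loop whose invariant need not mention what the loop does not write. -/
theorem Runs.forLoop' {Y : ℕ} (hY : 2 ≤ Y) {i lim : ℕ} {body : Prog} {T N : ℕ} {s₀ : State}
    (Inv : ℕ → State → Prop) (hne : i ≠ lim) (hlim : s₀.var lim = N) (hN : N ≤ Y)
    (hi : ¬ body.WritesVar i) (hl : ¬ body.WritesVar lim)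
    (hs : s₀.Small Y) (h0 : Inv 0 (s₀.setVar i 0))
    (hstep : ∀ k < N, ∀ s, s.var i = (k : ℤ) → s.Small Y →
      SameOff (Prog.forLoop i lim body) s₀ s → Inv k s →
      Runs Y body s T fun s' => s'.Small Y ∧
        (SameOff body s s' → Inv (k + 1) (s'.setVar i (k + 1)))) :
    Runs Y (Prog.forLoop i lim body) s₀ (N * (T + 10) + 10) fun s' =>
      Inv N s' ∧ s'.Small Y ∧ SameOff (Prog.forLoop i lim body) s₀ s' := by
  refine (Runs.forLoop hY (T := T) (fun k s => Inv k s ∧ s.Small Y ∧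
    SameOff (Prog.forLoop i lim body) s₀ s) hne hlim hi hl (fun k s h => h.2.1) hs ?_ ?_)
  · refine ⟨h0, hs.setVar (by simp), fun x hx => ?_, fun _ _ => rfl⟩
    rw [Prog.writesVar_forLoop, not_or] at hx
    simp [hx.1]
  · rintro k hk s h1 - ⟨h3, h4, h5⟩
    refine (hstep k hk s h1 h4 h5 h3).sameOff.mono le_rfl ?_
    rintro s' ⟨⟨h6, h7⟩, h8⟩
    refine ⟨h6, h7 h8, h6.setVar ?_, fun x hx => ?_, fun a ha => ?_⟩
    · rw [abs_of_nonneg (by positivity)]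
      exact_mod_cast (by omega : k + 1 ≤ Y)
    · have hx' := hx
      rw [Prog.writesVar_forLoop, not_or] at hx
      rw [State.setVar_var, if_neg hx.1, h8.var x hx.2, h5.var x hx']
    · have ha' := ha
      rw [Prog.writesArr_forLoop] at ha
      rw [State.setVar_arr, h8.arr a ha, h5.arr a ha']

/-! ### The decision for one job, as a program -/

/- Names of the variables of the program. The variables below `21` are not written by the program
for a single decision. The numbers `0`, `1`, `2` are those of the input and the answer. `VP` and
`VR` hold the total lengths of all jobs and of the r-jobs, `VD` holds `P + 1`, and `VE` holds the number
of entries in a layer of the table. -/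
notation "Vn" => (0 : ℕ)
notation "VK" => (1 : ℕ)
notation "Vans" => (2 : ℕ)
notation "VP" => (3 : ℕ)
notation "VR" => (4 : ℕ)
notation "VD" => (5 : ℕ)
notation "VE" => (6 : ℕ)
notation "Vlim" => (7 : ℕ)
notation "Vt" => (8 : ℕ)
notation "Vi" => (9 : ℕ)
notation "Vk" => (10 : ℕ)
notation "Vj" => (11 : ℕ)
notation "Vp" => (12 : ℕ)
notation "Vd" => (13 : ℕ)
notation "Vw" => (14 : ℕ)
notation "Vr" => (15 : ℕ)
notation "Vb" => (16 : ℕ)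
notation "Vs" => (17 : ℕ)
notation "Vx" => (18 : ℕ)
notation "Vv" => (19 : ℕ)
notation "Vm" => (20 : ℕ)
notation "Vbest" => (21 : ℕ)
notation "Vcls" => (22 : ℕ)
notation "VbNew" => (23 : ℕ)
notation "VxNew" => (24 : ℕ)
notation "VvNew" => (25 : ℕ)
notation "VmNew" => (26 : ℕ)
notation "Vtmp" => (27 : ℕ)
notation "Vcnt" => (28 : ℕ)
notation "Vopt" => (29 : ℕ)
notation "Vstart" => (30 : ℕ)

/- Names of the arrays of the program: the input, the output, the jobs in the order of due dates,
their classes, the table of the dynamic program, and the jobs in their given order. -/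
notation "Ap" => (0 : ℕ)
notation "Ad" => (1 : ℕ)
notation "Aw" => (2 : ℕ)
notation "Ar" => (3 : ℕ)
notation "Aout" => (4 : ℕ)
notation "Aord" => (5 : ℕ)
notation "Acls" => (6 : ℕ)
notation "Atab" => (7 : ℕ)
notation "Aid" => (8 : ℕ)

namespace DP

/-- The number of a state in the table: its entries are the digits in base `D`. -/
def St.code (D : ℤ) (t : St) : ℤ := (((t.b * D + t.s) * D + t.x) * D + t.v) * D + t.m

end DP

open Renting.Expr Renting.DP

/-- The state of the dynamic program that is stored in the variables. -/
def State.cur (s : State) : St := ⟨s.var Vb, s.var Vs, s.var Vx, s.var Vv, s.var Vm⟩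

/-- The job that is stored in the variables. -/
def State.curJob (s : State) : Job := ⟨s.var Vp, s.var Vd, s.var Vw, s.var Vr⟩

/-- The decision that is stored in the variables. No decision changes the entry `s`, so it needs no
variable of its own. -/
def State.choice (s : State) : Choice :=
  ⟨s.var Vbest, s.var Vcls, ⟨s.var VbNew, s.var Vs, s.var VxNew, s.var VvNew, s.var VmNew⟩⟩

/-- The address of a state in the layer of the table for the next job. -/
def nextAddr (b x v m : Expr) : Expr :=
  (var Vk + const 1) * var VE +
    ((((b * var VD + var Vs) * var VD + x) * var VD + v) * var VD + m)

/-- The program for `DP.better`. -/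
def tryOption (A : Cond) (c : ℤ) (b x v m : Expr) : Prog :=
  .ite A
    (.block [
      .assign Vtmp (read Atab (nextAddr b x v m)),
      .ite (.not (.le (var Vbest) (var Vtmp)))
        (.block [
          .assign Vbest (var Vtmp),
          .assign Vcls (const c),
          .assign VbNew b,
          .assign VxNew x,
          .assign VvNew v,
          .assign VmNew m])
        .skip])
    .skip

/-- Equality as a test. -/
def Cond.eq (e f : Expr) : Cond := .and (.le e f) (.le f e)

@[simp] theorem Cond.holds_eq (s : State) (e f : Expr) :
    (Cond.eq e f).Holds s ↔ e.eval s = f.eval s := by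
  simp [Cond.eq, le_antisymm_iff]

/-- The program for `DP.choose`. -/
def chooseProg : Prog :=
  .block [
    .assign Vbest (var Vw + read Atab (nextAddr (var Vb) (var Vx) (var Vv) (var Vm))),
    .assign Vcls (const 4 - const 2 * var Vr),
    .assign VbNew (var Vb),
    .assign VxNew (var Vx),
    .assign VvNew (var Vv),
    .assign VmNew (var Vm),
    tryOption
      (.and (.eq (var Vr) (const 1)) (.le (var Vs + var Vv + var Vm + var Vp) (var Vd)))
      1 (var Vb) (var Vx) (var Vv + var Vp) (var Vm),
    tryOption
      (.and (.eq (var Vr) (const 0)) (.and (.eq (var Vb) (const 0))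
        (.and (.le (var Vx + var Vp) (var Vs)) (.le (var Vx + var Vp) (var Vd)))))
      0 (var Vb) (var Vx + var Vp) (var Vv) (var Vm),
    tryOption
      (.and (.eq (var Vr) (const 0)) (.and (.eq (var Vb) (const 0))
        (.and (.le (var Vs + var Vv + var Vm + var Vp) (var Vd))
          (.le (var Vm + var Vp + var VR) (var VK)))))
      1 (var Vb) (var Vx) (var Vv) (var Vm + var Vp),
    tryOption
      (.and (.eq (var Vr) (const 0))
        (.le (var Vs + var VR + var Vm + var Vb * var Vx + var Vp) (var Vd)))
      3 (const 1) (var Vb * var Vx + var Vp) (var Vv) (var Vm)]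

/-- The value of the expression depends on variables below `21` only. -/
def Expr.Stable (e : Expr) : Prop :=
  ∀ s s' : State, (∀ x < 21, s'.var x = s.var x) → e.eval s' = e.eval s

/-- The table is required to be correct at the new state only if the test succeeds; otherwise this
state may lie outside the table. -/
theorem tryOption_run {Y : ℕ} {A : Cond} {c : ℤ} {b x v m : Expr} (hb : b.Stable) (hx : x.Stable)
    (hv : v.Stable) (hm : m.Stable) {s : State} (hs : ∀ i, |s.arr Atab i| ≤ (Y : ℤ))
    (hs' : |s.var Vtmp| ≤ (Y : ℤ)) {g : St → ℤ} {t : St}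
    (ht : (⟨b.eval s, s.var Vs, x.eval s, v.eval s, m.eval s⟩ : St) = t)
    (hg : A.Holds s → s.arr Atab ((s.var Vk + 1) * s.var VE + t.code (s.var VD)) = g t) :
    ((tryOption A c b x v m).run s).choice = better g (A.Holds s) c t s.choice ∧
      |((tryOption A c b x v m).run s).var Vtmp| ≤ (Y : ℤ) ∧
      (∀ y < 21, ((tryOption A c b x v m).run s).var y = s.var y) ∧
      ((tryOption A c b x v m).run s).arr = s.arr := by
  classical
  have hw : ∀ y < 21, ((tryOption A c b x v m).run s).var y = s.var y := by
    intro y hy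
    refine (Prog.sameOff_run s).var y ?_
    simp [tryOption, Prog.WritesVar]
    omega
  have ha : ((tryOption A c b x v m).run s).arr = s.arr := by
    funext a
    refine (Prog.sameOff_run s).arr a ?_
    simp [tryOption, Prog.WritesArr]
  refine ⟨?_, ?_, hw, ha⟩
  · by_cases hA : A.Holds s
    · have hg' : s.arr Atab ((nextAddr b x v m).eval s) = g t := by
        rw [← hg hA, ← ht]
        simp [nextAddr, St.code]
      have eb (s' : State) (h : ∀ x < 21, s'.var x = s.var x) := hb s s' h
      have ex (s' : State) (h : ∀ x < 21, s'.var x = s.var x) := hx s s' h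
      have ev (s' : State) (h : ∀ x < 21, s'.var x = s.var x) := hv s s' h
      have em (s' : State) (h : ∀ x < 21, s'.var x = s.var x) := hm s s' h
      simp only [tryOption, Prog.run, hA, if_true, Prog.run_block_cons, Prog.run_block_nil,
        Cond.holds_not, Cond.holds_le, eval_var, eval_read, hg', State.setVar_var]
      by_cases hlt : g t < s.var Vbest
      · have h2 : ¬ s.var Vbest ≤ g t := not_le.2 hlt
        simp only [Nat.reduceEqDiff, if_false, h2, not_false_eq_true, if_true]
        rw [better, if_pos ⟨trivial, hlt⟩, ← ht]
        simp only [State.choice, State.setVar_var, Nat.reduceEqDiff, if_false, if_true, eval_const]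
        congr 2
        · refine eb _ fun y hy => ?_
          simp only [State.setVar_var]
          split_ifs <;> omega
        · refine ex _ fun y hy => ?_
          simp only [State.setVar_var]
          split_ifs <;> omega
        · refine ev _ fun y hy => ?_
          simp only [State.setVar_var]
          split_ifs <;> omega
        · refine em _ fun y hy => ?_
          simp only [State.setVar_var]
          split_ifs <;> omega
      · have h2 : s.var Vbest ≤ g t := not_lt.1 hlt
        simp only [Nat.reduceEqDiff, if_false, h2, not_true_eq_false]
        rw [better, if_neg fun h => hlt h.2]
        simp [State.choice]
    · simp [tryOption, Prog.run, hA, better]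
  · simp only [tryOption, Prog.run, Prog.run_block_cons, Prog.run_block_nil]
    split_ifs <;> simp [hs, hs']

/-- If the table contains the prices of the later jobs in the next layer, the program finds the
decision of the dynamic program. -/
theorem chooseProg_run {Y : ℕ} {s : State} (hs : ∀ i, |s.arr Atab i| ≤ (Y : ℤ))
    (hs' : |s.var Vtmp| ≤ (Y : ℤ)) {P : ℤ} {g : St → ℤ} (hR : 0 ≤ s.var VR)
    (hq : s.curJob.Good P) (ht : s.cur.InBox P)
    (hg : ∀ t, t.InBox P →
      s.arr Atab ((s.var Vk + 1) * s.var VE + t.code (s.var VD)) = g t) :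
    (chooseProg.run s).choice = choose (s.var VR) (s.var VK) g s.curJob s.cur ∧
      |(chooseProg.run s).var Vtmp| ≤ (Y : ℤ) ∧
      (∀ x < 21, (chooseProg.run s).var x = s.var x) ∧ (chooseProg.run s).arr = s.arr := by
  have hbox {c : ℤ} (h : Allowed (s.var VR) (s.var VK) s.curJob c s.cur) :=
    h.inBox hR hq ht
  -- The state after the tentative decision that the job is tardy.
  set s₀ : State := (Prog.block [
    .assign Vbest (var Vw + read Atab (nextAddr (var Vb) (var Vx) (var Vv) (var Vm))),
    .assign Vcls (const 4 - const 2 * var Vr),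
    .assign VbNew (var Vb),
    .assign VxNew (var Vx),
    .assign VvNew (var Vv),
    .assign VmNew (var Vm)]).run s with hs0
  have h0v : ∀ x < 21, s₀.var x = s.var x := by
    intro y hy
    refine (Prog.sameOff_run s).var y ?_
    simp [Prog.WritesVar]
    omega
  have h0a : s₀.arr = s.arr := by
    funext a
    refine (Prog.sameOff_run s).arr a ?_
    simp [Prog.WritesArr]
  have h0t : |s₀.var Vtmp| ≤ (Y : ℤ) := by
    rw [(Prog.sameOff_run s).var Vtmp]
    · exact hs'
    · simp [Prog.WritesVar]
  have h0c : s₀.choice = ⟨s.curJob.w + g s.cur, 4 - 2 * s.curJob.r, s.cur⟩ := by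
    have := hg s.cur ht
    simp only [St.code, State.cur] at this
    simp [hs0, Prog.run, State.choice, nextAddr, State.curJob, State.cur, ← this]
  unfold choose
  rw [← h0c]
  have step {A : Cond} {c : ℤ} {b x v m : Expr} (hb : b.Stable) (hx : x.Stable)
      (hv : v.Stable) (hm : m.Stable) {A' : Prop} {t : St} (hA : A.Holds s ↔ A')
      (hAs : ∀ s' : State, (∀ x < 21, s'.var x = s.var x) → (A.Holds s' ↔ A.Holds s))
      (ht : (⟨b.eval s, s.var Vs, x.eval s, v.eval s, m.eval s⟩ : St) = t)
      (hA' : A' → t.InBox P) {s' : State} (hv' : ∀ x < 21, s'.var x = s.var x)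
      (ha' : s'.arr = s.arr) (ht' : |s'.var Vtmp| ≤ (Y : ℤ)) {a : Choice} (hc : s'.choice = a) :
      (∀ y < 21, ((tryOption A c b x v m).run s').var y = s.var y) ∧
      ((tryOption A c b x v m).run s').arr = s.arr ∧
      |((tryOption A c b x v m).run s').var Vtmp| ≤ (Y : ℤ) ∧
      ((tryOption A c b x v m).run s').choice = better g A' c t a := by
    have hAA : A.Holds s' = A' := propext ((hAs s' hv').trans hA)
    obtain ⟨h1, h2, h3, h4⟩ := tryOption_run (A := A) (c := c) hb hx hv hm (s := s')
      (by rw [ha']; exact hs) ht' (g := g) (t := t)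
      (by rw [hb s s' hv', hx s s' hv', hv s s' hv', hm s s' hv', hv' _ (by norm_num)]; exact ht)
      (by
        intro h
        rw [ha', hv' _ (by norm_num), hv' _ (by norm_num), hv' _ (by norm_num)]
        exact hg t (hA' (hAA ▸ h)))
    exact ⟨fun x hx => (h3 x hx).trans (hv' x hx), h4.trans ha', h2, by rw [h1, hAA, hc]⟩
  obtain ⟨h1v, h1a, h1t, h1c⟩ := step (c := 1)
    (A := .and (.eq (var Vr) (const 1)) (.le (var Vs + var Vv + var Vm + var Vp) (var Vd)))
    (b := var Vb) (x := var Vx) (v := var Vv + var Vp) (m := var Vm)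
    (A' := s.curJob.r = 1 ∧ s.cur.s + s.cur.v + s.cur.m + s.curJob.p ≤ s.curJob.d)
    (t := { s.cur with v := s.cur.v + s.curJob.p })
    (by intro s s' h; simp [h]) (by intro s s' h; simp [h]) (by intro s s' h; simp [h])
    (by intro s s' h; simp [h]) (by simp [State.cur, State.curJob]) (by intro s' h; simp [h])
    (by simp [State.cur, State.curJob])
    (fun h => by simpa [next, h.1] using hbox (.inl ⟨rfl, h.1, h.2⟩)) h0v h0a h0t rfl
  obtain ⟨h2v, h2a, h2t, h2c⟩ := step (c := 0)
    (A := .and (.eq (var Vr) (const 0)) (.and (.eq (var Vb) (const 0))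
        (.and (.le (var Vx + var Vp) (var Vs)) (.le (var Vx + var Vp) (var Vd)))))
    (b := var Vb) (x := var Vx + var Vp) (v := var Vv) (m := var Vm)
    (A' := s.curJob.r = 0 ∧ s.cur.b = 0 ∧ s.cur.x + s.curJob.p ≤ s.cur.s ∧
      s.cur.x + s.curJob.p ≤ s.curJob.d)
    (t := { s.cur with x := s.cur.x + s.curJob.p })
    (by intro s s' h; simp [h]) (by intro s s' h; simp [h]) (by intro s s' h; simp [h])
    (by intro s s' h; simp [h]) (by simp [State.cur, State.curJob]) (by intro s' h; simp [h])
    (by simp [State.cur, State.curJob])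
    (fun h => by simpa [next] using hbox (.inr (.inl ⟨rfl, h⟩))) h1v h1a h1t h1c
  obtain ⟨h3v, h3a, h3t, h3c⟩ := step (c := 1)
    (A := .and (.eq (var Vr) (const 0)) (.and (.eq (var Vb) (const 0))
        (.and (.le (var Vs + var Vv + var Vm + var Vp) (var Vd))
          (.le (var Vm + var Vp + var VR) (var VK)))))
    (b := var Vb) (x := var Vx) (v := var Vv) (m := var Vm + var Vp)
    (A' := s.curJob.r = 0 ∧ s.cur.b = 0 ∧
      s.cur.s + s.cur.v + s.cur.m + s.curJob.p ≤ s.curJob.d ∧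
      s.cur.m + s.curJob.p + s.var VR ≤ s.var VK)
    (t := { s.cur with m := s.cur.m + s.curJob.p })
    (by intro s s' h; simp [h]) (by intro s s' h; simp [h]) (by intro s s' h; simp [h])
    (by intro s s' h; simp [h]) (by simp [State.cur, State.curJob]) (by intro s' h; simp [h])
    (by simp [State.cur, State.curJob])
    (fun h => by simpa [next, h.1] using hbox (.inr (.inr (.inl ⟨rfl, h⟩)))) h2v h2a h2t h2c
  obtain ⟨h4v, h4a, h4t, h4c⟩ := step (c := 3)
    (A := .and (.eq (var Vr) (const 0))
        (.le (var Vs + var VR + var Vm + var Vb * var Vx + var Vp) (var Vd)))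
    (b := const 1) (x := var Vb * var Vx + var Vp) (v := var Vv) (m := var Vm)
    (A' := s.curJob.r = 0 ∧
      s.cur.s + s.var VR + s.cur.m + s.cur.b * s.cur.x + s.curJob.p ≤ s.curJob.d)
    (t := { s.cur with b := 1, x := s.cur.b * s.cur.x + s.curJob.p })
    (by intro s s' h; simp) (by intro s s' h; simp [h]) (by intro s s' h; simp [h])
    (by intro s s' h; simp [h]) (by simp [State.cur, State.curJob]) (by intro s' h; simp [h])
    (by simp [State.cur, State.curJob])
    (fun h => by simpa [next] using hbox (.inr (.inr (.inr (.inl ⟨rfl, h⟩))))) h3v h3a h3t h3c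
  exact ⟨h4c, h4t, h4v, h4a⟩

/-! ### Counting through the states -/

/-- The successor of the current state in the order of the codes. -/
def succProg : Prog :=
  .block [
    .assign Vm (var Vm + const 1),
    .ite (.le (var VD) (var Vm))
      (.block [.assign Vm (const 0), .assign Vv (var Vv + const 1)]) .skip,
    .ite (.le (var VD) (var Vv))
      (.block [.assign Vv (const 0), .assign Vx (var Vx + const 1)]) .skip,
    .ite (.le (var VD) (var Vx))
      (.block [.assign Vx (const 0), .assign Vs (var Vs + const 1)]) .skip,
    .ite (.le (var VD) (var Vs))
      (.block [.assign Vs (const 0), .assign Vb (var Vb + const 1)]) .skip]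

namespace DP

/-- All entries of the state except `b` are digits in base `D`. -/
structure St.IsDigits (D : ℤ) (t : St) : Prop where
  b : 0 ≤ t.b
  s : 0 ≤ t.s ∧ t.s < D
  x : 0 ≤ t.x ∧ t.x < D
  v : 0 ≤ t.v ∧ t.v < D
  m : 0 ≤ t.m ∧ t.m < D

theorem digit_inj {D a a' r r' : ℤ} (hr : 0 ≤ r ∧ r < D) (hr' : 0 ≤ r' ∧ r' < D)
    (h : a * D + r = a' * D + r') : a = a' ∧ r = r' := by
  have : a = a' := by
    rcases lt_trichotomy a a' with h1 | h1 | h1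
    · nlinarith
    · exact h1
    · nlinarith
  subst this
  exact ⟨rfl, by linarith⟩

theorem St.IsDigits.code_inj {D : ℤ} {t t' : St} (ht : t.IsDigits D) (ht' : t'.IsDigits D)
    (h : t.code D = t'.code D) : t = t' := by
  unfold St.code at h
  obtain ⟨h, hm⟩ := digit_inj ht.m ht'.m h
  obtain ⟨h, hv⟩ := digit_inj ht.v ht'.v h
  obtain ⟨h, hx⟩ := digit_inj ht.x ht'.x h
  obtain ⟨hb, hs⟩ := digit_inj ht.s ht'.s h
  cases t
  cases t'
  simp_all

theorem St.InBox.isDigits {P : ℤ} {t : St} (h : t.InBox P) : t.IsDigits (P + 1) :=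
  ⟨h.b.1, ⟨h.s.1, by linarith [h.s.2]⟩, ⟨h.x.1, by linarith [h.x.2]⟩, ⟨h.v.1, by linarith [h.v.2]⟩,
    ⟨h.m.1, by linarith [h.m.2]⟩⟩

/-- The number of states in the range of the table. -/
def layerSize (P : ℤ) : ℤ := 2 * (P + 1) ^ 4

theorem St.IsDigits.code_bounds {P : ℤ} {t : St} (h : t.IsDigits (P + 1)) :
    t.b * (P + 1) ^ 4 ≤ t.code (P + 1) ∧ t.code (P + 1) < (t.b + 1) * (P + 1) ^ 4 := by
  obtain ⟨hb, ⟨hs, hs'⟩, ⟨hx, hx'⟩, ⟨hv, hv'⟩, ⟨hm, hm'⟩⟩ := h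
  unfold St.code
  generalize P + 1 = D at *
  have hD : 0 < D := by omega
  have key {a r l u : ℤ} (hr : 0 ≤ r) (hr' : r < D) (h1 : l ≤ a) (h2 : a < u) :
      l * D ≤ a * D + r ∧ a * D + r < u * D := by
    constructor <;> nlinarith
  obtain ⟨a1, a2⟩ := key hs hs' (le_refl t.b) (lt_add_one t.b)
  obtain ⟨a1, a2⟩ := key hx hx' a1 a2
  obtain ⟨a1, a2⟩ := key hv hv' a1 a2
  obtain ⟨a1, a2⟩ := key hm hm' a1 a2
  constructor
  · calc t.b * D ^ 4 = t.b * D * D * D * D := by ring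
      _ ≤ _ := a1
  · calc _ < (t.b + 1) * D * D * D * D := a2
      _ = _ := by ring

theorem St.InBox.code_bounds {P : ℤ} {t : St} (h : t.InBox P) :
    0 ≤ t.code (P + 1) ∧ t.code (P + 1) < layerSize P := by
  obtain ⟨h1, h2⟩ := h.isDigits.code_bounds
  have hP : (0 : ℤ) ≤ (P + 1) ^ 4 := by positivity
  have hb := h.b
  unfold layerSize
  constructor <;> nlinarith

theorem St.IsDigits.inBox {P : ℤ} {t : St} (h : t.IsDigits (P + 1))
    (h' : t.code (P + 1) < layerSize P) : t.InBox P := by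
  obtain ⟨h1, h2⟩ := h.code_bounds
  obtain ⟨hb, hs, hx, hv, hm⟩ := h
  have hP : (0 : ℤ) < (P + 1) ^ 4 := pow_pos (by linarith [hs.1, hs.2]) 4
  refine ⟨⟨hb, ?_⟩, ⟨hs.1, by linarith [hs.2]⟩, ⟨hx.1, by linarith [hx.2]⟩,
    ⟨hv.1, by linarith [hv.2]⟩, ⟨hm.1, by linarith [hm.2]⟩⟩
  unfold layerSize at h'
  by_contra! hb2
  nlinarith

end DP

/-- The carry runs through the digits; the entry `b` counts the overflows and is not reduced. -/
theorem succProg_run {s : State} (h : s.cur.IsDigits (s.var VD)) :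
    (succProg.run s).cur.IsDigits (s.var VD) ∧
      (succProg.run s).cur.code (s.var VD) = s.cur.code (s.var VD) + 1 ∧
      (succProg.run s).var Vb ≤ s.var Vb + 1 := by
  obtain ⟨hb, hs, hx, hv, hm⟩ := h
  simp only [State.cur] at hb hs hx hv hm
  have hD : 0 < s.var VD := by omega
  simp only [succProg, Prog.run_block_cons, Prog.run_block_nil, Prog.run, Cond.holds_le, eval_var,
    eval_add, eval_const, State.setVar_var]
  by_cases h1 : s.var VD ≤ s.var Vm + 1 <;> [by_cases h2 : s.var VD ≤ s.var Vv + 1;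
    have h2 := not_le.2 hv.2] <;> [by_cases h3 : s.var VD ≤ s.var Vx + 1;
    have h3 := not_le.2 hx.2; have h3 := not_le.2 hx.2] <;>
    [by_cases h4 : s.var VD ≤ s.var Vs + 1; have h4 := not_le.2 hs.2; have h4 := not_le.2 hs.2;
      have h4 := not_le.2 hs.2] <;>
  · simp only [State.setVar_var, h1, h2, h3, h4, State.cur, if_true, if_false, Nat.reduceEqDiff,
      St.code]
    refine ⟨⟨?_, ?_, ?_, ?_, ?_⟩, ?_, ?_⟩
    · dsimp only; omega
    · dsimp only; omega
    · dsimp only; omega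
    · dsimp only; omega
    · dsimp only; omega
    · try rw [(by omega : s.var Vm = s.var VD - 1)]
      try rw [(by omega : s.var Vv = s.var VD - 1)]
      try rw [(by omega : s.var Vx = s.var VD - 1)]
      try rw [(by omega : s.var Vs = s.var VD - 1)]
      ring
    · omega

/-! ### Bucket sort -/

section buckets

variable {n : ℕ}

/-- The entries of the list with keys `0, …, T - 1`, one key after the other; `off` is added to
each key. -/
def buckets (key : Fin n → ℤ) (off : ℤ) (L : List (Fin n)) (T : ℕ) : List (Fin n) :=
  (List.range T).flatMap fun t : ℕ => L.filter fun j => key j + off = t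

variable {key : Fin n → ℤ} {off : ℤ} {L : List (Fin n)} {T : ℕ}

theorem buckets_succ : buckets key off L (T + 1) =
    buckets key off L T ++ L.filter fun j => key j + off = T := by
  simp [buckets, List.range_succ]

theorem length_buckets_le : (buckets key off L T).length ≤ T * L.length := by
  induction T with
  | zero => simp [buckets]
  | succ T ih =>
    rw [buckets_succ, List.length_append, Nat.succ_mul]
    exact add_le_add ih (List.length_filter_le _ _)

theorem mem_buckets {j : Fin n} :
    j ∈ buckets key off L T ↔ j ∈ L ∧ 0 ≤ key j + off ∧ key j + off < T := by
  simp only [buckets, List.mem_flatMap, List.mem_range, List.mem_filter, decide_eq_true_eq]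
  constructor
  · rintro ⟨t, ht, hj, h⟩
    exact ⟨hj, by omega, by omega⟩
  · rintro ⟨hj, h0, hT⟩
    exact ⟨(key j + off).toNat, by omega, hj, by omega⟩

theorem nodup_buckets (hL : L.Nodup) : (buckets key off L T).Nodup := by
  induction T with
  | zero => simp [buckets]
  | succ T ih =>
    rw [buckets_succ]
    refine List.Nodup.append ih (hL.filter _) fun j h1 h2 => ?_
    have h1 := (mem_buckets.1 h1).2.2
    have h2 := (List.mem_filter.1 h2).2
    rw [decide_eq_true_eq] at h2
    omega

theorem pairwise_buckets : (buckets key off L T).Pairwise fun i j => key i ≤ key j := by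
  induction T with
  | zero => simp [buckets]
  | succ T ih =>
    rw [buckets_succ, List.pairwise_append]
    refine ⟨ih, ?_, fun i hi j hj => ?_⟩
    · refine List.Pairwise.imp_of_mem (R := fun _ _ => True) ?_
        (by simp [List.pairwise_iff_getElem])
      intro i j hi hj _
      have h1 := (List.mem_filter.1 hi).2
      have h2 := (List.mem_filter.1 hj).2
      rw [decide_eq_true_eq] at h1 h2
      omega
    · have h1 := (mem_buckets.1 hi).2.2
      have h2 := (List.mem_filter.1 hj).2
      rw [decide_eq_true_eq] at h2
      omega

/-- The first cells of array `a` contain the list. -/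
def Stores (s : State) (a : ℕ) (L : List (Fin n)) : Prop :=
  ∀ k (h : k < L.length), s.arr a (k : ℤ) = ((L[k] : ℕ) : ℤ)

theorem Stores.congr {s s' : State} {a : ℕ} {L : List (Fin n)} (h : Stores s a L)
    (h' : s'.arr a = s.arr a) : Stores s' a L := fun k hk => by rw [h']; exact h k hk

theorem Stores.append {s s' : State} {a : ℕ} {L : List (Fin n)} (h : Stores s a L) {j : Fin n}
    (h' : ∀ l, s'.arr a l = if l = (L.length : ℤ) then ((j : ℕ) : ℤ) else s.arr a l) :
    Stores s' a (L ++ [j]) := by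
  intro k hk
  rw [List.length_append, List.length_singleton] at hk
  rw [h']
  by_cases hkL : k = L.length
  · subst hkL
    simp
  · rw [if_neg (by exact_mod_cast hkL), h k (by omega), List.getElem_append_left]

end buckets

/-- Moves one entry of array `src` to the end of array `dst` if it has the current key. -/
def collectStep (src key dst : ℕ) (off : ℤ) : Prog :=
  .block [
    .assign Vj (read src (var Vi)),
    .ite (.eq (read key (var Vj) + const off) (var Vt))
      (.block [.write dst (var Vcnt) (var Vj), .assign Vcnt (var Vcnt + const 1)])
      .skip]

/-- Writes the `buckets` of the list in array `src` to array `dst`. -/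
def collectProg (src key dst : ℕ) (off : ℤ) : Prog :=
  .seq (.assign Vcnt (const 0)) (.forLoop Vt Vlim (.forLoop Vi Vn (collectStep src key dst off)))

/-- One pass over array `src` for each key. With `T` keys this takes time `O(T * n)`, which is
within `O(n * P ^ 4)` for keys in a range of length `P + 2`, whereas sorting by comparisons would
need time `n * log n`. -/
theorem collectProg_runs {n Y T : ℕ} (hY : 2 ≤ Y) {src key dst : ℕ} {off : ℤ} (hsrc : src ≠ dst)
    (hkey : key ≠ dst) {s : State} (hs : s.Small Y) (hn : s.var Vn = n) (hlim : s.var Vlim = T)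
    (hTn : T * n ≤ Y) {L : List (Fin n)} (hL : Stores s src L) (hlen : L.length = n)
    {f : Fin n → ℤ} (hf : ∀ j : Fin n, s.arr key ((j : ℕ) : ℤ) = f j) :
    Runs Y (collectProg src key dst off) s
      (T * (n * ((collectStep src key dst off).time + 10) + 20) + 20) fun s' =>
        Stores s' dst (buckets f off L T) ∧ s'.Small Y ∧
          SameOff (collectProg src key dst off) s s' := by
  have hnY : n ≤ Y := by
    have := hs.var Vn
    rw [hn, abs_of_nonneg (by positivity)] at this
    exact_mod_cast this
  have hTY : T ≤ Y := by
    have := hs.var Vlim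
    rw [hlim, abs_of_nonneg (by positivity)] at this
    exact_mod_cast this
  have hs0 : (s.setVar Vcnt 0).Small Y := hs.setVar (by simp)
  have main := Runs.forLoop' hY (i := Vt) (lim := Vlim)
    (body := .forLoop Vi Vn (collectStep src key dst off)) (s₀ := s.setVar Vcnt 0)
    (T := n * ((collectStep src key dst off).time + 10) + 10) (N := T)
    (fun t s' => Stores s' dst (buckets f off L t) ∧
      s'.var Vcnt = (buckets f off L t).length)
    (by norm_num) (by simpa using hlim) hTY (by simp [collectStep, Prog.WritesVar])
    (by simp [collectStep, Prog.WritesVar]) hs0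
    ⟨fun k hk => by simp [buckets] at hk, by simp [buckets]⟩ ?_
  · refine (Runs.seq (T₁ := 2) hY ⟨_, 2, .assign s Vcnt (const 0)
      ((const 0).fits_of_small hY hs).1, le_rfl, main⟩).mono ?_ ?_
    · have : T * (n * ((collectStep src key dst off).time + 10) + 20) =
        T * (n * ((collectStep src key dst off).time + 10) + 10 + 10) := rfl
      omega
    · rintro s' ⟨⟨h1, -⟩, h2, h3⟩
      refine ⟨h1, h2, fun x hx => ?_, fun a ha => ?_⟩
      · have hx' : x ≠ Vcnt ∧ ¬ (Prog.forLoop Vt Vlim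
            (.forLoop Vi Vn (collectStep src key dst off))).WritesVar x := by
          simpa [collectProg, Prog.WritesVar] using hx
        rw [h3.var x hx'.2, State.setVar_var, if_neg hx'.1]
      · exact h3.arr a fun h => ha (.inr h)
  · intro t ht s₁ hst hs₁ hoff ⟨hst1, hcnt1⟩
    have hn1 : s₁.var Vn = n := by
      rw [hoff.var Vn (by simp [collectStep, Prog.WritesVar])]
      simpa using hn
    refine (Runs.forLoop' hY (i := Vi) (lim := Vn) (N := n)
      (T := (collectStep src key dst off).time) (fun i s' =>
        Stores s' dst (buckets f off L t ++ (L.take i).filter fun j => f j + off = t) ∧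
        s'.var Vcnt = (buckets f off L t ++ (L.take i).filter fun j => f j + off = t).length)
      (by norm_num) hn1 hnY (by simp [collectStep, Prog.WritesVar])
      (by simp [collectStep, Prog.WritesVar]) hs₁
      ⟨by simpa using hst1.congr (s' := s₁.setVar Vi 0) rfl, by simpa using hcnt1⟩
      ?_).mono le_rfl ?_
    · intro i hi s₂ hsi hs₂ hoff₂ ⟨hst2, hcnt2⟩
      have hi' : i < L.length := by omega
      set acc := buckets f off L t ++ (L.take i).filter fun j => f j + off = t with hacc
      have hcntY : acc.length + 1 ≤ Y := by
        have h1 := length_buckets_le (key := f) (off := off) (L := L) (T := t)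
        have h2 := List.length_filter_le (fun j => decide (f j + off = t)) (L.take i)
        rw [List.length_take] at h2
        have h3 : (t + 1) * n ≤ T * n := Nat.mul_le_mul_right _ ht
        rw [hlen] at h1
        rw [Nat.succ_mul] at h3
        rw [hacc, List.length_append]
        omega
      have htake : (L.take (i + 1)).filter (fun j => decide (f j + off = t)) =
          (L.take i).filter (fun j => decide (f j + off = t)) ++
            if f L[i] + off = t then [L[i]] else [] := by
        rw [List.take_add_one, List.getElem?_eq_getElem hi', List.filter_append]
        by_cases h : f L[i] + off = t <;> simp [h]
      have hsrc2 : s₂.arr src (i : ℤ) = ((L[i] : ℕ) : ℤ) := by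
        rw [hoff₂.arr src (by simp [collectStep, Prog.WritesArr, hsrc]),
          hoff.arr src (by simp [collectStep, Prog.WritesArr, hsrc])]
        exact hL i hi'
      have hkey2 : s₂.arr key ((L[i] : ℕ) : ℤ) = f L[i] := by
        rw [hoff₂.arr key (by simp [collectStep, Prog.WritesArr, hkey]),
          hoff.arr key (by simp [collectStep, Prog.WritesArr, hkey])]
        exact hf _
      have ht2 : s₂.var Vt = t := by
        rw [hoff₂.var Vt (by simp [collectStep, Prog.WritesVar]), hst]
      have hjY : |((L[i] : ℕ) : ℤ)| ≤ Y := hsrc2 ▸ hs₂.arr src i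
      refine (Runs.of_loopFree (by simp [collectStep, Prog.LoopFree]) hY hs₂
        (Q := fun s' => s'.Small Y ∧
          Stores s' dst (buckets f off L t ++ (L.take (i + 1)).filter fun j => f j + off = t) ∧
          s'.var Vcnt = (buckets f off L t ++
            (L.take (i + 1)).filter fun j => f j + off = t).length) ?_).mono le_rfl ?_
      · rw [htake, ← List.append_assoc, ← hacc]
        by_cases h : f L[i] + off = t
        · simp only [collectStep, Prog.run_block_cons, Prog.run_block_nil, Prog.run, eval_read,
            eval_var, hsi, hsrc2, Cond.holds_eq, eval_add, eval_const, State.setVar_var, if_true,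
            State.setVar_arr, hkey2, Nat.reduceEqDiff, if_false, ht2, h, hcnt2, State.setArr_var]
          refine ⟨((hs₂.setVar hjY).setArr hjY).setVar ?_, hst2.append fun l => ?_, ?_⟩
          · rw [abs_of_nonneg (by positivity)]
            exact_mod_cast hcntY
          · simp
          · simp
        · simp only [collectStep, Prog.run_block_cons, Prog.run_block_nil, Prog.run, eval_read,
            eval_var, hsi, hsrc2, Cond.holds_eq, eval_add, eval_const, State.setVar_var, if_true,
            State.setVar_arr, hkey2, Nat.reduceEqDiff, if_false, ht2, h]
          refine ⟨hs₂.setVar hjY, ?_, ?_⟩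
          · rw [List.append_nil]
            exact hst2.congr rfl
          · simpa using hcnt2
      · rintro s' ⟨h1, h2, h3⟩
        exact ⟨h1, fun _ => ⟨h2.congr rfl, by simpa using h3⟩⟩
    · rintro s' ⟨⟨h1, h2⟩, h3, -⟩
      rw [List.take_of_length_le hlen.le, ← buckets_succ] at h1 h2
      exact ⟨h3, fun _ => ⟨h1.congr rfl, by simpa using h2⟩⟩

/-! ### Preparation of the instance -/

/-- The numbers that the program has to store are at most `Y`. -/
structure Bounds (I : Inst) (Y : ℕ) : Prop where
  five : 5 ≤ Y
  jobs : 5 * I.n ≤ Y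
  weight : I.totalW ≤ Y
  keys : (I.totalP + 2) * (I.n + 1) ≤ Y
  table : 2 * (I.totalP + 1) ^ 4 ≤ Y

/-- The part of the input that the program leaves unchanged is in memory. -/
structure Basic (I : Inst) (Y : ℕ) (s : State) : Prop where
  small : s.Small Y
  n : s.var Vn = I.n
  budget : s.var VK = I.budget
  p : ∀ j : Fin I.n, s.arr Ap ((j : ℕ) : ℤ) = I.p j
  w : ∀ j : Fin I.n, s.arr Aw ((j : ℕ) : ℤ) = I.w j
  r : ∀ j : Fin I.n, s.arr Ar ((j : ℕ) : ℤ) = (I.job j).r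

theorem Basic.of_sameOff {I : Inst} {Y : ℕ} {s s' : State} {c : Prog} (h : Basic I Y s)
    (hs : s'.Small Y) (hc : SameOff c s s') (hv : ¬ c.WritesVar Vn ∧ ¬ c.WritesVar VK)
    (ha : ¬ c.WritesArr Ap ∧ ¬ c.WritesArr Aw ∧ ¬ c.WritesArr Ar) : Basic I Y s' where
  small := hs
  n := (hc.var _ hv.1).trans h.n
  budget := (hc.var _ hv.2).trans h.budget
  p j := by rw [hc.arr _ ha.1]; exact h.p j
  w j := by rw [hc.arr _ ha.2.1]; exact h.w j
  r j := by rw [hc.arr _ ha.2.2]; exact h.r j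

/-- The sum of the first `i` values of `f`. -/
def psum {n : ℕ} (f : Fin n → ℤ) (i : ℕ) : ℤ := ∑ j : Fin n, if (j : ℕ) < i then f j else 0

theorem psum_zero {n : ℕ} (f : Fin n → ℤ) : psum f 0 = 0 := by simp [psum]

theorem psum_succ {n : ℕ} (f : Fin n → ℤ) {i : ℕ} (hi : i < n) :
    psum f (i + 1) = psum f i + f ⟨i, hi⟩ := by
  have h : f ⟨i, hi⟩ = ∑ j : Fin n, if j = ⟨i, hi⟩ then f j else 0 := by simp
  rw [h, psum, psum, ← Finset.sum_add_distrib]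
  refine Finset.sum_congr rfl fun j _ => ?_
  by_cases h1 : (j : ℕ) < i
  · have h2 : j ≠ ⟨i, hi⟩ := fun h => by simp [h] at h1
    simp [h1, h2, h1.trans (Nat.lt_succ_self i)]
  · by_cases h2 : j = ⟨i, hi⟩
    · simp [h2]
    · have h3 : ¬ (j : ℕ) < i + 1 := fun h => h2 (Fin.ext (by simp only; omega))
      simp [h1, h2, h3]

theorem psum_full {n : ℕ} (f : Fin n → ℤ) : psum f n = ∑ j, f j := by simp [psum]

theorem psum_bounds {n : ℕ} {f g : Fin n → ℤ} (h : ∀ j, 0 ≤ f j ∧ f j ≤ g j) (i : ℕ) :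
    0 ≤ psum f i ∧ psum f i ≤ ∑ j, g j := by
  constructor
  · exact Finset.sum_nonneg fun j _ => by split_ifs; exacts [(h j).1, le_rfl]
  · refine Finset.sum_le_sum fun j _ => ?_
    split_ifs
    exacts [(h j).2, (h j).1.trans (h j).2]

/-- Adds one job to the sums `P` and `R`. -/
def sumsStep : Prog :=
  .block [
    .assign VP (var VP + read Ap (var Vi)),
    .assign VR (var VR + read Ap (var Vi) * read Ar (var Vi)),
    .write Aid (var Vi) (var Vi)]

/-- Computes `P` and `R`, and lists the jobs in array `Aid`. -/
def sumsProg : Prog := .forLoop Vi Vn sumsStep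

theorem sumsProg_runs {I : Inst} {Y : ℕ} (hB : Bounds I Y) {s : State} (hs : Basic I Y s)
    (hP : s.var VP = 0) (hR : s.var VR = 0) :
    Runs Y sumsProg s (I.n * (sumsStep.time + 10) + 10) fun s' =>
      (s'.var VP = I.totalP ∧ s'.var VR = I.rTotal ∧ Stores s' Aid (List.finRange I.n)) ∧
        s'.Small Y ∧ SameOff sumsProg s s' := by
  have hY := hB.five
  have hjobs := hB.jobs
  have hPY : (I.totalP : ℤ) ≤ Y := by
    have := hB.keys
    exact_mod_cast (by nlinarith : I.totalP ≤ Y)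
  have hpr (j : Fin I.n) : (0 : ℤ) ≤ I.p j * (I.job j).r ∧ (I.p j : ℤ) * (I.job j).r ≤ I.p j := by
    have : (0 : ℤ) ≤ I.p j := by positivity
    rcases Inst.job_r_cases j with h | h <;> simp [h]
  have hsumP : ∑ j, (I.p j : ℤ) = I.totalP := by simp [Inst.totalP]
  have hsumR : ∑ j, (I.p j : ℤ) * (I.job j).r = I.rTotal := by
    refine Finset.sum_congr rfl fun j _ => ?_
    by_cases h : j ∈ I.rJobs
    · simp [h, Inst.job_r_eq_one.2 h]
    · simp [h, Inst.job_r_eq_zero.2 h]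
  refine (Runs.forLoop' (by omega) (i := Vi) (lim := Vn) (N := I.n) (T := sumsStep.time)
    (fun i s' => s'.var VP = psum (fun j => (I.p j : ℤ)) i ∧
      s'.var VR = psum (fun j => (I.p j : ℤ) * (I.job j).r) i ∧
      Stores s' Aid ((List.finRange I.n).take i))
    (by norm_num) hs.n (by omega) (by simp [sumsStep, Prog.WritesVar])
    (by simp [sumsStep, Prog.WritesVar]) hs.small
    ⟨by simpa [psum_zero] using hP, by simpa [psum_zero] using hR, fun k hk => by simp at hk⟩
    ?_).mono le_rfl ?_
  · intro i hi s₁ hsi hs₁ hoff ⟨h1, h2, h3⟩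
    have hb : Basic I Y s₁ := hs.of_sameOff hs₁ hoff (by simp [sumsStep, Prog.WritesVar])
      (by simp [sumsStep, Prog.WritesArr])
    have hp := hb.p ⟨i, hi⟩
    have hr := hb.r ⟨i, hi⟩
    dsimp only at hp hr
    have e1 := psum_succ (fun j => (I.p j : ℤ)) hi
    have e2 := psum_succ (fun j => (I.p j : ℤ) * (I.job j).r) hi
    have b1 := psum_bounds (f := fun j => (I.p j : ℤ)) (g := fun j => (I.p j : ℤ))
      (fun j => ⟨by positivity, le_rfl⟩) (i + 1)
    have b2 := psum_bounds hpr (i + 1)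
    rw [hsumP] at b1 b2
    refine (Runs.of_loopFree (by simp [sumsStep, Prog.LoopFree]) (by omega) hs₁
      (Q := fun s' => s'.Small Y ∧ s'.var VP = psum (fun j => (I.p j : ℤ)) (i + 1) ∧
        s'.var VR = psum (fun j => (I.p j : ℤ) * (I.job j).r) (i + 1) ∧
        Stores s' Aid ((List.finRange I.n).take (i + 1))) ?_).mono le_rfl ?_
    · simp only [sumsStep, Prog.run_block_cons, Prog.run_block_nil, Prog.run, eval_add, eval_mul,
        eval_var, eval_read, State.setVar_var, State.setVar_arr, Nat.reduceEqDiff, if_false,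
        hsi, hp, hr, h1, h2, ← e1, ← e2]
      refine ⟨State.Small.setArr (State.Small.setVar (State.Small.setVar hs₁ ?_) ?_) ?_, ?_, ?_, ?_⟩
      · rw [abs_of_nonneg b1.1]; exact b1.2.trans hPY
      · rw [abs_of_nonneg b2.1]; exact b2.2.trans hPY
      · rw [abs_of_nonneg (by positivity)]; exact_mod_cast (by omega : i ≤ Y)
      · simp
      · simp
      · have hlen : i < (List.finRange I.n).length := by simpa using hi
        rw [List.take_add_one, List.getElem?_eq_getElem hlen]
        refine h3.append fun l => ?_
        simp [hi.le]
    · exact fun s' h => ⟨h.1, fun _ => ⟨by simpa using h.2.1, by simpa using h.2.2.1,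
        h.2.2.2.congr rfl⟩⟩
  · rintro s' ⟨⟨h1, h2, h3⟩, h4, h5⟩
    rw [psum_full, hsumP] at h1
    rw [psum_full, hsumR] at h2
    rw [List.take_of_length_le (by simp)] at h3
    exact ⟨⟨h1, h2, h3⟩, h4, h5⟩

/-- Moves one due date into the range `[-1, P]`. -/
def clipStep : Prog :=
  .block [
    .assign Vd (read Ad (var Vi)),
    .ite (.le (var VP) (var Vd)) (.assign Vd (var VP)) .skip,
    .ite (.le (var Vd) (const (-1))) (.assign Vd (const (-1))) .skip,
    .write Ad (var Vi) (var Vd)]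

/-- Moves all due dates into the range `[-1, P]`. -/
def clipProg : Prog := .forLoop Vi Vn clipStep

theorem clipStep_run {s : State} {d P i : ℤ} (hi : s.var Vi = i) (hd : s.arr Ad i = d)
    (hP : s.var VP = P) :
    (clipStep.run s).arr Ad = Function.update (s.arr Ad) i (max (-1) (min d P)) ∧
      (clipStep.run s).var Vd = max (-1) (min d P) := by
  simp only [clipStep, Prog.run_block_cons, Prog.run_block_nil, Prog.run, eval_read, eval_var,
    eval_const, Cond.holds_le, hi, hd, State.setVar_var, Nat.reduceEqDiff, if_false, if_true, hP]
  by_cases h1 : P ≤ d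
  · simp only [h1, if_true, State.setVar_var, min_eq_right]
    by_cases h2 : P ≤ -1
    · simp [h2, State.setArr, hi]
    · simp [h2, State.setArr, hi, max_eq_right (not_le.1 h2).le]
  · simp only [h1, if_false, State.setVar_var, if_true, min_eq_left (not_le.1 h1).le]
    by_cases h2 : d ≤ -1
    · simp [h2, State.setArr, hi]
    · simp [h2, State.setArr, hi, max_eq_right (not_le.1 h2).le]

theorem clipProg_runs {I : Inst} {Y : ℕ} (hB : Bounds I Y) {s : State} (hs : Basic I Y s)
    (hP : s.var VP = I.totalP) (hd : ∀ j : Fin I.n, s.arr Ad ((j : ℕ) : ℤ) = I.d j) :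
    Runs Y clipProg s (I.n * (clipStep.time + 10) + 10) fun s' =>
      (∀ j : Fin I.n, s'.arr Ad ((j : ℕ) : ℤ) = I.due j) ∧ s'.Small Y ∧ SameOff clipProg s s' := by
  have hY := hB.five
  have hPY : (I.totalP : ℤ) ≤ Y := by
    have := hB.keys
    exact_mod_cast (by nlinarith : I.totalP ≤ Y)
  have hjobs := hB.jobs
  refine (Runs.forLoop' (by omega) (i := Vi) (lim := Vn) (N := I.n) (T := clipStep.time)
    (fun i s' => ∀ j : Fin I.n, s'.arr Ad ((j : ℕ) : ℤ) = if (j : ℕ) < i then I.due j else I.d j)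
    (by norm_num) hs.n (by omega) (by simp [clipStep, Prog.WritesVar])
    (by simp [clipStep, Prog.WritesVar]) hs.small (by simpa using hd) ?_).mono le_rfl ?_
  · intro i hi s₁ hsi hs₁ hoff h1
    have hP1 : s₁.var VP = I.totalP :=
      (hoff.var VP (by simp [clipStep, Prog.WritesVar])).trans hP
    have hdi : s₁.arr Ad (i : ℤ) = I.d ⟨i, hi⟩ := by simpa using h1 ⟨i, hi⟩
    obtain ⟨h2, h3⟩ := clipStep_run hsi hdi hP1
    have hdue : max (-1) (min (I.d ⟨i, hi⟩) (I.totalP : ℤ)) = I.due ⟨i, hi⟩ := rfl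
    rw [hdue] at h2 h3
    have hdY : |I.due ⟨i, hi⟩| ≤ (Y : ℤ) := by
      rw [← hdue]
      have : (0 : ℤ) ≤ I.totalP := by positivity
      have : (5 : ℤ) ≤ Y := by exact_mod_cast hY
      rw [abs_le]
      constructor <;> omega
    refine (Runs.of_loopFree (by simp [clipStep, Prog.LoopFree]) (by omega) hs₁
      (Q := fun s' => s'.Small Y ∧ ∀ j : Fin I.n, s'.arr Ad ((j : ℕ) : ℤ) =
        if (j : ℕ) < i + 1 then I.due j else I.d j) ?_).mono le_rfl fun s' h => ⟨h.1, fun _ => h.2⟩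
    constructor
    · refine (Prog.sameOff_run s₁).small hs₁ (fun x hx => ?_) fun a ha l => ?_
      · obtain rfl : x = Vd := by simpa [clipStep, Prog.WritesVar] using hx
        rwa [h3]
      · obtain rfl : a = Ad := by simpa [clipStep, Prog.WritesArr] using ha
        rw [h2, Function.update_apply]
        split_ifs
        exacts [hdY, hs₁.arr _ _]
    · intro j
      rw [h2, Function.update_apply]
      by_cases hji : (j : ℕ) = i
      · obtain rfl : j = ⟨i, hi⟩ := Fin.ext hji
        simp
      · rw [if_neg (by exact_mod_cast hji), h1]
        have : (j : ℕ) < i + 1 ↔ (j : ℕ) < i := by omega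
        simp [this]
  · rintro s' ⟨h1, h2, h3⟩
    exact ⟨fun j => by rw [h1 j, if_pos j.2], h2, h3⟩

/-- The bucket sort arranges the jobs in the order of their due dates. -/
theorem edd_buckets (I : Inst) : I.EDD (buckets I.due 1 (List.finRange I.n) (I.totalP + 2)) where
  nodup := nodup_buckets (List.nodup_finRange _)
  mem j := by
    refine mem_buckets.2 ⟨List.mem_finRange j, ?_⟩
    simp only [Inst.due]
    push_cast
    omega
  sorted := pairwise_buckets

/-! ### Filling the table -/

/-- The prepared instance is in memory: the sums, the due dates in the range `[-1, P]`, and the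
order `L` of the jobs. -/
structure Ready (I : Inst) (Y : ℕ) (L : List (Fin I.n)) (s : State) : Prop where
  basic : Basic I Y s
  P : s.var VP = I.totalP
  R : s.var VR = I.rTotal
  D : s.var VD = I.totalP + 1
  E : s.var VE = layerSize I.totalP
  d : ∀ j : Fin I.n, s.arr Ad ((j : ℕ) : ℤ) = I.due j
  ord : Stores s Aord L

theorem Ready.of_sameOff {I : Inst} {Y : ℕ} {L : List (Fin I.n)} {s s' : State} {c : Prog}
    (h : Ready I Y L s) (hs : s'.Small Y) (hc : SameOff c s s')
    (hv : ∀ x < 7, x ≠ Vans → ¬ c.WritesVar x) (ha : ∀ a < 6, a ≠ Aout → ¬ c.WritesArr a) :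
    Ready I Y L s' where
  basic := h.basic.of_sameOff hs hc
    ⟨hv _ (by norm_num) (by norm_num), hv _ (by norm_num) (by norm_num)⟩
    ⟨ha _ (by norm_num) (by norm_num), ha _ (by norm_num) (by norm_num),
      ha _ (by norm_num) (by norm_num)⟩
  P := (hc.var _ (hv _ (by norm_num) (by norm_num))).trans h.P
  R := (hc.var _ (hv _ (by norm_num) (by norm_num))).trans h.R
  D := (hc.var _ (hv _ (by norm_num) (by norm_num))).trans h.D
  E := (hc.var _ (hv _ (by norm_num) (by norm_num))).trans h.E
  d j := by rw [hc.arr _ (ha _ (by norm_num) (by norm_num))]; exact h.d j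
  ord := h.ord.congr (hc.arr _ (ha _ (by norm_num) (by norm_num)))

/-- Loads the data of the job in position `k`. -/
def loadStep : Prog :=
  .block [
    .assign Vj (read Aord (var Vk)),
    .assign Vp (read Ap (var Vj)),
    .assign Vd (read Ad (var Vj)),
    .assign Vw (read Aw (var Vj)),
    .assign Vr (read Ar (var Vj))]

theorem loadStep_run {I : Inst} {Y : ℕ} {L : List (Fin I.n)} {s : State} (h : Ready I Y L s)
    {k : ℕ} (hk : k < L.length) (hsk : s.var Vk = k) :
    (loadStep.run s).curJob = I.job L[k] ∧ (loadStep.run s).var Vj = ((L[k] : ℕ) : ℤ) ∧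
      (loadStep.run s).Small Y := by
  have hj := h.ord k hk
  have hp := h.basic.p L[k]
  have hd := h.d L[k]
  have hw := h.basic.w L[k]
  have hr := h.basic.r L[k]
  have hs := h.basic.small
  have bj := hs.arr Aord k
  have bp := hs.arr Ap ((L[k] : ℕ) : ℤ)
  have bd := hs.arr Ad ((L[k] : ℕ) : ℤ)
  have bw := hs.arr Aw ((L[k] : ℕ) : ℤ)
  have br := hs.arr Ar ((L[k] : ℕ) : ℤ)
  simp only [loadStep, Prog.run_block_cons, Prog.run_block_nil, Prog.run, eval_read, eval_var, hsk,
    hj, State.setVar_var, State.setVar_arr, if_true]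
  rw [hj] at bj
  exact ⟨by simp [State.curJob, hp, hd, hw, hr, Inst.job],
    by simp,
    ((((hs.setVar bj).setVar bp).setVar bd).setVar bw).setVar br⟩

/-- The layer of the table for the jobs from position `k` on is correct. -/
def Layer (I : Inst) (L : List (Fin I.n)) (s : State) (k : ℕ) : Prop :=
  ∀ t : St, t.InBox I.totalP →
    s.arr Atab (k * layerSize I.totalP + t.code (I.totalP + 1)) =
      value I.rTotal I.budget ((L.drop k).map I.job) t

theorem abs_value_le {I : Inst} {Y : ℕ} (hB : Bounds I Y) {L : List (Fin I.n)} (hL : L.Nodup)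
    (k : ℕ) (t : St) : |value I.rTotal I.budget ((L.drop k).map I.job) t| ≤ (Y : ℤ) := by
  have hg : ∀ q ∈ (L.drop k).map I.job, q.Good I.totalP := fun q hq => by
    obtain ⟨j, -, rfl⟩ := List.mem_map.1 hq
    exact Inst.job_good j
  rw [abs_of_nonneg (value_nonneg hg t)]
  refine (value_le hg t).trans ?_
  have h1 : (((L.drop k).map I.job).map Job.w).sum = ∑ j ∈ (L.drop k).toFinset, (I.w j : ℤ) := by
    rw [List.sum_toFinset _ (hL.sublist (List.drop_sublist k L)), List.map_map]
    rfl
  rw [h1]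
  refine (Finset.sum_le_univ_sum_of_nonneg fun j => by positivity).trans ?_
  have := hB.weight
  rw [Inst.totalW] at this
  exact_mod_cast this

/-- The decision for the job in position `k`, read off from layer `k + 1` of the table. All
variables stay small because the decision leads to a state in the range of the table. -/
theorem chooseProg_runs_small {I : Inst} {Y : ℕ} (hB : Bounds I Y) {L : List (Fin I.n)}
    (hL : L.Nodup) {k : ℕ} (hk : k < L.length) {s : State} (hready : Ready I Y L s)
    (hsk : s.var Vk = k) (hq : s.curJob = I.job L[k]) (ht : s.cur.InBox I.totalP)
    (hlayer : Layer I L s (k + 1)) :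
    (chooseProg.run s).choice = choose I.rTotal I.budget
        (value I.rTotal I.budget ((L.drop (k + 1)).map I.job)) (I.job L[k]) s.cur ∧
      (chooseProg.run s).choice.next.InBox I.totalP ∧
      (chooseProg.run s).choice.value = value I.rTotal I.budget ((L.drop k).map I.job) s.cur ∧
      (chooseProg.run s).Small Y ∧ ∀ x < 21, (chooseProg.run s).var x = s.var x := by
  have hs := hready.basic.small
  obtain ⟨h1, h2, h3, h4⟩ := chooseProg_run (fun i => hs.arr Atab i) (hs.var Vtmp)
    (g := value I.rTotal I.budget ((L.drop (k + 1)).map I.job))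
    (by rw [hready.R]; exact Inst.rTotal_nonneg) (hq ▸ Inst.job_good L[k]) ht
    (by
      rw [hready.D, hready.E, hsk]
      exact_mod_cast hlayer)
  rw [hready.R, hready.basic.budget, hq] at h1
  obtain ⟨v1, v2, v3⟩ := choose_valid (R := I.rTotal) (K := I.budget)
    (value I.rTotal I.budget ((L.drop (k + 1)).map I.job)) (Inst.job_r_cases L[k]) s.cur
  have hval : (chooseProg.run s).choice.value =
      value I.rTotal I.budget ((L.drop k).map I.job) s.cur := by
    rw [h1, List.drop_eq_getElem_cons hk, List.map_cons, value]
  have hbox : (chooseProg.run s).choice.next.InBox I.totalP := by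
    rw [h1, v2]
    exact v1.inBox Inst.rTotal_nonneg (Inst.job_good _) ht
  have hcls : 0 ≤ (chooseProg.run s).choice.cls ∧ (chooseProg.run s).choice.cls ≤ 4 := by
    rw [h1]
    rcases Inst.job_r_cases L[k] with hr | hr <;>
      rcases v1 with ⟨h, -⟩ | ⟨h, -⟩ | ⟨h, -⟩ | ⟨h, -⟩ | h <;> rw [h] <;> norm_num [hr]
  refine ⟨h1, hbox, hval, ?_, h3⟩
  have hY := hB.five
  have hPY : (I.totalP : ℤ) ≤ Y := by
    have := hB.keys
    exact_mod_cast (by nlinarith : I.totalP ≤ Y)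
  have h5 : (5 : ℤ) ≤ Y := by exact_mod_cast hY
  have habs := abs_value_le hB hL k s.cur
  rw [← hval] at habs
  refine (Prog.sameOff_run s).small hs (fun x hx => ?_) fun a ha => ?_
  · obtain ⟨hb, -, hx', hv, hm⟩ := hbox
    simp only [State.choice] at habs hcls hb hx' hv hm
    have hx2 : x = Vbest ∨ x = Vcls ∨ x = VbNew ∨ x = VxNew ∨ x = VvNew ∨ x = VmNew ∨ x = Vtmp := by
      simp [chooseProg, tryOption, Prog.WritesVar] at hx
      omega
    rcases hx2 with rfl | rfl | rfl | rfl | rfl | rfl | rfl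
    · exact habs
    · rw [abs_of_nonneg hcls.1]; omega
    · rw [abs_of_nonneg hb.1]; omega
    · rw [abs_of_nonneg hx'.1]; omega
    · rw [abs_of_nonneg hv.1]; omega
    · rw [abs_of_nonneg hm.1]; omega
    · exact h2
  · simp [chooseProg, tryOption, Prog.WritesArr] at ha

/-- The address of the current state in the current layer of the table. -/
def curAddr : Expr :=
  var Vk * var VE +
    ((((var Vb * var VD + var Vs) * var VD + var Vx) * var VD + var Vv) * var VD + var Vm)

/-- Fills one entry of the table. -/
def cellStep : Prog := .block [chooseProg, .write Atab curAddr (var Vbest), succProg]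

/-- Prepares a layer of the table. -/
def layerInit : Prog :=
  .block [
    .assign Vk (var Vn - const 1 - var Vt),
    loadStep,
    .assign Vb (const 0),
    .assign Vs (const 0),
    .assign Vx (const 0),
    .assign Vv (const 0),
    .assign Vm (const 0)]

/-- Fills one layer of the table. -/
def layerProg : Prog := .seq layerInit (.forLoop Vi VE cellStep)

/-- Fills the table. -/
def tableProg : Prog := .forLoop Vt Vn layerProg

/-- One entry of layer `k` is filled, and the next state is made the current one. -/
theorem cellStep_run {I : Inst} {Y : ℕ} (hB : Bounds I Y) {L : List (Fin I.n)}
    (hL : L.Nodup) {k : ℕ} (hk : k < L.length) {s : State} (hready : Ready I Y L s)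
    (hsk : s.var Vk = k) (hq : s.curJob = I.job L[k]) (ht : s.cur.InBox I.totalP)
    (hlayer : Layer I L s (k + 1)) :
    (cellStep.run s).Small Y ∧ (cellStep.run s).cur.IsDigits (I.totalP + 1) ∧
      (cellStep.run s).cur.code (I.totalP + 1) = s.cur.code (I.totalP + 1) + 1 ∧
      (cellStep.run s).arr Atab = Function.update (s.arr Atab)
        (k * layerSize I.totalP + s.cur.code (I.totalP + 1))
        (value I.rTotal I.budget ((L.drop k).map I.job) s.cur) := by
  obtain ⟨-, -, h3, h4, h5⟩ := chooseProg_runs_small hB hL hk hready hsk hq ht hlayer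
  set s₁ := chooseProg.run s with hs₁
  have ha1 : s₁.arr = s.arr := by
    funext a
    refine (Prog.sameOff_run s).arr a ?_
    simp [chooseProg, tryOption, Prog.WritesArr]
  have hcur : s₁.cur = s.cur := by simp [State.cur, h5]
  have haddr : curAddr.eval s₁ = k * layerSize I.totalP + s.cur.code (I.totalP + 1) := by
    simp [curAddr, St.code, State.cur, h5, hsk, hready.D, hready.E]
  have hbest : s₁.var Vbest = value I.rTotal I.budget ((L.drop k).map I.job) s.cur := h3
  set s₂ := s₁.setArr Atab (curAddr.eval s₁) (s₁.var Vbest) with hs₂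
  have hs₂small : s₂.Small Y := h4.setArr (hbest ▸ abs_value_le hB hL k s.cur)
  have hD₂ : s₂.var VD = I.totalP + 1 := (h5 VD (by norm_num)).trans hready.D
  have hcur₂ : s₂.cur = s.cur := hcur
  obtain ⟨h6, h7, h8⟩ := succProg_run (s := s₂) (by rw [hD₂, hcur₂]; exact ht.isDigits)
  rw [hD₂] at h6 h7
  rw [hcur₂] at h7
  have hrun : cellStep.run s = succProg.run s₂ := rfl
  have hb₂ : s₂.var Vb = s.var Vb := h5 Vb (by norm_num)
  rw [hrun]
  refine ⟨?_, h6, h7, ?_⟩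
  · have hPY : (I.totalP : ℤ) ≤ Y := by
      have := hB.keys
      exact_mod_cast (by nlinarith : I.totalP ≤ Y)
    have h5 : (5 : ℤ) ≤ Y := by exact_mod_cast hB.five
    refine (Prog.sameOff_run s₂).small hs₂small (fun x hx => ?_) fun a ha => ?_
    · obtain ⟨hb, hs, hx', hv, hm⟩ := h6
      have hbs : s.var Vb ≤ 1 := ht.b.2
      simp only [State.cur] at hb hs hx' hv hm
      have hx2 : x = Vb ∨ x = Vs ∨ x = Vx ∨ x = Vv ∨ x = Vm := by
        simp [succProg, Prog.WritesVar] at hx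
        omega
      rcases hx2 with rfl | rfl | rfl | rfl | rfl
      · rw [abs_of_nonneg hb]; omega
      · rw [abs_of_nonneg hs.1]; omega
      · rw [abs_of_nonneg hx'.1]; omega
      · rw [abs_of_nonneg hv.1]; omega
      · rw [abs_of_nonneg hm.1]; omega
    · simp [succProg, Prog.WritesArr] at ha
  · rw [(Prog.sameOff_run s₂).arr Atab (by simp [succProg, Prog.WritesArr]), hs₂, haddr, hbest]
    simp [State.setArr, ha1]

/-- The layers are filled from the last job to the first. The layer after the last job consists of
zeros, which the memory contains at the start. -/
theorem tableProg_runs {I : Inst} {Y : ℕ} (hB : Bounds I Y) {L : List (Fin I.n)}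
    (hL : L.Nodup) (hlen : L.length = I.n) {s : State} (hready : Ready I Y L s)
    (h0 : ∀ l, s.arr Atab l = 0) :
    Runs Y tableProg s (I.n * (layerInit.time +
        (2 * (I.totalP + 1) ^ 4 * (cellStep.time + 10) + 10) + 1 + 10) + 10) fun s' =>
      (∀ k ≤ I.n, Layer I L s' k) ∧ s'.Small Y ∧ SameOff tableProg s s' := by
  have hY := hB.five
  have hjobs := hB.jobs
  have hE : layerSize I.totalP = ((2 * (I.totalP + 1) ^ 4 : ℕ) : ℤ) := by
    rw [layerSize]; push_cast; rfl
  refine (Runs.forLoop' (by omega) (i := Vt) (lim := Vn) (N := I.n)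
    (T := layerInit.time + (2 * (I.totalP + 1) ^ 4 * (cellStep.time + 10) + 10) + 1)
    (fun t s' => ∀ k ≤ I.n, I.n ≤ k + t → Layer I L s' k)
    (by norm_num) hready.basic.n (by omega)
    (by simp [layerProg, layerInit, loadStep, cellStep, chooseProg, tryOption, succProg,
      Prog.WritesVar])
    (by simp [layerProg, layerInit, loadStep, cellStep, chooseProg, tryOption, succProg,
      Prog.WritesVar])
    hready.basic.small ?_ ?_).mono le_rfl ?_
  · intro k hk hk' t _
    have : k = L.length := by omega
    subst this
    simp [h0, value]
  · intro t ht s₁ hst hs₁ hoff hInv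
    have hr₁ : Ready I Y L s₁ := hready.of_sameOff hs₁ hoff
      (by
        intro x hx hx'
        simp [layerProg, layerInit, loadStep, cellStep, chooseProg, tryOption, succProg,
          Prog.WritesVar]
        omega)
      (by
        intro x hx hx'
        simp [layerProg, layerInit, loadStep, cellStep, chooseProg, tryOption, succProg,
          Prog.WritesArr]
        omega)
    obtain ⟨k, hkt⟩ : ∃ k, k + 1 + t = I.n := ⟨I.n - 1 - t, by omega⟩
    have hk : k < L.length := by omega
    -- The state after the preparation of the layer.
    set s₂ := s₁.setVar Vk k with hs₂
    have hs₂small : s₂.Small Y := hs₁.setVar (by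
      rw [abs_of_nonneg (by positivity)]
      exact_mod_cast (by omega : k ≤ Y))
    have hr₂ : Ready I Y L s₂ := hr₁.of_sameOff (c := .assign Vk (const 0)) hs₂small
      ⟨fun x hx => (State.setVar_var ..).trans (if_neg hx), fun _ _ => rfl⟩
      (by intro x hx _; simp [Prog.WritesVar]; omega) (by simp [Prog.WritesArr])
    obtain ⟨hq, -, hs₃⟩ := loadStep_run hr₂ hk (by simp [hs₂])
    have hinit : layerInit.run s₁ = (((((loadStep.run s₂).setVar Vb 0).setVar Vs 0).setVar Vx
        0).setVar Vv 0).setVar Vm 0 := by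
      have : (var Vn - const 1 - var Vt).eval s₁ = k := by
        simp [hr₁.basic.n, hst]
        omega
      simp only [layerInit, Prog.run_block_cons, Prog.run_block_nil, Prog.run, this, eval_const]
      rfl
    set s₄ := layerInit.run s₁ with hs₄
    have hs₄small : s₄.Small Y := by
      rw [hinit]
      exact ((((hs₃.setVar (by simp)).setVar (by simp)).setVar (by simp)).setVar (by simp)).setVar
        (by simp)
    have hcur₄ : s₄.cur = ⟨0, 0, 0, 0, 0⟩ := by simp [hinit, State.cur]
    have hq₄ : s₄.curJob = I.job L[k] := by
      rw [← hq, hinit]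
      simp [State.curJob]
    have hk₄ : s₄.var Vk = k := by
      have : (loadStep.run s₂).var Vk = s₂.var Vk :=
        (Prog.sameOff_run s₂).var Vk (by simp [loadStep, Prog.WritesVar])
      simp only [hinit, State.setVar_var, Nat.reduceEqDiff, if_false, this]
      simp [hs₂]
    have hr₄ : Ready I Y L s₄ := hr₁.of_sameOff hs₄small (Prog.sameOff_run s₁)
      (by intro x hx hx'; simp [layerInit, loadStep, Prog.WritesVar]; omega)
      (by intro x hx hx'; simp [layerInit, loadStep, Prog.WritesArr])
    have ha₄ : s₄.arr Atab = s₁.arr Atab :=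
      (Prog.sameOff_run s₁).arr Atab (by simp [layerInit, loadStep, Prog.WritesArr])
    have main := Runs.forLoop' (by omega) (i := Vi) (lim := VE) (N := 2 * (I.totalP + 1) ^ 4)
      (T := cellStep.time) (body := cellStep) (s₀ := s₄) (Y := Y)
      (fun i s' => s'.cur.IsDigits (I.totalP + 1) ∧ s'.cur.code (I.totalP + 1) = i ∧
        (∀ l ≤ I.n, k < l → Layer I L s' l) ∧
        ∀ t : St, t.InBox I.totalP → t.code (I.totalP + 1) < i →
          s'.arr Atab (k * layerSize I.totalP + t.code (I.totalP + 1)) =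
            value I.rTotal I.budget ((L.drop k).map I.job) t)
      (by norm_num) (hr₄.E.trans hE) hB.table
      (by simp [cellStep, chooseProg, tryOption, succProg, Prog.WritesVar])
      (by simp [cellStep, chooseProg, tryOption, succProg, Prog.WritesVar]) hs₄small ?_ ?_
    · refine Runs.seq (by omega) (Runs.mono (Runs.of_loopFree
        (by simp [layerInit, loadStep, Prog.LoopFree]) (by omega) hs₁
        (Q := fun s' => s' = s₄) rfl) le_rfl ?_)
      rintro _ rfl
      refine main.mono le_rfl ?_
      rintro s' ⟨⟨-, -, h1, h2⟩, h3, -⟩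
      refine ⟨h3, fun _ l hl hl' t ht => ?_⟩
      rcases eq_or_lt_of_le (by omega : k ≤ l) with rfl | hkl
      · exact h2 t ht (by rw [← hE]; exact ht.code_bounds.2)
      · exact h1 l hl hkl t ht
    · have hcur0 : (s₄.setVar Vi 0).cur = ⟨0, 0, 0, 0, 0⟩ := by
        rw [← hcur₄]; simp [State.cur]
      rw [hcur0]
      have hd : (0 : ℤ) ≤ 0 ∧ (0 : ℤ) < (I.totalP : ℤ) + 1 := ⟨le_rfl, by positivity⟩
      refine ⟨⟨le_rfl, hd, hd, hd, hd⟩, by simp [St.code], fun l hl hkl t ht => ?_,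
        fun t ht h => ?_⟩
      · rw [State.setVar_arr, ha₄]
        exact hInv l hl (by omega) t ht
      · have := ht.code_bounds.1
        simp only [Nat.cast_zero] at h
        omega
    · intro i hi s₅ hsi hs₅ hoff₅ ⟨h1, h2, h3, h4⟩
      have hr₅ : Ready I Y L s₅ := hr₄.of_sameOff hs₅ hoff₅
        (by
          intro x hx hx'
          simp [cellStep, chooseProg, tryOption, succProg, Prog.WritesVar]
          omega)
        (by
          intro x hx hx'
          simp [cellStep, chooseProg, tryOption, succProg, Prog.WritesArr]
          omega)
      have hbox : s₅.cur.InBox I.totalP := h1.inBox (by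
        rw [h2, hE]
        exact_mod_cast hi)
      have hvar (x : ℕ) (hx : 10 ≤ x) (hx' : x < 16) : s₅.var x = s₄.var x :=
        hoff₅.var x (by
          simp [cellStep, chooseProg, tryOption, succProg, Prog.WritesVar]
          omega)
      have hq₅ : s₅.curJob = I.job L[k] := by
        rw [← hq₄]
        simp [State.curJob, hvar]
      have hk₅ : s₅.var Vk = k := (hvar _ (by norm_num) (by norm_num)).trans hk₄
      obtain ⟨c1, c2, c3, c4⟩ := cellStep_run hB hL hk hr₅ hk₅ hq₅ hbox
        (h3 (k + 1) (by omega) (by omega))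
      refine (Runs.of_loopFree
        (by simp [cellStep, chooseProg, tryOption, succProg, Prog.LoopFree]) (by omega) hs₅
        (Q := fun s' => s' = cellStep.run s₅) rfl).mono le_rfl ?_
      rintro _ rfl
      have hcur' : ((cellStep.run s₅).setVar Vi (i + 1)).cur = (cellStep.run s₅).cur := by
        simp [State.cur]
      refine ⟨c1, fun _ => ⟨by rwa [hcur'], by rw [hcur', c3, h2]; push_cast; ring,
        fun l hl hkl t ht => ?_, fun t ht hti => ?_⟩⟩
      · rw [State.setVar_arr, c4, Function.update_of_ne]
        · exact h3 l hl hkl t ht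
        · intro h
          have := (digit_inj ht.code_bounds hbox.code_bounds h).1
          omega
      · rw [State.setVar_arr, c4]
        by_cases hti' : t = s₅.cur
        · rw [hti', Function.update_self]
        · have hne : t.code (I.totalP + 1) ≠ s₅.cur.code (I.totalP + 1) := fun h =>
            hti' (ht.isDigits.code_inj h1 h)
          rw [Function.update_of_ne (by simpa using hne)]
          refine h4 t ht ?_
          rw [h2] at hne
          push_cast at hti
          omega
  · rintro s' ⟨h1, h2, h3⟩
    exact ⟨fun k hk => h1 k hk (by omega), h2, h3⟩

/-! ### The best start of the renting period -/

/-- Compares the start `i` of the renting period with the best one so far. -/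
def bestStep : Prog :=
  .block [
    .assign Vtmp (read Atab (var Vi * var VD * var VD * var VD)),
    .ite (.not (.le (var Vopt) (var Vtmp)))
      (.block [.assign Vopt (var Vtmp), .assign Vstart (var Vi)])
      .skip]

/-- Takes the start `0` as the best one so far. -/
def bestInit : Prog := .block [.assign Vopt (read Atab (const 0)), .assign Vstart (const 0)]

/-- Finds the best start of the renting period. -/
def bestProg : Prog := .seq bestInit (.forLoop Vi VD bestStep)

theorem bestProg_runs {I : Inst} {Y : ℕ} (hB : Bounds I Y) {L : List (Fin I.n)}
    {s : State} (hready : Ready I Y L s) (hlayer : Layer I L s 0) :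
    Runs Y bestProg s (bestInit.time + ((I.totalP + 1) * (bestStep.time + 10) + 10) + 1) fun s' =>
      ((0 ≤ s'.var Vstart ∧ s'.var Vstart ≤ I.totalP) ∧ ∀ x : ℤ, 0 ≤ x → x ≤ I.totalP →
        value I.rTotal I.budget (L.map I.job) (St.init (s'.var Vstart)) ≤
          value I.rTotal I.budget (L.map I.job) (St.init x)) ∧
      s'.Small Y ∧ SameOff bestProg s s' := by
  have hY := hB.five
  have hPY : I.totalP + 2 ≤ Y := by
    have := hB.keys
    nlinarith
  set V : ℤ → ℤ := fun x => value I.rTotal I.budget (L.map I.job) (St.init x) with hV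
  have hs := hready.basic.small
  have htab (x : ℤ) (h0 : 0 ≤ x) (hx : x ≤ I.totalP) :
      s.arr Atab (x * (I.totalP + 1) * (I.totalP + 1) * (I.totalP + 1)) = V x := by
    have hP : (0 : ℤ) ≤ I.totalP := by positivity
    have hd : (0 : ℤ) ≤ 0 ∧ (0 : ℤ) ≤ (I.totalP : ℤ) := ⟨le_rfl, hP⟩
    have := hlayer (St.init x) ⟨⟨le_rfl, by norm_num [St.init]⟩, ⟨h0, hx⟩, hd, hd, hd⟩
    simpa [St.init, St.code, hV] using this
  have h1 : (bestInit.run s).var Vopt = V 0 ∧ (bestInit.run s).var Vstart = 0 := by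
    have := htab 0 le_rfl (by positivity)
    simp only [zero_mul] at this
    simp [bestInit, Prog.run, this]
  have h2 : (bestInit.run s).Small Y := by
    simp only [bestInit, Prog.run_block_cons, Prog.run_block_nil, Prog.run, eval_read, eval_const]
    exact (hs.setVar (hs.arr _ _)).setVar (by simp)
  have h3 : SameOff bestInit s (bestInit.run s) := Prog.sameOff_run s
  have hD : (bestInit.run s).var VD = ((I.totalP + 1 : ℕ) : ℤ) := by
    rw [h3.var VD (by simp [bestInit, Prog.WritesVar]), hready.D]
    push_cast
    rfl
  have main := Runs.forLoop' (by omega) (i := Vi) (lim := VD) (N := I.totalP + 1)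
    (T := bestStep.time) (body := bestStep) (s₀ := bestInit.run s) (Y := Y)
    (fun i s' => (0 ≤ s'.var Vstart ∧ s'.var Vstart ≤ I.totalP) ∧
      s'.var Vopt = V (s'.var Vstart) ∧ ∀ x : ℤ, 0 ≤ x → x < i → V (s'.var Vstart) ≤ V x)
    (by norm_num) hD (by omega) (by simp [bestStep, Prog.WritesVar])
    (by simp [bestStep, Prog.WritesVar]) h2 ?_ ?_
  · refine (Runs.seq_run (by simp [bestInit, Prog.LoopFree]) (by omega) hs main).sameOff.mono
      le_rfl ?_
    rintro s' ⟨⟨⟨h4, -, h5⟩, h6, -⟩, h7⟩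
    exact ⟨⟨h4, fun x h0 hx => h5 x h0 (by push_cast; omega)⟩, h6, h7⟩
  · simp only [State.setVar_var, Nat.reduceEqDiff, if_false, h1]
    exact ⟨⟨le_rfl, by positivity⟩, trivial, fun x h0 hx => by simp at hx; omega⟩
  · intro i hi s₁ hsi hs₁ hoff ⟨h4, h5, h6⟩
    have hD₁ : s₁.var VD = I.totalP + 1 := by
      rw [hoff.var VD (by simp [bestStep, Prog.WritesVar]), hD]
      push_cast
      rfl
    have ha₁ : s₁.arr Atab = s.arr Atab := by
      rw [hoff.arr Atab (by simp [bestStep, Prog.WritesArr]),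
        h3.arr Atab (by simp [bestInit, Prog.WritesArr])]
    have ht : (read Atab (var Vi * var VD * var VD * var VD)).eval s₁ = V i := by
      simp only [eval_read, eval_mul, eval_var, hsi, hD₁, ha₁]
      exact htab i (by positivity) (by omega)
    have hVi : |V i| ≤ (Y : ℤ) := ht ▸ hs₁.arr _ _
    have hiY : |(i : ℤ)| ≤ (Y : ℤ) := by
      rw [abs_of_nonneg (by positivity)]
      exact_mod_cast (by omega : i ≤ Y)
    refine (Runs.of_loopFree (by simp [bestStep, Prog.LoopFree]) (by omega) hs₁
      (Q := fun s' => s'.Small Y ∧ (0 ≤ s'.var Vstart ∧ s'.var Vstart ≤ I.totalP) ∧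
      s'.var Vopt = V (s'.var Vstart) ∧
        ∀ x : ℤ, 0 ≤ x → x < i + 1 → V (s'.var Vstart) ≤ V x) ?_).mono le_rfl ?_
    · simp only [bestStep, Prog.run_block_cons, Prog.run_block_nil, Prog.run, ht, Cond.holds_not,
        Cond.holds_le, eval_var, State.setVar_var, Nat.reduceEqDiff, if_false, if_true, h5]
      by_cases hlt : V (s₁.var Vstart) ≤ V i
      · simp only [hlt, not_true_eq_false, if_false, State.setVar_var, Nat.reduceEqDiff]
        refine ⟨hs₁.setVar hVi, h4, h5, fun x h0 hx => ?_⟩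
        rcases eq_or_lt_of_le (Int.lt_add_one_iff.1 hx) with rfl | hx
        exacts [hlt, h6 x h0 hx]
      · simp only [hlt, not_false_eq_true, if_true, State.setVar_var, Nat.reduceEqDiff, if_false,
          hsi]
        refine ⟨((hs₁.setVar hVi).setVar hVi).setVar hiY, ⟨by positivity, by omega⟩, trivial,
          fun x h0 hx => ?_⟩
        rcases eq_or_lt_of_le (Int.lt_add_one_iff.1 hx) with rfl | hx
        exacts [le_rfl, (not_le.1 hlt).le.trans (h6 x h0 hx)]
    · rintro s' ⟨h7, h8, h9, h10⟩
      refine ⟨h7, fun _ => ?_⟩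
      simp only [State.setVar_var, Nat.reduceEqDiff, if_false]
      push_cast
      exact ⟨h8, h9, h10⟩

/-! ### Following an optimal path -/

/-- Decides on the class of one job. -/
def planStep : Prog :=
  .block [
    .assign Vk (var Vi),
    loadStep,
    chooseProg,
    .write Acls (var Vj) (var Vcls),
    .assign Vb (var VbNew),
    .assign Vx (var VxNew),
    .assign Vv (var VvNew),
    .assign Vm (var VmNew)]

/-- Starts in the best initial state. -/
def planInit : Prog :=
  .block [
    .assign Vb (const 0),
    .assign Vs (var Vstart),
    .assign Vx (const 0),
    .assign Vv (const 0),
    .assign Vm (const 0)]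

/-- Writes the classes of the jobs to array `Acls`. -/
def planProg : Prog := .seq planInit (.forLoop Vi Vn planStep)

/-- The classes that are stored in array `Acls`. -/
def State.classes (s : State) (n : ℕ) (j : Fin n) : ℤ := s.arr Acls ((j : ℕ) : ℤ)

/-- One step along the path `plan`. -/
theorem planStep_run {I : Inst} {Y : ℕ} (hB : Bounds I Y) {L : List (Fin I.n)}
    (hL : L.Nodup) {k : ℕ} (hk : k < L.length) {s : State} (hready : Ready I Y L s)
    (hsk : s.var Vi = k) (ht : s.cur.InBox I.totalP) (hlayer : Layer I L s (k + 1)) :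
    let a := choose I.rTotal I.budget
        (value I.rTotal I.budget ((L.drop (k + 1)).map I.job)) (I.job L[k]) s.cur
    (planStep.run s).Small Y ∧ (planStep.run s).cur = a.next ∧ a.next.InBox I.totalP ∧
      (planStep.run s).classes I.n = Function.update (s.classes I.n) L[k] a.cls := by
  intro a
  have hs := hready.basic.small
  set s₁ := s.setVar Vk k with hs₁
  have hs₁small : s₁.Small Y := hs.setVar (hsk ▸ hs.var Vi)
  have hr₁ : Ready I Y L s₁ := hready.of_sameOff (c := .assign Vk (const 0)) hs₁small
    ⟨fun x hx => (State.setVar_var ..).trans (if_neg hx), fun _ _ => rfl⟩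
    (by intro x hx _; simp [Prog.WritesVar]; omega) (by simp [Prog.WritesArr])
  obtain ⟨hq, hj, hs₂small⟩ := loadStep_run hr₁ hk (by simp [hs₁])
  set s₂ := loadStep.run s₁ with hs₂
  have off₂ : SameOff loadStep s₁ s₂ := Prog.sameOff_run s₁
  have hr₂ : Ready I Y L s₂ := hr₁.of_sameOff hs₂small off₂
    (by intro x hx hx'; simp [loadStep, Prog.WritesVar]; omega)
    (by intro x hx hx'; simp [loadStep, Prog.WritesArr])
  have hv₂ (x : ℕ) (hx : 16 ≤ x) : s₂.var x = s.var x := by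
    rw [off₂.var x (by simp [loadStep, Prog.WritesVar]; omega), hs₁, State.setVar_var,
      if_neg (by omega)]
  have ha₂ : s₂.arr = s.arr := by
    funext b
    exact off₂.arr b (by simp [loadStep, Prog.WritesArr])
  have hcur₂ : s₂.cur = s.cur := by simp [State.cur, hv₂]
  have hk₂ : s₂.var Vk = k := by
    rw [off₂.var Vk (by simp [loadStep, Prog.WritesVar])]
    simp [hs₁]
  obtain ⟨h1, h2, -, hs₃small, h3⟩ := chooseProg_runs_small hB hL hk hr₂ hk₂ hq
    (hcur₂ ▸ ht) (by intro t ht; rw [ha₂]; exact hlayer t ht)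
  rw [hcur₂] at h1
  change _ = a at h1
  set s₃ := chooseProg.run s₂ with hs₃
  have ha₃ : s₃.arr = s.arr := by
    rw [← ha₂]
    funext b
    exact (Prog.sameOff_run s₂).arr b (by simp [chooseProg, tryOption, Prog.WritesArr])
  have hj₃ : s₃.var Vj = ((L[k] : ℕ) : ℤ) := (h3 Vj (by norm_num)).trans hj
  have hrun : planStep.run s = ((((s₃.setArr Acls (s₃.var Vj) (s₃.var Vcls)).setVar Vb
      (s₃.var VbNew)).setVar Vx (s₃.var VxNew)).setVar Vv (s₃.var VvNew)).setVar Vm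
      (s₃.var VmNew) := by
    simp only [planStep, Prog.run_block_cons, Prog.run_block_nil, Prog.run, eval_var, hsk,
      State.setVar_var, State.setArr_var, Nat.reduceEqDiff, if_false]
    rfl
  rw [hrun]
  refine ⟨((((hs₃small.setArr (hs₃small.var _)).setVar (hs₃small.var _)).setVar
    (hs₃small.var _)).setVar (hs₃small.var _)).setVar (hs₃small.var _), ?_, h1 ▸ h2, ?_⟩
  · rw [← h1]
    simp [State.cur, State.choice]
  · funext i
    rw [← h1]
    by_cases hi : i = L[k]
    · subst hi
      simp [State.classes, State.choice, hj₃]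
    · have : ((i : ℕ) : ℤ) ≠ ((L[k] : ℕ) : ℤ) := by
        intro h
        exact hi (Fin.ext (by exact_mod_cast h))
      simp [State.classes, hj₃, hi, this, ha₃]

theorem planProg_runs {I : Inst} {Y : ℕ} (hB : Bounds I Y) {L : List (Fin I.n)}
    (hL : L.Nodup) (hlen : L.length = I.n) {s : State} (hready : Ready I Y L s)
    (hlayer : ∀ k ≤ I.n, Layer I L s k) (hstart : 0 ≤ s.var Vstart ∧ s.var Vstart ≤ I.totalP) :
    Runs Y planProg s (planInit.time + (I.n * (planStep.time + 10) + 10) + 1) fun s' =>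
      s'.classes I.n =
        plan I.rTotal I.budget I.job L (St.init (s.var Vstart)) (s.classes I.n) ∧
      s'.Small Y ∧ SameOff planProg s s' := by
  have hY := hB.five
  have hjobs := hB.jobs
  have hs := hready.basic.small
  have h1 : (planInit.run s).cur = St.init (s.var Vstart) := by
    simp [planInit, Prog.run, State.cur, St.init]
  have h2 : (planInit.run s).Small Y := by
    simp only [planInit, Prog.run_block_cons, Prog.run_block_nil, Prog.run, eval_const, eval_var,
      State.setVar_var, Nat.reduceEqDiff, if_false]
    exact ((((hs.setVar (by simp)).setVar (hs.var _)).setVar (by simp)).setVar (by simp)).setVar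
      (by simp)
  have h3 : SameOff planInit s (planInit.run s) := Prog.sameOff_run s
  have hr₁ : Ready I Y L (planInit.run s) := hready.of_sameOff h2 h3
    (by intro x hx hx'; simp [planInit, Prog.WritesVar]; omega) (by simp [planInit, Prog.WritesArr])
  have main := Runs.forLoop' (by omega) (i := Vi) (lim := Vn) (N := I.n)
    (T := planStep.time) (body := planStep) (s₀ := planInit.run s) (Y := Y)
    (fun i s' => s'.cur.InBox I.totalP ∧
      plan I.rTotal I.budget I.job (L.drop i) s'.cur (s'.classes I.n) =
        plan I.rTotal I.budget I.job L (St.init (s.var Vstart)) (s.classes I.n))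
    (by norm_num) hr₁.basic.n (by omega)
    (by simp [planStep, loadStep, chooseProg, tryOption, Prog.WritesVar])
    (by simp [planStep, loadStep, chooseProg, tryOption, Prog.WritesVar]) h2 ?_ ?_
  · refine (Runs.seq_run (by simp [planInit, Prog.LoopFree]) (by omega) hs main).sameOff.mono
      le_rfl ?_
    rintro s' ⟨⟨⟨-, h4⟩, h5, -⟩, h6⟩
    rw [List.drop_of_length_le hlen.le] at h4
    exact ⟨h4, h5, h6⟩
  · have hcur : ((planInit.run s).setVar Vi 0).cur = St.init (s.var Vstart) := by
      rw [← h1]; simp [State.cur]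
    have hP : (0 : ℤ) ≤ I.totalP := by positivity
    have hd : (0 : ℤ) ≤ 0 ∧ (0 : ℤ) ≤ (I.totalP : ℤ) := ⟨le_rfl, hP⟩
    rw [hcur]
    refine ⟨⟨⟨le_rfl, by norm_num [St.init]⟩, hstart, hd, hd, hd⟩, ?_⟩
    have : ((planInit.run s).setVar Vi 0).classes I.n = s.classes I.n := by
      funext j
      simp only [State.classes, State.setVar_arr]
      rw [h3.arr Acls (by simp [planInit, Prog.WritesArr])]
    rw [this, List.drop_zero]
  · intro i hi s₁ hsi hs₁ hoff ⟨h4, h5⟩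
    have hi' : i < L.length := by omega
    have hr₂ : Ready I Y L s₁ := hr₁.of_sameOff hs₁ hoff
      (by
        intro x hx hx'
        simp [planStep, loadStep, chooseProg, tryOption, Prog.WritesVar]
        omega)
      (by
        intro x hx hx'
        simp [planStep, loadStep, chooseProg, tryOption, Prog.WritesArr]
        omega)
    have ha₁ : s₁.arr Atab = s.arr Atab := by
      rw [hoff.arr Atab (by simp [planStep, loadStep, chooseProg, tryOption, Prog.WritesArr]),
        h3.arr Atab (by simp [planInit, Prog.WritesArr])]
    obtain ⟨g1, g2, g3, g4⟩ := planStep_run hB hL hi' hr₂ hsi h4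
      (by intro t ht; rw [ha₁]; exact hlayer (i + 1) (by omega) t ht)
    refine (Runs.of_loopFree
      (by simp [planStep, loadStep, chooseProg, tryOption, Prog.LoopFree]) (by omega) hs₁
      (Q := fun s' => s' = planStep.run s₁) rfl).mono le_rfl ?_
    rintro _ rfl
    have hcur : ((planStep.run s₁).setVar Vi (i + 1)).cur = (planStep.run s₁).cur := by
      simp [State.cur]
    have hcls : ((planStep.run s₁).setVar Vi (i + 1)).classes I.n =
        (planStep.run s₁).classes I.n := rfl
    refine ⟨g1, fun _ => ⟨by rw [hcur, g2]; exact g3, ?_⟩⟩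
    rw [hcur, hcls, g2, g4, ← h5, List.drop_eq_getElem_cons hi', plan]

/-! ### The whole program -/

/-- Computes the sizes of the table. -/
def sizesStep : Prog :=
  .block [
    .assign VD (var VP + const 1),
    .assign VE (const 2 * (var VD * var VD * var VD * var VD)),
    .assign Vlim (var VD + const 1)]

/-- The part of the program for instances with a feasible sequence. -/
def solveProg : Prog :=
  .seq clipProg <| .seq (collectProg Aid Ad Aord 1) <| .seq tableProg <| .seq bestProg <|
    .seq planProg <| .seq (.assign Vlim (const 5)) <| .seq (collectProg Aord Acls Aout 0)
      (.assign Vans (const 1))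

/-- The program that solves the scheduling problem. -/
def mainProg : Prog :=
  .seq sumsProg <| .seq sizesStep <| .ite (.le (var VR) (var VK)) solveProg .skip

/-- The running time of `solveProg`. -/
def solveTime (n P : ℕ) : ℕ :=
  n * (clipStep.time + 10) + 10 +
  ((P + 2) * (n * ((collectStep Aid Ad Aord 1).time + 10) + 20) + 20 +
  (n * (layerInit.time + (2 * (P + 1) ^ 4 * (cellStep.time + 10) + 10) + 1 + 10) + 10 +
  (bestInit.time + ((P + 1) * (bestStep.time + 10) + 10) + 1 +
  (planInit.time + (n * (planStep.time + 10) + 10) + 1 +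
  (2 + (5 * (n * ((collectStep Aord Acls Aout 0).time + 10) + 20) + 20 + 2 + 1) + 1)
  + 1) + 1) + 1) + 1) + 1

/-- The running time of `mainProg`. -/
def mainTime (n P : ℕ) : ℕ :=
  n * (sumsStep.time + 10) + 10 +
    (sizesStep.time + ((Cond.le (var VR) (var VK)).cost + solveTime n P + 1) + 1) + 1

/-- The term `n * (P + 1) ^ 4` for the table dominates all others. As `P ≥ 1`, it is at most
`16 * n * P ^ 4`, and lower-order terms are absorbed. -/
theorem exists_mainTime_le :
    ∃ c, ∀ n P : ℕ, 0 < n → 0 < P → mainTime n P ≤ c * (n * P ^ 4) := by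
  unfold mainTime solveTime
  generalize clipStep.time = a₁
  generalize (collectStep Aid Ad Aord 1).time = a₂
  generalize layerInit.time = a₃
  generalize cellStep.time = a₄
  generalize bestInit.time = a₅
  generalize bestStep.time = a₆
  generalize planInit.time = a₇
  generalize planStep.time = a₈
  generalize (collectStep Aord Acls Aout 0).time = a₉
  generalize sumsStep.time = b₁
  generalize sizesStep.time = b₂
  generalize (Cond.le (var VR) (var VK)).cost = b₃
  refine ⟨(a₁ + b₁ + 2 * a₂ + a₃ + 5 * a₉ + a₈ + 121) + (a₂ + 10) + (20 + a₆ + 10) +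
    (2 * (a₄ + 10)) * 16 + (a₅ + a₆ + a₇ + b₂ + b₃ + 300), fun n P hn hP => ?_⟩
  set Z := n * P ^ 4 with hZ
  have hP4 : P ≤ P ^ 4 := Nat.le_self_pow (by norm_num) P
  have h1 : n ≤ Z := Nat.le_mul_of_pos_right _ (by positivity)
  have h2 : n * P ≤ Z := Nat.mul_le_mul_left _ hP4
  have h3 : P ≤ Z := hP4.trans (Nat.le_mul_of_pos_left _ hn)
  have h4 : n * (P + 1) ^ 4 ≤ 16 * Z := by
    calc n * (P + 1) ^ 4 ≤ n * (2 * P) ^ 4 := by gcongr; omega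
      _ = 16 * Z := by rw [hZ]; ring
  have h5 : 1 ≤ Z := hn.trans_le h1
  calc _ ≤ (a₁ + b₁ + 2 * a₂ + a₃ + 5 * a₉ + a₈ + 121) * n + (a₂ + 10) * (n * P)
        + (20 + a₆ + 10) * P + (2 * (a₄ + 10)) * (n * (P + 1) ^ 4)
        + (a₅ + a₆ + a₇ + b₂ + b₃ + 300) * 1 := by
        linarith
    _ ≤ (a₁ + b₁ + 2 * a₂ + a₃ + 5 * a₉ + a₈ + 121) * Z + (a₂ + 10) * Z
        + (20 + a₆ + 10) * Z + (2 * (a₄ + 10)) * (16 * Z)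
        + (a₅ + a₆ + a₇ + b₂ + b₃ + 300) * Z := by gcongr
    _ = _ := by ring

/-! ### Correctness and running time -/

/-- The bucket sort for the classes as keys writes down the sequence. -/
theorem buckets_eq_arrange {I : Inst} (c : Fin I.n → ℤ) (L : List (Fin I.n)) :
    buckets c 0 L 5 = Inst.arrange c L := by
  simp [buckets, Inst.arrange, List.range_succ]

/-- If the r-jobs fit into the budget, the program finds an optimal sequence: its cost is the least
value over all starts of the renting period, and no feasible sequence costs less than such a value.
-/
theorem solveProg_runs {I : Inst} {Y : ℕ} (hB : Bounds I Y) {s : State} (hs : Basic I Y s)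
    (hP : s.var VP = I.totalP) (hR : s.var VR = I.rTotal) (hD : s.var VD = I.totalP + 1)
    (hE : s.var VE = layerSize I.totalP) (hlim : s.var Vlim = (I.totalP + 2 : ℕ))
    (hd : ∀ j : Fin I.n, s.arr Ad ((j : ℕ) : ℤ) = I.d j) (hid : Stores s Aid (List.finRange I.n))
    (htab : ∀ l, s.arr Atab l = 0) (hRK : I.rTotal ≤ I.budget) :
    Runs Y solveProg s (solveTime I.n I.totalP) I.Answered := by
  have hY : 2 ≤ Y := by have := hB.five; omega
  have hjobs := hB.jobs
  have hkeys := hB.keys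
  have h5 : (5 : ℤ) ≤ Y := by exact_mod_cast hB.five
  unfold solveProg solveTime
  set L := buckets I.due 1 (List.finRange I.n) (I.totalP + 2) with hLdef
  have hL : I.EDD L := edd_buckets I
  have hlen : L.length = I.n := by
    have := (List.toFinset_card_of_nodup hL.nodup).symm
    rwa [Finset.eq_univ_of_forall fun j => List.mem_toFinset.2 (hL.mem j), Finset.card_fin] at this
  refine Runs.seq hY ((clipProg_runs hB hs hP hd).mono le_rfl ?_)
  rintro s₁ ⟨hd₁, hs₁, off₁⟩
  have hb₁ : Basic I Y s₁ := hs.of_sameOff hs₁ off₁ (by simp [clipProg, clipStep, Prog.WritesVar])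
    (by simp [clipProg, clipStep, Prog.WritesArr])
  have hv₁ (x : ℕ) (hx : x < 8) : s₁.var x = s.var x :=
    off₁.var x (by simp [clipProg, clipStep, Prog.WritesVar]; omega)
  refine Runs.seq hY ((collectProg_runs hY (by norm_num) (by norm_num) hs₁ hb₁.n
    ((hv₁ _ (by norm_num)).trans hlim) (by nlinarith)
    (hid.congr (off₁.arr Aid (by simp [clipProg, clipStep, Prog.WritesArr]))) (by simp)
    hd₁).mono le_rfl ?_)
  rintro s₂ ⟨hord₂, hs₂, off₂⟩
  have hb₂ : Basic I Y s₂ := hb₁.of_sameOff hs₂ off₂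
    (by simp [collectProg, collectStep, Prog.WritesVar])
    (by simp [collectProg, collectStep, Prog.WritesArr])
  have hv₂ (x : ℕ) (hx : x < 8) : s₂.var x = s.var x := by
    rw [off₂.var x (by simp [collectProg, collectStep, Prog.WritesVar]; omega), hv₁ x hx]
  have hr₂ : Ready I Y L s₂ := {
    basic := hb₂
    P := (hv₂ _ (by norm_num)).trans hP
    R := (hv₂ _ (by norm_num)).trans hR
    D := (hv₂ _ (by norm_num)).trans hD
    E := (hv₂ _ (by norm_num)).trans hE
    d := fun j => by
      rw [off₂.arr Ad (by simp [collectProg, collectStep, Prog.WritesArr])]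
      exact hd₁ j
    ord := hord₂ }
  have htab₂ (l : ℤ) : s₂.arr Atab l = 0 := by
    rw [off₂.arr Atab (by simp [collectProg, collectStep, Prog.WritesArr]),
      off₁.arr Atab (by simp [clipProg, clipStep, Prog.WritesArr])]
    exact htab l
  refine Runs.seq hY ((tableProg_runs hB hL.nodup hlen hr₂ htab₂).mono le_rfl ?_)
  rintro s₃ ⟨hlayer, hs₃, off₃⟩
  have hr₃ : Ready I Y L s₃ := hr₂.of_sameOff hs₃ off₃
    (by
      intro x hx hx'
      simp [tableProg, layerProg, layerInit, loadStep, cellStep, chooseProg, tryOption, succProg,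
        Prog.WritesVar]
      omega)
    (by
      intro x hx hx'
      simp [tableProg, layerProg, layerInit, loadStep, cellStep, chooseProg, tryOption, succProg,
        Prog.WritesArr]
      omega)
  refine Runs.seq hY ((bestProg_runs hB hr₃ (hlayer 0 (Nat.zero_le _))).mono le_rfl ?_)
  rintro s₄ ⟨⟨hstart, hbest⟩, hs₄, off₄⟩
  have hr₄ : Ready I Y L s₄ := hr₃.of_sameOff hs₄ off₄
    (by intro x hx hx'; simp [bestProg, bestInit, bestStep, Prog.WritesVar]; omega)
    (by simp [bestProg, bestInit, bestStep, Prog.WritesArr])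
  have hlayer₄ : ∀ k ≤ I.n, Layer I L s₄ k := fun k hk t ht => by
    rw [off₄.arr Atab (by simp [bestProg, bestInit, bestStep, Prog.WritesArr])]
    exact hlayer k hk t ht
  refine Runs.seq hY ((planProg_runs hB hL.nodup hlen hr₄ hlayer₄ hstart).mono le_rfl ?_)
  rintro s₅ ⟨hcls, hs₅, off₅⟩
  have hr₅ : Ready I Y L s₅ := hr₄.of_sameOff hs₅ off₅
    (by
      intro x hx hx'
      simp [planProg, planInit, planStep, loadStep, chooseProg, tryOption, Prog.WritesVar]
      omega)
    (by
      intro x hx hx'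
      simp [planProg, planInit, planStep, loadStep, chooseProg, tryOption, Prog.WritesArr]
      omega)
  set c := s₅.classes I.n with hc
  refine Runs.seq (T₁ := 2) hY (Runs.mono (Runs.of_loopFree (c := .assign Vlim (const 5)) trivial hY
    hs₅ (Q := fun s' => s' = s₅.setVar Vlim 5) rfl) le_rfl ?_)
  rintro _ rfl
  refine Runs.seq (T₂ := 2) hY ((collectProg_runs (T := 5) hY (by norm_num) (by norm_num)
    (hs₅.setVar (x := Vlim) (v := 5) (by simpa using h5)) (by simpa using hr₅.basic.n)
    (by simp) hjobs (hr₅.ord.congr rfl) hlen (f := c) fun j => rfl).mono le_rfl ?_)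
  rintro s₆ ⟨hout, hs₆, -⟩
  refine (Runs.of_loopFree (c := .assign Vans (const 1)) trivial hY
    hs₆ (Q := I.Answered) ?_).mono le_rfl fun _ h => h
  rw [buckets_eq_arrange] at hout
  -- The sequence in the output array realizes an optimal path of the dynamic program.
  obtain ⟨hrun, hcost⟩ := plan_spec (R := I.rTotal) (K := I.budget) Inst.job_r_cases hL.nodup
    (St.init (s₄.var Vstart)) (s₄.classes I.n)
  rw [← hcls] at hrun hcost
  obtain ⟨σ, hσ, hfeas, htardy⟩ := Inst.exists_sequence_of_run hL hRK hstart.1 hrun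
  refine .inl ⟨by simp [Prog.run], σ, ⟨hfeas, fun τ hτ => ?_⟩, fun i => ?_⟩
  · obtain ⟨-, c', x, hx0, hxP, hrun', hcost'⟩ := hτ.exists_run hL
    have h1 := value_le_cost Inst.job_r_cases hrun'
    have h2 := hbest x hx0 hxP
    have : (I.tardyWeight σ : ℤ) ≤ I.tardyWeight τ := by linarith
    exact_mod_cast this
  · have := hout i (by rw [hσ]; simp)
    simp only [hσ, List.getElem_ofFn] at this
    simpa [Prog.run] using this

/-- There is a feasible sequence exactly if the total length of the r-jobs is within the budget.
This test decides between the two answers. -/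
theorem mainProg_runs {I : Inst} {Y : ℕ} (hB : Bounds I Y) (hsmall : I.input.Small Y) :
    Runs Y mainProg I.input (mainTime I.n I.totalP) I.Answered := by
  have hY : 2 ≤ Y := by have := hB.five; omega
  have harr {n : ℕ} (f : Fin n → ℤ) (j : Fin n) : toArray f ((j : ℕ) : ℤ) = f j := by
    simp [toArray]
  have hbasic : Basic I Y I.input := {
    small := hsmall
    n := rfl
    budget := rfl
    p := harr fun j => (I.p j : ℤ)
    w := harr fun j => (I.w j : ℤ)
    r := fun j => harr (fun j => if j ∈ I.rJobs then (1 : ℤ) else 0) j }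
  unfold mainProg mainTime
  refine Runs.seq hY ((sumsProg_runs hB hbasic rfl rfl).mono le_rfl ?_)
  rintro s₁ ⟨⟨hP, hR, hid⟩, hs₁, off₁⟩
  have hb₁ : Basic I Y s₁ := hbasic.of_sameOff hs₁ off₁
    (by simp [sumsProg, sumsStep, Prog.WritesVar]) (by simp [sumsProg, sumsStep, Prog.WritesArr])
  have off₂ : SameOff sizesStep s₁ (sizesStep.run s₁) := Prog.sameOff_run s₁
  have e : (sizesStep.run s₁).var VD = I.totalP + 1 ∧
      (sizesStep.run s₁).var VE = layerSize I.totalP ∧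
      (sizesStep.run s₁).var Vlim = I.totalP + 2 := by
    refine ⟨by simp [sizesStep, Prog.run, hP], ?_, ?_⟩
    · simp [sizesStep, Prog.run, hP, layerSize]
      ring
    · simp [sizesStep, Prog.run, hP]
      ring
  have hPY : I.totalP + 2 ≤ Y := by
    have := hB.keys
    nlinarith
  have hs₂ : (sizesStep.run s₁).Small Y := by
    refine off₂.small hs₁ (fun x hx => ?_) fun a ha => ?_
    · have hx' : x = VD ∨ x = VE ∨ x = Vlim := by simpa [sizesStep, Prog.WritesVar] using hx
      rcases hx' with rfl | rfl | rfl
      · rw [e.1, abs_of_nonneg (by positivity)]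
        exact_mod_cast (by omega : I.totalP + 1 ≤ Y)
      · rw [e.2.1, layerSize, abs_of_nonneg (by positivity)]
        exact_mod_cast hB.table
      · rw [e.2.2, abs_of_nonneg (by positivity)]
        exact_mod_cast hPY
    · simp [sizesStep, Prog.WritesArr] at ha
  refine Runs.seq hY (Runs.mono (Runs.of_loopFree (by simp [sizesStep, Prog.LoopFree]) hY hs₁
    (Q := fun s' => s' = sizesStep.run s₁) rfl) le_rfl ?_)
  rintro _ rfl
  set s₂ := sizesStep.run s₁ with hs₂def
  have hb₂ : Basic I Y s₂ := hb₁.of_sameOff hs₂ off₂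
    (by simp [sizesStep, Prog.WritesVar]) (by simp [sizesStep, Prog.WritesArr])
  have hP₂ : s₂.var VP = I.totalP :=
    (off₂.var VP (by simp [sizesStep, Prog.WritesVar])).trans hP
  have hR₂ : s₂.var VR = I.rTotal :=
    (off₂.var VR (by simp [sizesStep, Prog.WritesVar])).trans hR
  have ha₂ (a : ℕ) (ha : a ≠ Aid) : s₂.arr a = I.input.arr a := by
    rw [off₂.arr a (by simp [sizesStep, Prog.WritesArr]),
      off₁.arr a (by simpa [sumsProg, sumsStep, Prog.WritesArr] using ha)]
  refine Runs.ite hY hs₂ (fun h => ?_) fun h => ?_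
  · refine solveProg_runs hB hb₂ hP₂ hR₂ e.1 e.2.1 (by rw [e.2.2]; push_cast; rfl) (fun j => ?_)
      (hid.congr (off₂.arr Aid (by simp [sizesStep, Prog.WritesArr]))) (fun l => ?_) ?_
    · rw [ha₂ Ad (by norm_num)]
      exact harr _ j
    · rw [ha₂ Atab (by norm_num)]
      rfl
    · simpa [hR₂, hb₂.budget] using h
  · refine (Runs.of_loopFree (c := .skip) trivial hY hs₂ (Q := I.Answered) ?_).mono
      (by simp only [Prog.time, solveTime]; omega) fun _ h => h
    refine .inr ⟨?_, fun σ hσ => h ?_⟩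
    · change s₂.var Vans = 0
      rw [off₂.var Vans (by simp [sizesStep, Prog.WritesVar]),
        off₁.var Vans (by simp [sumsProg, sumsStep, Prog.WritesVar])]
      rfl
    · simpa [hR₂, hb₂.budget] using (hσ.exists_run (edd_buckets I)).1

theorem Inst.n_pos {I : Inst} (hP : 0 < I.totalP) : 0 < I.n := by
  rcases Nat.eq_zero_or_pos I.n with h | h
  · have : IsEmpty (Fin I.n) := by rw [h]; infer_instance
    simp [Inst.totalP] at hP
  · exact h

/-- With `N = 2 + I.magnitude`, a layer of the table has `2 * (P + 1) ^ 4 ≤ N ^ 5` entries, and the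
other numbers to be stored are smaller. -/
theorem bounds_of_magnitude {I : Inst} (hP : 0 < I.totalP) :
    Bounds I ((2 + I.magnitude) ^ 5) ∧ I.input.Small ((2 + I.magnitude) ^ 5) := by
  have hn := Inst.n_pos hP
  set N := 2 + I.magnitude with hN
  have hmag : I.n + I.totalP + I.totalW + (∑ j, (I.d j).natAbs) + I.budget.natAbs + 2 = N := by
    rw [hN, Inst.magnitude, add_comm]
  have h4 : 4 ≤ N := by omega
  have hpow {a b : ℕ} (h : a ≤ b) : N ^ a ≤ N ^ b := Nat.pow_le_pow_right (by omega) h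
  have hN5 : N ≤ N ^ 5 := Nat.le_self_pow (by norm_num) N
  have hN2 : 4 * N ≤ N ^ 2 := by rw [pow_two]; exact Nat.mul_le_mul_right _ h4
  have hN25 : N ^ 2 ≤ N ^ 5 := hpow (by norm_num)
  refine ⟨⟨?_, ?_, ?_, ?_, ?_⟩, ⟨fun x => ?_, fun a i => ?_⟩⟩
  · omega
  · have : N ^ 2 * 4 ≤ N ^ 3 := by rw [pow_succ]; exact Nat.mul_le_mul_left _ h4
    have := hpow (show 3 ≤ 5 by norm_num)
    omega
  · omega
  · calc (I.totalP + 2) * (I.n + 1) ≤ N * N := Nat.mul_le_mul (by omega) (by omega)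
      _ = N ^ 2 := (pow_two N).symm
      _ ≤ N ^ 5 := hN25
  · calc 2 * (I.totalP + 1) ^ 4 ≤ N * N ^ 4 :=
        Nat.mul_le_mul (by omega) (Nat.pow_le_pow_left (by omega) 4)
      _ = N ^ 5 := by ring
  · have h1 : |(I.n : ℤ)| ≤ (N ^ 5 : ℕ) := by
      rw [Nat.abs_cast]
      exact_mod_cast (by omega : I.n ≤ N ^ 5)
    have h2 : |I.budget| ≤ (N ^ 5 : ℕ) := by
      rw [Int.abs_eq_natAbs]
      exact_mod_cast (by omega : I.budget.natAbs ≤ N ^ 5)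
    match x with
    | 0 => exact h1
    | 1 => exact h2
    | n + 2 => simp [Inst.input]
  · have key (f : Fin I.n → ℤ) (hf : ∀ j, (f j).natAbs ≤ N) :
        |toArray f i| ≤ (N ^ 5 : ℕ) := by
      unfold toArray
      split_ifs with h
      · rw [Int.abs_eq_natAbs]
        exact_mod_cast (hf _).trans hN5
      · simp
    match a with
    | 0 =>
      refine key (fun j => (I.p j : ℤ)) fun j => ?_
      have := Finset.single_le_sum (f := I.p) (fun i _ => Nat.zero_le _) (Finset.mem_univ j)
      rw [Int.natAbs_natCast]
      change I.p j ≤ I.totalP at this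
      omega
    | 1 =>
      refine key I.d fun j => ?_
      have := Finset.single_le_sum (f := fun i => (I.d i).natAbs) (fun i _ => Nat.zero_le _)
        (Finset.mem_univ j)
      omega
    | 2 =>
      refine key (fun j => (I.w j : ℤ)) fun j => ?_
      have := Finset.single_le_sum (f := I.w) (fun i _ => Nat.zero_le _) (Finset.mem_univ j)
      rw [Int.natAbs_natCast]
      change I.w j ≤ I.totalW at this
      omega
    | 3 =>
      refine key (fun j => if j ∈ I.rJobs then 1 else 0) fun j => ?_
      split_ifs <;> simp
      omega
    | n + 4 => simp [Inst.input]

end Renting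

theorem mainTheorem5 :
    ∃ (prog : Renting.Prog) (c k : ℕ), ∀ I : Renting.Inst, 0 < I.totalP →
      ∃ (s : Renting.State) (t : ℕ),
        Renting.Exec ((2 + I.magnitude) ^ k) prog I.input s t ∧
        I.Answered s ∧
        t ≤ c * (I.n * I.totalP ^ 4) := by
  obtain ⟨c, hc⟩ := Renting.exists_mainTime_le
  refine ⟨Renting.mainProg, c, 5 * Renting.mainProg.growth, fun I hP => ?_⟩
  obtain ⟨hB, hs⟩ := Renting.bounds_of_magnitude hP
  obtain ⟨s, t, he, ht, ha⟩ := Renting.mainProg_runs hB hs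
  rw [← pow_mul] at he
  exact ⟨s, t, he, ha, ht.trans (hc _ _ (Renting.Inst.n_pos hP) hP)⟩
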